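/- There is a universal constant $c>0$ with the following property. Let $d\ge 1$, $D=[-1,1]^d$, and let $f$ be a real-valued function that admits a Fourier representation $$f(x)=\int_{\mathbb{R}^d}e^{ix\cdot\omega}\,\mathcal{F}(f)(\omega)\,d\omega\qquad(x\in D)$$ with an integrable function $\mathcal{F}(f):\mathbb{R}^d\to\mathbb{C}$ such that $$v_{f,3}=\int_{\mathbb{R}^d}\|\omega\|_1^3\,|\mathcal{F}(f)(\omega)|\,d\omega<\infty .$$ Then $f$ is twice continuously differentiable near $0$, and there is a number $0\le v\le 2v_{f,3}$ such that for every integer $m\ge 1$ there are $b_k\in[-1,1]$, $a_k\in\mathbb{R}^d$ with $\|a_k\|_1=1$, and $t_k\in[0,1]$ ($k=1,\dots,m$) for which the function $$f_m(x)=f(0)+\nabla f(0)\cdot x+\tfrac12\,x^{T}\nabla\nabla^{T}f(0)\,x+\frac{v}{2m}\sum_{k=1}^m b_k\,(a_k\cdot x-t_k)_+^2,\qquad (z)_+=\max(z,0),$$ satisfies $$\sup_{x\in D}|f(x)-f_m(x)|\le c\,v_{f,3}\sqrt d\;m^{-1/2-1/d}.$$ Moreover, for the same $v$ and every $m\ge1$,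 there are $b_k\in\{-1,1\}$, $a_k\in\mathbb{R}^d$ with $\|a_k\|_1=1$, and $t_k\in[0,1]$ for which $f_m$, defined by the same formula, satisfies $$\sup_{x\in D}|f(x)-f_m(x)|\le c\,v_{f,3}\sqrt d\;m^{-1/2-1/(d+2)}.$$ -/

import Mathlib

open MeasureTheory

noncomputable section

/-- The `ℓ¹` norm of a vector of `ℝ^d`. -/
def l1norm {d : ℕ} (a : Fin d → ℝ) : ℝ := ∑ i, |a i|

/-- The cube `[-1,1]^d`. -/
def cube (d : ℕ) : Set (Fin d → ℝ) := {x | ∀ i, x i ∈ Set.Icc (-1 : ℝ) 1}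

/-- `f` has the Fourier representation `f x = ∫ e^{i x·ω} F(ω) dω` on `D`, as a Lebesgue integral
over `ℝ^d` (so that `F` is integrable). -/
def HasFourierRepresentationOn {d : ℕ} (f : (Fin d → ℝ) → ℝ) (F : (Fin d → ℝ) → ℂ)
    (D : Set (Fin d → ℝ)) : Prop :=
  Integrable F ∧
    ∀ x ∈ D, (f x : ℂ) = ∫ ω, Complex.exp (Complex.I * ((x ⬝ᵥ ω : ℝ) : ℂ)) * F ω

/-- The condition `∫ ‖ω‖₁^s |F(ω)| dω < ∞`. -/
def FiniteFourierMoment {d : ℕ} (s : ℕ) (F : (Fin d → ℝ) → ℂ) : Prop :=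
  Integrable fun ω => l1norm ω ^ s * ‖F ω‖

/-- The quantity `v_{f,s} = ∫ ‖ω‖₁^s |F(ω)| dω`. -/
def fourierMoment {d : ℕ} (s : ℕ) (F : (Fin d → ℝ) → ℂ) : ℝ :=
  ∫ ω, l1norm ω ^ s * ‖F ω‖

/-- The gradient, as the vector of partial derivatives. -/
def gradVec {d : ℕ} (f : (Fin d → ℝ) → ℝ) (x : Fin d → ℝ) : Fin d → ℝ :=
  fun i => fderiv ℝ f x (Pi.single i 1)

/-- The Hessian matrix, with entries `∂ᵢ ∂ⱼ f`. -/
def hessMat {d : ℕ} (f : (Fin d → ℝ) → ℝ) (x : Fin d → ℝ) : Matrix (Fin d) (Fin d) ℝ :=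
  Matrix.of fun i j => fderiv ℝ (fun y => gradVec f y j) x (Pi.single i 1)

/-- The combination of squared ReLU ridge functions
`b₀ + a₀·x + xᵀ A₀ x / 2 + (v / 2m) ∑ₖ bₖ (aₖ·x - tₖ)₊²`. -/
def sqReLUCombination {d m : ℕ} (b₀ : ℝ) (a₀ : Fin d → ℝ) (A₀ : Matrix (Fin d) (Fin d) ℝ)
    (v : ℝ) (b : Fin m → ℝ) (a : Fin m → Fin d → ℝ) (t : Fin m → ℝ) (x : Fin d → ℝ) : ℝ :=
  b₀ + a₀ ⬝ᵥ x + (x ⬝ᵥ A₀.mulVec x) / 2 +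
    v / (2 * (m : ℝ)) * ∑ k, b k * (max (a k ⬝ᵥ x - t k) 0) ^ 2

end

/-! Write `V` for `fourierMoment 3 F`. Taylor's formula with integral remainder for `e^{iny}`,
applied with `n = ‖ω‖₁` and `y = (ω/‖ω‖₁)·x`, expresses `f` minus its quadratic Taylor polynomial at
`0` as an integral of squared ReLU ridge functions. Its signed density splits into nonnegative
weights on signed ridge functions `±(a·x - t)₊²` of total mass exactly `V`. The remainder is thus
`V` times an average of ridge functions, and `v = 2V` serves for every `m`
(`exists_ridge_average_fourier`).

The average is replaced by one over a finite sequence of `m * R` parameters, which is divided into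
`m` groups of `R` close ones. One member of each group is drawn at random: stratified sampling. The
error is a sum of independent centred processes on the cube whose increments are controlled by the
group diameters `δ g`. Hoeffding's lemma and chaining (`exists_selection`) give a sup-norm bound of
order `√d * √(∑ δ g ^ 2)`.

The directions `a` fill a sphere of dimension `d - 1` and `t` adds one more, so the parameter set
has dimension `d`, and the squared diameters can be made to sum to `O(m^{1-2/d})`. For `d ≥ 3` this
follows from cell counts at dyadic scales. For `d = 2` those counts would lose a logarithm, and
ordering the parameters along a Hilbert curve avoids it (`exists_hasGrouping`). Division by `m`
gives the rate `m^{-1/2-1/max(d,2)}` with signs `±1`. This is stronger than the second claim and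
contains the first for `d ≥ 2`.

For `d = 1` the first claim asks for `m^{-3/2}`, beyond this rate. There the remainder is an
integral over `t` alone for each direction `±1`, and second-order quadrature with weights in
`[-1,1]` reaches `m^{-2}` (`exists_sum_approx_of_dim_one`). -/

/-! ### Ridge functions and their dependence on the parameters -/

/-- The parameters `(b, a, t)` of a ridge function `b (a·x - t)₊²` with `b = ±1`, `‖a‖₁ = 1`
and `t ∈ [0,1]`. -/
def ridgeParams (d : ℕ) : Set (ℝ × (Fin d → ℝ) × ℝ) :=
  {θ | (θ.1 = -1 ∨ θ.1 = 1) ∧ l1norm θ.2.1 = 1 ∧ θ.2.2 ∈ Set.Icc (0 : ℝ) 1}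

/-- The squared ReLU ridge function with parameters `θ = (b, a, t)`. -/
noncomputable def ridge {d : ℕ} (θ : ℝ × (Fin d → ℝ) × ℝ) (x : Fin d → ℝ) : ℝ :=
  θ.1 * (max (θ.2.1 ⬝ᵥ x - θ.2.2) 0) ^ 2

/-- The distance of parameters: absolute values in `b` and `t`, the `ℓ¹` norm in `a`. -/
def paramDist {d : ℕ} (θ θ' : ℝ × (Fin d → ℝ) × ℝ) : ℝ :=
  |θ.1 - θ'.1| + l1norm (θ.2.1 - θ'.2.1) + |θ.2.2 - θ'.2.2|

lemma l1norm_nonneg {d : ℕ} (a : Fin d → ℝ) : 0 ≤ l1norm a :=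
  Finset.sum_nonneg fun _ _ => abs_nonneg _

lemma l1norm_sub_le {d : ℕ} (a b : Fin d → ℝ) : l1norm (a - b) ≤ l1norm a + l1norm b := by
  unfold l1norm
  rw [← Finset.sum_add_distrib]
  exact Finset.sum_le_sum fun i _ => abs_sub (a i) (b i)

lemma l1norm_smul {d : ℕ} (r : ℝ) (a : Fin d → ℝ) : l1norm (r • a) = |r| * l1norm a := by
  simp [l1norm, abs_mul, Finset.mul_sum]

lemma l1norm_pos {d : ℕ} {a : Fin d → ℝ} (h : a ≠ 0) : 0 < l1norm a := by
  obtain ⟨i, hi⟩ := Function.ne_iff.1 h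
  exact (abs_pos.2 hi).trans_le
    (Finset.single_le_sum (f := fun i => |a i|) (fun _ _ => abs_nonneg _) (Finset.mem_univ i))

lemma continuous_l1norm {d : ℕ} : Continuous (l1norm (d := d)) := by
  unfold l1norm; fun_prop

lemma abs_dotProduct_le {d : ℕ} (a x : Fin d → ℝ) {r : ℝ} (h : ∀ i, |x i| ≤ r) :
    |a ⬝ᵥ x| ≤ l1norm a * r := by
  unfold dotProduct l1norm
  rw [Finset.sum_mul]
  refine (Finset.abs_sum_le_sum_abs _ _).trans (Finset.sum_le_sum fun i _ => ?_)
  rw [abs_mul]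
  exact mul_le_mul_of_nonneg_left (h i) (abs_nonneg _)

lemma mem_cube_iff_abs {d : ℕ} {x : Fin d → ℝ} : x ∈ cube d ↔ ∀ i, |x i| ≤ 1 := by
  simp [cube, abs_le]

lemma zero_mem_cube (d : ℕ) : (0 : Fin d → ℝ) ∈ cube d := by
  simp [mem_cube_iff_abs]

lemma abs_dotProduct_le_of_mem_cube {d : ℕ} (a : Fin d → ℝ) {x : Fin d → ℝ} (hx : x ∈ cube d) :
    |a ⬝ᵥ x| ≤ l1norm a := by
  simpa using abs_dotProduct_le a x (mem_cube_iff_abs.1 hx)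

lemma paramDist_le_five {d : ℕ} {θ θ' : ℝ × (Fin d → ℝ) × ℝ} (h : θ ∈ ridgeParams d)
    (h' : θ' ∈ ridgeParams d) : paramDist θ θ' ≤ 5 := by
  obtain ⟨hb, ha, ht0, ht1⟩ := h
  obtain ⟨hb', ha', ht0', ht1'⟩ := h'
  have h1 : |θ.1 - θ'.1| ≤ 2 := by
    rcases hb with hb | hb <;> rcases hb' with hb' | hb' <;> rw [hb, hb'] <;> norm_num
  have h2 := l1norm_sub_le θ.2.1 θ'.2.1
  have h3 : |θ.2.2 - θ'.2.2| ≤ 1 := by rw [abs_le]; constructor <;> linarith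
  unfold paramDist
  linarith

lemma hasDerivAt_max_zero_sq (z : ℝ) :
    HasDerivAt (fun z : ℝ => (max z 0) ^ 2) (2 * max z 0) z := by
  rcases lt_trichotomy z 0 with h | rfl | h
  · rw [max_eq_right h.le, mul_zero]
    refine (hasDerivAt_const z (0 : ℝ)).congr_of_eventuallyEq ?_
    filter_upwards [gt_mem_nhds h] with y hy
    simp [max_eq_right hy.le]
  · rw [hasDerivAt_iff_isLittleO]
    simp only [max_self, mul_zero, sub_zero, smul_zero, ne_eq, OfNat.ofNat_ne_zero,
      not_false_eq_true, zero_pow]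
    refine Asymptotics.IsBigO.trans_isLittleO (g := fun x : ℝ => x ^ 2) ?_ ?_
    · refine Asymptotics.IsBigO.of_bound 1 (Filter.Eventually.of_forall fun x => ?_)
      rw [one_mul, Real.norm_of_nonneg (sq_nonneg _), Real.norm_of_nonneg (sq_nonneg _)]
      rcases le_total x 0 with hx | hx
      · rw [max_eq_right hx]; simpa using sq_nonneg x
      · rw [max_eq_left hx]
    · simpa using Asymptotics.isLittleO_pow_pow (𝕜 := ℝ) (show 1 < 2 by norm_num)
  · rw [max_eq_left h.le]
    have := (hasDerivAt_id z).pow 2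
    simp only [id_eq, Nat.cast_ofNat, Nat.add_one_sub_one, pow_one, mul_one] at this
    refine this.congr_of_eventuallyEq ?_
    filter_upwards [lt_mem_nhds h] with y hy
    simp [max_eq_left hy.le]

lemma abs_max_zero_sub_le (x y : ℝ) : |max x 0 - max y 0| ≤ |x - y| := by
  simpa using abs_max_sub_max_le_abs x y 0

/-- The difference of two ridge functions is Lipschitz on the cube, with a constant proportional
to the distance of the parameters. -/
lemma abs_ridge_sub_sub_le {d : ℕ} {θ θ' : ℝ × (Fin d → ℝ) × ℝ} (hθ : θ ∈ ridgeParams d)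
    (hθ' : θ' ∈ ridgeParams d) {x y : Fin d → ℝ} (hx : x ∈ cube d) (hy : y ∈ cube d) {r : ℝ}
    (hr : ∀ i, |x i - y i| ≤ r) :
    |(ridge θ x - ridge θ' x) - (ridge θ y - ridge θ' y)| ≤ 4 * paramDist θ θ' * r := by
  obtain ⟨b, a, t⟩ := θ
  obtain ⟨b', a', t'⟩ := θ'
  obtain ⟨hb, ha, ht0, ht1⟩ := hθ
  obtain ⟨hb', ha', ht0', ht1'⟩ := hθ'
  simp only at hb ha ht0 ht1 hb' ha' ht0' ht1'
  have hb1 : |b'| = 1 := by rcases hb' with h | h <;> simp [h]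
  set u := a ⬝ᵥ y - t with hu
  set u' := a' ⬝ᵥ y - t' with hu'
  set e := a ⬝ᵥ (x - y) with he
  set e' := a' ⬝ᵥ (x - y) with he'
  have hE : |e| ≤ r := by
    have := abs_dotProduct_le a (x - y) (r := r) hr
    rwa [ha, one_mul] at this
  have hE' : |e'| ≤ r := by
    have := abs_dotProduct_le a' (x - y) (r := r) hr
    rwa [ha', one_mul] at this
  have hEE : |e - e'| ≤ l1norm (a - a') * r := by
    rw [he, he', ← sub_dotProduct]
    exact abs_dotProduct_le _ _ (by simpa using hr)
  have hr0 : 0 ≤ r := (abs_nonneg _).trans hE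
  -- Mean value inequality for the difference of the two ridge functions along the segment from `y`
  -- to `x`.
  have key := norm_image_sub_le_of_norm_deriv_le_segment_01' (E := ℝ)
    (f := fun s => b * (max (u + s * e) 0) ^ 2 - b' * (max (u' + s * e') 0) ^ 2)
    (f' := fun s => b * (2 * max (u + s * e) 0 * e) - b' * (2 * max (u' + s * e') 0 * e'))
    (C := 4 * paramDist (b, a, t) (b', a', t') * r) ?_ ?_
  · simp only [Real.norm_eq_abs, one_mul, zero_mul, add_zero] at key
    have e1 : u + e = a ⬝ᵥ x - t := by rw [hu, he, dotProduct_sub]; ring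
    have e2 : u' + e' = a' ⬝ᵥ x - t' := by rw [hu', he', dotProduct_sub]; ring
    rw [e1, e2] at key
    simpa only [ridge] using key
  · intro s _
    have h1 : HasDerivAt (fun s : ℝ => u + s * e) e s := by
      simpa using ((hasDerivAt_id s).mul_const e).const_add u
    have h2 : HasDerivAt (fun s : ℝ => u' + s * e') e' s := by
      simpa using ((hasDerivAt_id s).mul_const e').const_add u'
    exact ((((hasDerivAt_max_zero_sq _).comp s h1).const_mul b).sub
      (((hasDerivAt_max_zero_sq _).comp s h2).const_mul b')).hasDerivWithinAt
  · intro s hs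
    have hz : ∀ i, |(y + s • (x - y)) i| ≤ 1 := by
      intro i
      have h1 := hx i
      have h2 := hy i
      simp only [Pi.add_apply, Pi.smul_apply, Pi.sub_apply, smul_eq_mul]
      rw [abs_le]
      have h3 := hs.1
      have h4 := hs.2
      constructor <;> nlinarith [h1.1, h1.2, h2.1, h2.2]
    have hw : u + s * e = a ⬝ᵥ (y + s • (x - y)) - t := by
      rw [dotProduct_add, dotProduct_smul, hu, he, smul_eq_mul]; ring
    have hw' : u' + s * e' = a' ⬝ᵥ (y + s • (x - y)) - t' := by
      rw [dotProduct_add, dotProduct_smul, hu', he', smul_eq_mul]; ring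
    have hm : |max (u + s * e) 0| ≤ 1 := by
      rw [abs_of_nonneg (le_max_right _ _)]
      refine max_le ?_ zero_le_one
      have := (abs_le.1 (abs_dotProduct_le a _ hz)).2
      rw [hw]; rw [ha] at this; linarith
    have hm' : |max (u' + s * e') 0| ≤ 1 := by
      rw [abs_of_nonneg (le_max_right _ _)]
      refine max_le ?_ zero_le_one
      have := (abs_le.1 (abs_dotProduct_le a' _ hz)).2
      rw [hw']; rw [ha'] at this; linarith
    have hmm : |max (u + s * e) 0 - max (u' + s * e') 0| ≤ l1norm (a - a') + |t - t'| := by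
      refine (abs_max_zero_sub_le _ _).trans ?_
      have h1 : u + s * e - (u' + s * e') = (a - a') ⬝ᵥ (y + s • (x - y)) - (t - t') := by
        rw [hw, hw', sub_dotProduct]; ring
      rw [h1]
      refine (abs_sub _ _).trans ?_
      have := abs_dotProduct_le (a - a') _ hz
      linarith
    -- Changing the sign, the activation and the direction one at a time costs `|b - b'|`, `‖a -
    -- a'‖₁ + |t - t'|` and `‖a - a'‖₁`, each times `r`. With the factor `2` this is at most `4 *
    -- paramDist * r`.
    have hsplit : b * (2 * max (u + s * e) 0 * e) - b' * (2 * max (u' + s * e') 0 * e') =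
        2 * ((b - b') * max (u + s * e) 0 * e + b' * (max (u + s * e) 0 - max (u' + s * e') 0) * e +
          b' * max (u' + s * e') 0 * (e - e')) := by ring
    rw [hsplit, Real.norm_eq_abs, abs_mul, abs_two]
    have k1 : |(b - b') * max (u + s * e) 0 * e| ≤ |b - b'| * r := by
      rw [abs_mul, abs_mul]
      calc |b - b'| * |max (u + s * e) 0| * |e| ≤ |b - b'| * 1 * r := by gcongr
        _ = _ := by ring
    have k2 : |b' * (max (u + s * e) 0 - max (u' + s * e') 0) * e| ≤
        (l1norm (a - a') + |t - t'|) * r := by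
      rw [abs_mul, abs_mul, hb1, one_mul]
      exact mul_le_mul hmm hE (abs_nonneg _) ((abs_nonneg _).trans hmm)
    have k3 : |b' * max (u' + s * e') 0 * (e - e')| ≤ l1norm (a - a') * r := by
      rw [abs_mul, abs_mul, hb1, one_mul]
      calc |max (u' + s * e') 0| * |e - e'| ≤ 1 * (l1norm (a - a') * r) := by gcongr
        _ = _ := one_mul _
    have k4 := abs_add_three ((b - b') * max (u + s * e) 0 * e)
      (b' * (max (u + s * e) 0 - max (u' + s * e') 0) * e) (b' * max (u' + s * e') 0 * (e - e'))
    have k5 := mul_nonneg (abs_nonneg (b - b')) hr0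
    have k6 := mul_nonneg (abs_nonneg (t - t')) hr0
    simp only [paramDist]
    nlinarith

/-- Since `t ≥ 0`, the random process is pinned at the origin, where every chain starts. -/
lemma ridge_zero {d : ℕ} {θ : ℝ × (Fin d → ℝ) × ℝ} (hθ : θ ∈ ridgeParams d) :
    ridge θ 0 = 0 := by
  have := hθ.2.2.1
  simp [ridge, this]

lemma abs_ridge_sub_le {d : ℕ} {θ θ' : ℝ × (Fin d → ℝ) × ℝ} (hθ : θ ∈ ridgeParams d)
    (hθ' : θ' ∈ ridgeParams d) {x : Fin d → ℝ} (hx : x ∈ cube d) :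
    |ridge θ x - ridge θ' x| ≤ 4 * paramDist θ θ' := by
  have := abs_ridge_sub_sub_le hθ hθ' hx (zero_mem_cube d) (r := 1)
    (by simpa using mem_cube_iff_abs.1 hx)
  simpa [ridge_zero hθ, ridge_zero hθ'] using this

lemma abs_ridge_le_one {d : ℕ} {θ : ℝ × (Fin d → ℝ) × ℝ} (hθ : θ ∈ ridgeParams d)
    {x : Fin d → ℝ} (hx : x ∈ cube d) : |ridge θ x| ≤ 1 := by
  obtain ⟨hb, ha, ht0, -⟩ := hθ
  have hb1 : |θ.1| = 1 := by rcases hb with h | h <;> simp [h]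
  have h1 := (abs_le.1 (abs_dotProduct_le_of_mem_cube θ.2.1 hx)).2
  rw [ridge, abs_mul, hb1, one_mul, abs_pow, abs_of_nonneg (le_max_right _ _)]
  exact pow_le_one₀ (le_max_right _ _) (max_le (by linarith) zero_le_one)

/-! ### Exponential moments and chaining on the cube -/

/-- Hoeffding's lemma for a finite uniform average. -/
lemma sum_exp_le_of_sum_eq_zero {ι : Type*} [Fintype ι] (y : ι → ℝ) {c : ℝ} (hsum : ∑ i, y i = 0)
    (hy : ∀ i, |y i| ≤ c) (l : ℝ) :
    ∑ i, Real.exp (l * y i) ≤ Fintype.card ι * Real.exp ((l * c) ^ 2 / 2) := by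
  rcases le_or_gt c 0 with hc | hc
  · have h0 : ∀ i, y i = 0 := fun i => abs_nonpos_iff.1 ((hy i).trans hc)
    simp only [h0, mul_zero, Real.exp_zero, Finset.sum_const, nsmul_eq_mul, Finset.card_univ]
    exact mul_le_mul_of_nonneg_left (Real.one_le_exp (by positivity)) (Nat.cast_nonneg _)
  -- The chord of `exp` over `[-lc, lc]` lies above the graph; its linear part disappears on
  -- summation because the `y i` sum to zero.
  · have key : ∀ i, Real.exp (l * y i) ≤
        Real.cosh (l * c) + y i * (Real.sinh (l * c) / c) := by
      intro i
      have hi := abs_le.1 (hy i)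
      have h := convexOn_exp.2 (Set.mem_univ (l * c)) (Set.mem_univ (-(l * c)))
        (show 0 ≤ (c + y i) / (2 * c) from div_nonneg (by linarith) (by linarith))
        (show 0 ≤ (c - y i) / (2 * c) from div_nonneg (by linarith) (by linarith))
        (by field_simp; ring)
      simp only [smul_eq_mul] at h
      have e1 : (c + y i) / (2 * c) * (l * c) + (c - y i) / (2 * c) * -(l * c) = l * y i := by
        field_simp; ring
      rw [e1] at h
      refine h.trans_eq ?_
      rw [Real.cosh_eq, Real.sinh_eq]
      field_simp
      ring
    calc ∑ i, Real.exp (l * y i) ≤ ∑ i, (Real.cosh (l * c) + y i * (Real.sinh (l * c) / c)) :=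
          Finset.sum_le_sum fun i _ => key i
      _ = Fintype.card ι * Real.cosh (l * c) := by
          rw [Finset.sum_add_distrib, ← Finset.sum_mul, hsum]; simp
      _ ≤ _ := mul_le_mul_of_nonneg_left (Real.cosh_le_exp_half_sq _) (Nat.cast_nonneg _)

/-- Summing over all choice functions is averaging over independent uniform draws, so the
exponential sum factorises over the groups and Hoeffding applies to each factor. -/
lemma sum_exp_sum_le {m R : ℕ} (Y : Fin m → Fin R → ℝ) (c : Fin m → ℝ)
    (hsum : ∀ g, ∑ i, Y g i = 0) (hY : ∀ g i, |Y g i| ≤ c g) (l : ℝ) :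
    ∑ ω : Fin m → Fin R, Real.exp (l * ∑ g, Y g (ω g)) ≤
      Fintype.card (Fin m → Fin R) * Real.exp (l ^ 2 * (∑ g, c g ^ 2) / 2) := by
  have h1 : ∑ ω : Fin m → Fin R, Real.exp (l * ∑ g, Y g (ω g)) =
      ∏ g, ∑ i, Real.exp (l * Y g i) := by
    rw [Finset.prod_univ_sum, Fintype.piFinset_univ]
    simp_rw [Finset.mul_sum, Real.exp_sum]
  rw [h1]
  calc ∏ g, ∑ i, Real.exp (l * Y g i)
      ≤ ∏ g, ((Fintype.card (Fin R) : ℝ) * Real.exp ((l * c g) ^ 2 / 2)) :=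
        Finset.prod_le_prod (fun g _ => Finset.sum_nonneg fun i _ => (Real.exp_pos _).le)
          fun g _ => sum_exp_le_of_sum_eq_zero _ (hsum g) (hY g) l
    _ = _ := by
        rw [Finset.prod_mul_distrib, ← Real.exp_sum]
        simp only [Finset.prod_const, Finset.card_univ, Fintype.card_fin, Fintype.card_fun,
          Nat.cast_pow]
        congr 2
        rw [Finset.mul_sum, Finset.sum_div]
        exact Finset.sum_congr rfl fun g _ => by ring

/-- The point of the dyadic grid of mesh `2⁻ᵏ` with index `j`. -/
noncomputable def dyadicPoint {d : ℕ} (k : ℕ) (j : Fin d → ℤ) : Fin d → ℝ := fun i => j i / 2 ^ k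

/-- The predecessor of a dyadic grid point in the chaining argument. -/
noncomputable def dyadicPred {d : ℕ} : ℕ → (Fin d → ℤ) → Fin d → ℝ
  | 0, _ => 0
  | k + 1, j => dyadicPoint k fun i => j i / 2

/-- The indices of the dyadic grid points of mesh `2⁻ᵏ` in the cube. -/
noncomputable def dyadicIndices (d k : ℕ) : Finset (Fin d → ℤ) :=
  Fintype.piFinset fun _ => Finset.Icc (-(2 ^ k : ℤ)) (2 ^ k)

lemma mem_dyadicIndices {d k : ℕ} {j : Fin d → ℤ} :
    j ∈ dyadicIndices d k ↔ ∀ i, -(2 ^ k : ℤ) ≤ j i ∧ j i ≤ 2 ^ k := by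
  simp [dyadicIndices]

lemma dyadicPoint_mem_cube {d k : ℕ} {j : Fin d → ℤ} (hj : j ∈ dyadicIndices d k) :
    dyadicPoint k j ∈ cube d := by
  intro i
  have h := mem_dyadicIndices.1 hj i
  have h1 : -(2 ^ k : ℝ) ≤ j i := by exact_mod_cast h.1
  have h2 : (j i : ℝ) ≤ 2 ^ k := by exact_mod_cast h.2
  have hp : (0 : ℝ) < 2 ^ k := by positivity
  constructor
  · rw [dyadicPoint, le_div_iff₀ hp]; linarith
  · rw [dyadicPoint, div_le_iff₀ hp]; linarith

lemma half_mem_dyadicIndices {d k : ℕ} {j : Fin d → ℤ} (hj : j ∈ dyadicIndices d (k + 1)) :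
    (fun i => j i / 2) ∈ dyadicIndices d k := by
  rw [mem_dyadicIndices] at hj ⊢
  intro i
  have h := hj i
  rw [pow_succ] at h
  constructor <;> omega

lemma dyadicPred_mem_cube {d k : ℕ} {j : Fin d → ℤ} (hj : j ∈ dyadicIndices d k) :
    dyadicPred k j ∈ cube d := by
  cases k with
  | zero => exact zero_mem_cube d
  | succ k => exact dyadicPoint_mem_cube (half_mem_dyadicIndices hj)

lemma abs_dyadicPoint_sub_dyadicPred_le {d k : ℕ} {j : Fin d → ℤ} (hj : j ∈ dyadicIndices d k)
    (i : Fin d) : |dyadicPoint k j i - dyadicPred k j i| ≤ 1 / 2 ^ k := by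
  cases k with
  | zero =>
    have := mem_cube_iff_abs.1 (dyadicPoint_mem_cube hj) i
    simpa [dyadicPred] using this
  | succ k =>
    simp only [dyadicPred, dyadicPoint]
    have h : ((j i : ℤ) : ℝ) = 2 * ((j i / 2 : ℤ) : ℝ) + ((j i % 2 : ℤ) : ℝ) := by
      exact_mod_cast (Int.mul_ediv_add_emod (j i) 2).symm
    have h0 : (0 : ℝ) ≤ ((j i % 2 : ℤ) : ℝ) := by
      exact_mod_cast Int.emod_nonneg _ (by norm_num)
    have h1 : ((j i % 2 : ℤ) : ℝ) ≤ 1 := by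
      have : j i % 2 ≤ 1 := by omega
      exact_mod_cast this
    have e : (j i : ℝ) / 2 ^ (k + 1) - ((j i / 2 : ℤ) : ℝ) / 2 ^ k =
        ((j i % 2 : ℤ) : ℝ) / 2 ^ (k + 1) := by
      rw [h, pow_succ]; field_simp; ring
    rw [e, abs_of_nonneg (by positivity)]
    gcongr

/-- The index of the dyadic grid point obtained by rounding down. -/
noncomputable def dyadicIndex {d : ℕ} (k : ℕ) (x : Fin d → ℝ) : Fin d → ℤ := fun i => ⌊2 ^ k * x i⌋

lemma dyadicIndex_mem {d k : ℕ} {x : Fin d → ℝ} (hx : x ∈ cube d) :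
    dyadicIndex k x ∈ dyadicIndices d k := by
  rw [mem_dyadicIndices]
  intro i
  have hp : (0 : ℝ) < 2 ^ k := by positivity
  obtain ⟨h1, h2⟩ := hx i
  constructor
  · apply Int.le_floor.2
    push_cast
    nlinarith
  · have : ((dyadicIndex k x i : ℤ) : ℝ) ≤ 2 ^ k := (Int.floor_le _).trans (by nlinarith)
    exact_mod_cast this

/-- Nested floors collapse, `⌊⌊2^(k+1) x⌋ / 2⌋ = ⌊2^k x⌋`, so the roundings of `x` at successive
levels form a chain under `dyadicPred`. -/
lemma dyadicPred_dyadicIndex {d k : ℕ} (x : Fin d → ℝ) :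
    dyadicPred (k + 1) (dyadicIndex (k + 1) x) = dyadicPoint k (dyadicIndex k x) := by
  simp only [dyadicPred, dyadicIndex]
  congr 1
  ext i
  have h := Int.floor_div_natCast (2 ^ (k + 1) * x i) 2
  simp only [Nat.cast_ofNat] at h
  rw [← h]
  congr 1
  rw [pow_succ]; ring

lemma abs_sub_dyadicPoint_le {d k : ℕ} (x : Fin d → ℝ) (i : Fin d) :
    |x i - dyadicPoint k (dyadicIndex k x) i| ≤ 1 / 2 ^ k := by
  have hp : (0 : ℝ) < 2 ^ k := by positivity
  have h1 := Int.floor_le (2 ^ k * x i)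
  have h2 := Int.lt_floor_add_one (2 ^ k * x i)
  have e : x i - dyadicPoint k (dyadicIndex k x) i =
      (2 ^ k * x i - ⌊2 ^ k * x i⌋) / 2 ^ k := by
    simp only [dyadicPoint, dyadicIndex]; field_simp
  rw [e, abs_of_nonneg (div_nonneg (by linarith) hp.le)]
  gcongr
  linarith

lemma card_dyadicIndices_le (d k : ℕ) :
    ((dyadicIndices d k).card : ℝ) ≤ Real.exp (d * (k + 2)) := by
  have h1 : (dyadicIndices d k).card = (2 ^ (k + 1) + 1) ^ d := by
    simp only [dyadicIndices, Fintype.card_piFinset, Int.card_Icc, Finset.prod_const,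
      Finset.card_univ, Fintype.card_fin]
    congr 1
    have : ((2 : ℤ) ^ k + 1 - -2 ^ k) = ((2 ^ (k + 1) + 1 : ℕ) : ℤ) := by
      push_cast; rw [pow_succ]; ring
    rw [this, Int.toNat_natCast]
  rw [h1, Real.exp_nat_mul]
  push_cast
  gcongr
  have h2 : (2 : ℝ) ≤ Real.exp 1 := by have := Real.add_one_le_exp (1 : ℝ); linarith
  calc (2 : ℝ) ^ (k + 1) + 1 ≤ 2 ^ (k + 2) := by
        have : (1 : ℝ) ≤ 2 ^ (k + 1) := one_le_pow₀ (by norm_num)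
        rw [pow_succ _ (k + 1)]; linarith
    _ ≤ Real.exp 1 ^ (k + 2) := by gcongr
    _ = _ := by rw [← Real.exp_nat_mul]; push_cast; ring_nf

lemma sum_quarter_pow_lt_one (n : ℕ) : ∑ k ∈ Finset.range n, 2 * (1 / 4 : ℝ) ^ (k + 2) < 1 := by
  have : ∑ k ∈ Finset.range n, 2 * (1 / 4 : ℝ) ^ (k + 2) ≤ 1 - (1 / 4) ^ n := by
    induction n with
    | zero => simp
    | succ n ih =>
      rw [Finset.sum_range_succ]
      have : (0 : ℝ) < (1 / 4) ^ n := by positivity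
      rw [pow_succ _ n, pow_add]
      linarith
  have h : (0 : ℝ) < (1 / 4) ^ n := by positivity
  linarith

/-- Chaining on the cube over a finite uniform probability space: some outcome of a process with
subgaussian increments is bounded by the entropy integral. -/
theorem exists_forall_abs_le_of_sum_exp_le {Ω : Type*} [Fintype Ω] [Nonempty Ω] {d : ℕ}
    (hd : 1 ≤ d) (X : Ω → (Fin d → ℝ) → ℝ) {σ Λ : ℝ} (hσ : 0 < σ) (hX : ∀ ω, X ω 0 = 0)
    (hexp : ∀ u ∈ cube d, ∀ v ∈ cube d, ∀ r : ℝ, (∀ i, |u i - v i| ≤ r) → ∀ l : ℝ,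
      ∑ ω, Real.exp (l * (X ω u - X ω v)) ≤ Fintype.card Ω * Real.exp ((l * σ * r) ^ 2 / 2))
    (hlip : ∀ ω, ∀ u ∈ cube d, ∀ v ∈ cube d, ∀ r : ℝ, (∀ i, |u i - v i| ≤ r) →
      |X ω u - X ω v| ≤ Λ * r) :
    ∃ ω, ∀ x ∈ cube d, |X ω x| ≤ 13 * σ * √(d : ℝ) := by
  have hd1 : (1 : ℝ) ≤ d := by exact_mod_cast hd
  have hsd : 1 ≤ √(d : ℝ) := Real.one_le_sqrt.2 hd1
  -- Beyond level `K` the crude Lipschitz bound leaves an error of at most `σ`, so finitely many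
  -- levels suffice.
  obtain ⟨K, hK⟩ : ∃ K : ℕ, Λ / σ ≤ 2 ^ K :=
    ((tendsto_pow_atTop_atTop_of_one_lt (r := (2 : ℝ)) (by norm_num)).eventually_ge_atTop
      (Λ / σ)).exists
  set s : ℕ → ℝ := fun k => √(d : ℝ) * (k + 2) with hs
  have hspos : ∀ k, 0 < s k := fun k => by simp only [hs]; positivity
  have hssq : ∀ k, s k ^ 2 = d * (k + 2) ^ 2 := fun k => by
    simp only [hs]; rw [mul_pow, Real.sq_sqrt (by positivity)]
  -- A link of level `k` has length at most `2⁻ᵏ`; this `l k` makes `l k * σ * 2⁻ᵏ = s k`.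
  set l : ℕ → ℝ := fun k => s k * 2 ^ k / σ with hl
  set Δ : ℕ → (Fin d → ℤ) → Ω → ℝ := fun k j ω => X ω (dyadicPoint k j) - X ω (dyadicPred k j)
    with hΔ
  -- A union bound in one sum: the mean of `Φ` is below `1`, so some outcome has `Φ ω < 1`. Then
  -- each summand is at most `1`, and every link satisfies `l k * |Δ| ≤ 2 * s k ^ 2`.
  set Φ : Ω → ℝ := fun ω => ∑ k ∈ Finset.range (K + 1), ∑ j ∈ dyadicIndices d k,
    Real.exp (-(2 * s k ^ 2)) * (Real.exp (l k * Δ k j ω) + Real.exp (-l k * Δ k j ω)) with hΦ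
  have hterm : ∀ k, ∀ j ∈ dyadicIndices d k,
      ∑ ω, Real.exp (-(2 * s k ^ 2)) * (Real.exp (l k * Δ k j ω) + Real.exp (-l k * Δ k j ω)) ≤
        Fintype.card Ω * (2 * Real.exp (-(3 / 2 * s k ^ 2))) := by
    intro k j hj
    have h1 := hexp _ (dyadicPoint_mem_cube hj) _ (dyadicPred_mem_cube hj) _
      (abs_dyadicPoint_sub_dyadicPred_le hj) (l k)
    have h2 := hexp _ (dyadicPoint_mem_cube hj) _ (dyadicPred_mem_cube hj) _
      (abs_dyadicPoint_sub_dyadicPred_le hj) (-l k)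
    have e1 : l k * σ * (1 / 2 ^ k) = s k := by simp only [hl]; field_simp
    have e2 : -l k * σ * (1 / 2 ^ k) = -s k := by rw [← e1]; ring
    rw [e1] at h1
    rw [e2, neg_sq] at h2
    rw [← Finset.mul_sum, Finset.sum_add_distrib]
    have e3 : Real.exp (-(3 / 2 * s k ^ 2)) =
        Real.exp (-(2 * s k ^ 2)) * Real.exp (s k ^ 2 / 2) := by
      rw [← Real.exp_add]; ring_nf
    rw [e3]
    have hp := Real.exp_pos (-(2 * s k ^ 2))
    calc _ ≤ Real.exp (-(2 * s k ^ 2)) * (Fintype.card Ω * Real.exp (s k ^ 2 / 2) +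
          Fintype.card Ω * Real.exp (s k ^ 2 / 2)) := by gcongr
      _ = _ := by ring
  -- As `k + 2 ≥ 2`, the exponent `d(k+2) - (3/2)d(k+2)²` is at most `-d(k+2)² ≤ -2(k+2)`.
  have hlevel : ∀ k, ((dyadicIndices d k).card : ℝ) * (2 * Real.exp (-(3 / 2 * s k ^ 2))) ≤
      2 * (1 / 4) ^ (k + 2) := by
    intro k
    have h4 : Real.exp (-2) ≤ 1 / 4 := by
      rw [Real.exp_neg, one_div]
      apply inv_anti₀ (by norm_num)
      have := Real.add_one_le_exp (1 : ℝ)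
      calc (4 : ℝ) = 2 ^ 2 := by norm_num
        _ ≤ Real.exp 1 ^ 2 := by gcongr; linarith
        _ = _ := by rw [← Real.exp_nat_mul]; norm_num
    have hk : (0 : ℝ) ≤ k := Nat.cast_nonneg k
    calc _ ≤ Real.exp (d * (k + 2)) * (2 * Real.exp (-(3 / 2 * s k ^ 2))) := by
          gcongr; exact card_dyadicIndices_le d k
      _ = 2 * Real.exp (d * (k + 2) - 3 / 2 * (d * (k + 2) ^ 2)) := by
          rw [hssq, sub_eq_add_neg, Real.exp_add]; ring
      _ ≤ 2 * Real.exp (((k + 2 : ℕ) : ℝ) * (-2)) := by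
          gcongr
          push_cast
          have h1 : (k + 2 : ℝ) * 1 ≤ (k + 2) * d := by gcongr
          have h2 : (d * (k + 2) : ℝ) * 2 ≤ d * (k + 2) * (k + 2) := by gcongr; linarith
          nlinarith
      _ ≤ _ := by rw [Real.exp_nat_mul]; gcongr
  have hsum : ∑ ω, Φ ω < ∑ _ω : Ω, (1 : ℝ) := by
    have hc : (0 : ℝ) < Fintype.card Ω := by exact_mod_cast Fintype.card_pos
    simp only [hΦ]
    rw [Finset.sum_comm]
    calc _ ≤ ∑ k ∈ Finset.range (K + 1), Fintype.card Ω * (2 * (1 / 4 : ℝ) ^ (k + 2)) := by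
          refine Finset.sum_le_sum fun k _ => ?_
          rw [Finset.sum_comm]
          calc _ ≤ ∑ j ∈ dyadicIndices d k,
                (Fintype.card Ω : ℝ) * (2 * Real.exp (-(3 / 2 * s k ^ 2))) :=
                Finset.sum_le_sum (hterm k)
            _ = Fintype.card Ω * ((dyadicIndices d k).card *
                (2 * Real.exp (-(3 / 2 * s k ^ 2)))) := by
                rw [Finset.sum_const, nsmul_eq_mul]; ring
            _ ≤ _ := mul_le_mul_of_nonneg_left (hlevel k) (Nat.cast_nonneg _)
      _ = Fintype.card Ω * ∑ k ∈ Finset.range (K + 1), 2 * (1 / 4 : ℝ) ^ (k + 2) := by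
          rw [Finset.mul_sum]
      _ < Fintype.card Ω * 1 := by gcongr; exact sum_quarter_pow_lt_one _
      _ = _ := by simp
  obtain ⟨ω, -, hω⟩ := Finset.exists_lt_of_sum_lt hsum
  refine ⟨ω, fun x hx => ?_⟩
  have hstep : ∀ k ≤ K, ∀ j ∈ dyadicIndices d k,
      |X ω (dyadicPoint k j) - X ω (dyadicPred k j)| ≤ 2 * σ * √(d : ℝ) * ((k + 2) / 2 ^ k) := by
    intro k hk j hj
    have hle : Real.exp (-(2 * s k ^ 2)) *
        (Real.exp (l k * Δ k j ω) + Real.exp (-l k * Δ k j ω)) ≤ Φ ω := by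
      simp only [hΦ]
      refine le_trans ?_ (Finset.single_le_sum (f := fun k => ∑ j ∈ dyadicIndices d k,
        Real.exp (-(2 * s k ^ 2)) * (Real.exp (l k * Δ k j ω) + Real.exp (-l k * Δ k j ω)))
        (fun k _ => Finset.sum_nonneg fun j _ => by positivity)
        (Finset.mem_range.2 (Nat.lt_succ_of_le hk)))
      exact Finset.single_le_sum (f := fun j =>
        Real.exp (-(2 * s k ^ 2)) * (Real.exp (l k * Δ k j ω) + Real.exp (-l k * Δ k j ω)))
        (fun j _ => by positivity) hj
    have hone := hle.trans hω.le
    have hlpos : 0 < l k := by simp only [hl]; have := hspos k; positivity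
    have hp := Real.exp_pos (-(2 * s k ^ 2))
    have hb : ∀ z : ℝ, Real.exp (-(2 * s k ^ 2)) * Real.exp z ≤ 1 → z ≤ 2 * s k ^ 2 := by
      intro z hz
      rw [← Real.exp_add, Real.exp_le_one_iff] at hz
      linarith
    have h1 := hb (l k * Δ k j ω) (by
      have := Real.exp_pos (-l k * Δ k j ω); nlinarith)
    have h2 := hb (-l k * Δ k j ω) (by
      have := Real.exp_pos (l k * Δ k j ω); nlinarith)
    have h3 : l k * |Δ k j ω| ≤ 2 * s k ^ 2 := by
      rcases abs_cases (Δ k j ω) with ⟨h, -⟩ | ⟨h, -⟩ <;> rw [h] <;> linarith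
    have e : l k * (2 * σ * √(d : ℝ) * ((k + 2) / 2 ^ k)) = 2 * s k ^ 2 := by
      simp only [hl, hs]; field_simp
    rw [← e] at h3
    exact le_of_mul_le_mul_left h3 hlpos
  -- `6 - (k+4)/2^k` is the partial sum of `(j+2)/2^j` over `j ≤ k`. The chain thus costs at most
  -- `12σ√d`, and the last step below level `K` brings `13`.
  have hchain : ∀ k ≤ K, |X ω (dyadicPoint k (dyadicIndex k x))| ≤
      2 * σ * √(d : ℝ) * (6 - (k + 4) / 2 ^ k) := by
    intro k
    induction k with
    | zero =>
      intro hk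
      have := hstep 0 hk _ (dyadicIndex_mem (k := 0) hx)
      simp only [dyadicPred, hX, sub_zero] at this
      refine this.trans_eq ?_
      norm_num
    | succ k ih =>
      intro hk
      have h1 := ih (by omega)
      have h2 := hstep (k + 1) hk _ (dyadicIndex_mem hx)
      rw [dyadicPred_dyadicIndex] at h2
      have h3 := abs_add_le (X ω (dyadicPoint (k + 1) (dyadicIndex (k + 1) x)) -
        X ω (dyadicPoint k (dyadicIndex k x))) (X ω (dyadicPoint k (dyadicIndex k x)))
      rw [sub_add_cancel] at h3
      refine (h3.trans (add_le_add h2 h1)).trans_eq ?_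
      push_cast
      rw [pow_succ]
      field_simp
      ring
  have h1 := hchain K le_rfl
  have h2 := hlip ω x hx _ (dyadicPoint_mem_cube (dyadicIndex_mem hx)) _
    (abs_sub_dyadicPoint_le (k := K) x)
  have h3 : Λ * (1 / 2 ^ K) ≤ σ := by
    rw [div_le_iff₀ hσ] at hK
    rw [mul_one_div, div_le_iff₀ (by positivity)]
    linarith
  have h4 : 2 * σ * √(d : ℝ) * (6 - (K + 4) / 2 ^ K) ≤ 2 * σ * √(d : ℝ) * 6 := by
    gcongr
    have : (0 : ℝ) ≤ (K + 4) / 2 ^ K := by positivity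
    linarith
  have h5 : σ * 1 ≤ σ * √(d : ℝ) := by gcongr
  have h6 := abs_add_le (X ω x - X ω (dyadicPoint K (dyadicIndex K x)))
    (X ω (dyadicPoint K (dyadicIndex K x)))
  rw [sub_add_cancel] at h6
  linarith

/-- One member can be selected from each of `m` groups of ridge functions so that the sum of the
selected ones is uniformly close to the sum of the group averages. -/
theorem exists_selection {d m R : ℕ} (hd : 1 ≤ d) (hR : 0 < R)
    (θ : Fin m → Fin R → ℝ × (Fin d → ℝ) × ℝ) (hθ : ∀ g i, θ g i ∈ ridgeParams d)
    (δ : Fin m → ℝ) (hδ : ∀ g i j, paramDist (θ g i) (θ g j) ≤ δ g) {B : ℝ} (hB : 0 < B)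
    (hsum : ∑ g, δ g ^ 2 ≤ B) :
    ∃ ω : Fin m → Fin R, ∀ x ∈ cube d,
      |∑ g, (ridge (θ g (ω g)) x - (1 / (R : ℝ)) * ∑ i, ridge (θ g i) x)| ≤
        52 * √B * √(d : ℝ) := by
  have : NeZero R := ⟨hR.ne'⟩
  have hR' : (0 : ℝ) < R := by exact_mod_cast hR
  set Y : Fin m → Fin R → (Fin d → ℝ) → ℝ := fun g i x =>
    ridge (θ g i) x - (1 / (R : ℝ)) * ∑ j, ridge (θ g j) x with hY
  have hY0 : ∀ g i, Y g i 0 = 0 := by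
    intro g i
    simp [hY, ridge_zero (hθ _ _)]
  have hYsum : ∀ g x, ∑ i, Y g i x = 0 := by
    intro g x
    simp only [hY, Finset.sum_sub_distrib, Finset.sum_const, Finset.card_univ, Fintype.card_fin,
      nsmul_eq_mul]
    field_simp
    ring
  have hYlip : ∀ g i, ∀ u ∈ cube d, ∀ v ∈ cube d, ∀ r : ℝ, (∀ i, |u i - v i| ≤ r) →
      |Y g i u - Y g i v| ≤ 4 * δ g * r := by
    intro g i u hu v hv r hr
    have e : Y g i u - Y g i v = (1 / (R : ℝ)) * ∑ j, ((ridge (θ g i) u - ridge (θ g j) u) -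
        (ridge (θ g i) v - ridge (θ g j) v)) := by
      simp only [hY, Finset.sum_sub_distrib, Finset.sum_const, Finset.card_univ, Fintype.card_fin,
        nsmul_eq_mul]
      field_simp
    have hr0 : 0 ≤ r := (abs_nonneg _).trans (hr ⟨0, hd⟩)
    rw [e, abs_mul, abs_of_pos (by positivity : 0 < 1 / (R : ℝ))]
    have : |∑ j, ((ridge (θ g i) u - ridge (θ g j) u) - (ridge (θ g i) v - ridge (θ g j) v))| ≤
        ∑ _j : Fin R, 4 * δ g * r := by
      refine (Finset.abs_sum_le_sum_abs _ _).trans (Finset.sum_le_sum fun j _ => ?_)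
      refine (abs_ridge_sub_sub_le (hθ g i) (hθ g j) hu hv hr).trans ?_
      gcongr
      exact hδ g i j
    rw [Finset.sum_const, Finset.card_univ, Fintype.card_fin, nsmul_eq_mul] at this
    calc _ ≤ 1 / (R : ℝ) * (R * (4 * δ g * r)) := by gcongr
      _ = _ := by field_simp
  -- Group `g` has increments at most `4 * δ g * r`, so chaining applies with `σ = 4√B`, whence `52
  -- = 13 * 4`.
  have hexp : ∀ u ∈ cube d, ∀ v ∈ cube d, ∀ r : ℝ, (∀ i, |u i - v i| ≤ r) → ∀ l : ℝ,
      ∑ ω : Fin m → Fin R, Real.exp (l * (∑ g, Y g (ω g) u - ∑ g, Y g (ω g) v)) ≤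
        Fintype.card (Fin m → Fin R) * Real.exp ((l * (4 * √B) * r) ^ 2 / 2) := by
    intro u hu v hv r hr l
    have h := sum_exp_sum_le (fun g i => Y g i u - Y g i v) (fun g => 4 * δ g * r)
      (fun g => by rw [Finset.sum_sub_distrib, hYsum, hYsum, sub_zero])
      (fun g i => hYlip g i u hu v hv r hr) l
    simp only [← Finset.sum_sub_distrib]
    refine h.trans ?_
    gcongr ?_ * Real.exp (?_ / 2)
    have e : ∑ g, (4 * δ g * r) ^ 2 = 16 * r ^ 2 * ∑ g, δ g ^ 2 := by
      rw [Finset.mul_sum]; exact Finset.sum_congr rfl fun g _ => by ring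
    rw [e]
    have e2 : (l * (4 * √B) * r) ^ 2 = l ^ 2 * (16 * r ^ 2 * B) := by
      rw [mul_pow, mul_pow, mul_pow, Real.sq_sqrt hB.le]; ring
    rw [e2]
    gcongr
  have hlip : ∀ ω : Fin m → Fin R, ∀ u ∈ cube d, ∀ v ∈ cube d, ∀ r : ℝ,
      (∀ i, |u i - v i| ≤ r) →
        |∑ g, Y g (ω g) u - ∑ g, Y g (ω g) v| ≤ (∑ g, 4 * δ g) * r := by
    intro ω u hu v hv r hr
    simp only [← Finset.sum_sub_distrib]
    refine (Finset.abs_sum_le_sum_abs _ _).trans ?_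
    rw [Finset.sum_mul]
    exact Finset.sum_le_sum fun g _ => hYlip g _ u hu v hv r hr
  obtain ⟨ω, hω⟩ := exists_forall_abs_le_of_sum_exp_le hd
    (fun (ω : Fin m → Fin R) x => ∑ g, Y g (ω g) x) (by positivity)
    (fun ω => by simp [hY0]) hexp hlip
  exact ⟨ω, fun x hx => (hω x hx).trans_eq (by ring)⟩

/-! ### Grouping by cells at dyadic scales -/

/-- The finite set `s` can be divided into `m` groups of `R` elements whose squared diameters
with respect to `ρ` sum to at most `c`. -/
def HasGrouping {ι : Type*} (ρ : ι → ι → ℝ) (R m : ℕ) (s : Finset ι) (c : ℝ) : Prop :=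
  ∃ (idx : Fin m → Fin R → ι) (δ : Fin m → ℝ), (∀ g i j, ρ (idx g i) (idx g j) ≤ δ g) ∧
    ∑ g, δ g ^ 2 ≤ c ∧ ∀ h : ι → ℝ, ∑ g, ∑ i, h (idx g i) = ∑ i ∈ s, h i

section Grouping

variable {ι : Type*} {ρ : ι → ι → ℝ} {R m : ℕ} {s : Finset ι} {c : ℝ}

lemma HasGrouping.mono {c' : ℝ} (h : HasGrouping ρ R m s c) (hc : c ≤ c') :
    HasGrouping ρ R m s c' := by
  obtain ⟨idx, δ, h1, h2, h3⟩ := h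
  exact ⟨idx, δ, h1, h2.trans hc, h3⟩

lemma hasGrouping_empty : HasGrouping ρ R 0 ∅ 0 :=
  ⟨Fin.elim0, Fin.elim0, fun g => g.elim0, by simp, by simp⟩

lemma HasGrouping.cons [DecidableEq ι] {t : Finset ι} {δ₀ : ℝ} (hts : t ⊆ s) (hcard : t.card = R)
    (hδ : ∀ i ∈ t, ∀ j ∈ t, ρ i j ≤ δ₀) (h : HasGrouping ρ R m (s \ t) c) :
    HasGrouping ρ R (m + 1) s (c + δ₀ ^ 2) := by
  obtain ⟨idx, δ, h1, h2, h3⟩ := h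
  have e : Fin R ≃ t := (Finset.equivFinOfCardEq hcard).symm
  refine ⟨Fin.cons (fun i => (e i : ι)) idx, Fin.cons δ₀ δ, ?_, ?_, ?_⟩
  · intro g
    refine Fin.cases ?_ (fun g => ?_) g
    · intro i j
      exact hδ _ (e i).2 _ (e j).2
    · intro i j
      simpa using h1 g i j
  · rw [Fin.sum_univ_succ]
    simp only [Fin.cons_zero, Fin.cons_succ]
    linarith
  · intro f
    rw [Fin.sum_univ_succ]
    simp only [Fin.cons_zero, Fin.cons_succ]
    rw [h3 f, ← Finset.sum_sdiff hts, add_comm]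
    congr 1
    rw [e.sum_comp (fun x : t => f x), Finset.sum_coe_sort]

lemma hasGrouping_of_forall_le {δ : ℝ} (hδ : ∀ i j, ρ i j ≤ δ) (hs : s.card = m * R) :
    HasGrouping ρ R m s (m * δ ^ 2) := by
  classical
  induction m generalizing s with
  | zero =>
    rw [zero_mul, Finset.card_eq_zero] at hs
    subst hs
    simpa using hasGrouping_empty
  | succ m ih =>
    rw [add_mul, one_mul] at hs
    obtain ⟨t, hts, ht⟩ := Finset.exists_subset_card_eq (s := s) (n := R) (by omega)
    have h := ih (s := s \ t) (by rw [Finset.card_sdiff_of_subset hts, ht, hs]; omega)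
    refine (h.cons hts ht fun i _ j _ => hδ i j).mono (le_of_eq ?_)
    push_cast; ring

/-- Groups are taken from the cells of a finite partition as long as possible; what is left has
at most `R` elements per cell. -/
lemma hasGrouping_of_cells {α : Type*} (S : Finset α) (key : ι → α) (hkey : ∀ i, key i ∈ S)
    {δ T : ℝ} (hδ : ∀ i j, key i = key j → ρ i j ≤ δ)
    (hT : ∀ (m' : ℕ) (s' : Finset ι), s'.card = m' * R → s'.card ≤ S.card * R →
      HasGrouping ρ R m' s' T) (hs : s.card = m * R) :
    HasGrouping ρ R m s (m * δ ^ 2 + T) := by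
  classical
  induction m generalizing s with
  | zero => exact (hT 0 s hs (by rw [hs]; simp)).mono (by simp)
  | succ m ih =>
    by_cases hle : s.card ≤ S.card * R
    · exact (hT _ s hs hle).mono (by simp; positivity)
    -- Pigeonhole: with more than `R` elements per cell on average, some cell contains a whole
    -- group.
    · obtain ⟨y, -, hy⟩ := Finset.exists_lt_card_fiber_of_mul_lt_card_of_maps_to
        (s := s) (t := S) (f := key) (n := R) (fun i _ => hkey i) (by omega)
      obtain ⟨t, hts, ht⟩ := Finset.exists_subset_card_eq hy.le
      have hts' : t ⊆ s := hts.trans (Finset.filter_subset _ _)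
      rw [add_mul, one_mul] at hs
      have h := ih (s := s \ t) (by rw [Finset.card_sdiff_of_subset hts', ht, hs]; omega)
      refine (h.cons hts' ht (δ₀ := δ) fun i hi j hj => hδ i j ?_).mono (le_of_eq ?_)
      · rw [(Finset.mem_filter.1 (hts hi)).2, (Finset.mem_filter.1 (hts hj)).2]
      · push_cast; ring

/-- If cells of diameter `5 / 2ⁿ` number at most `(A 2ⁿ)ᵈ` with `d ≥ 3`, the leftovers of the
finer levels contribute a geometric sum. -/
lemma hasGrouping_of_levels {d : ℕ} (hd : 3 ≤ d) (hR : 0 < R) {A : ℝ} (hA : 0 < A)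
    (hρ : ∀ i j, ρ i j ≤ 5)
    (hcell : ∀ n : ℕ, ∃ (α : Type) (S : Finset α) (key : ι → α), (∀ i, key i ∈ S) ∧
      (∀ i j, key i = key j → ρ i j ≤ 5 / 2 ^ n) ∧ (S.card : ℝ) ≤ (A * 2 ^ n) ^ d)
    (n : ℕ) : ∀ (m : ℕ) (s : Finset ι), s.card = m * R →
      HasGrouping ρ R m s (m * (5 / 2 ^ n) ^ 2 + 200 * (A * 2 ^ n) ^ d / 4 ^ n) := by
  induction n with
  | zero =>
    intro m s hs
    refine (hasGrouping_of_forall_le hρ hs).mono ?_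
    have : 0 ≤ 200 * (A * 2 ^ 0) ^ d / 4 ^ 0 := by positivity
    simp only [pow_zero, div_one] at *
    linarith
  | succ n ih =>
    intro m s hs
    obtain ⟨α, S, key, hkey, hδ, hS⟩ := hcell (n + 1)
    refine hasGrouping_of_cells S key hkey hδ (fun m' s' hs' hle => ?_) hs
    refine (ih m' s' hs').mono ?_
    have hm' : (m' : ℝ) ≤ (A * 2 ^ (n + 1)) ^ d := by
      refine le_trans ?_ hS
      rw [hs'] at hle
      exact_mod_cast Nat.le_of_mul_le_mul_right hle hR
    -- Refining multiplies the cell bound by `2^d ≥ 8` but divides squared diameters by only `4`, so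
    -- the finest level dominates. The constant `200` closes the induction because `25 * 2^d + 200 ≤
    -- 50 * 2^d`.
    have h8 : (8 : ℝ) ≤ 2 ^ d := by
      calc (8 : ℝ) = 2 ^ 3 := by norm_num
        _ ≤ 2 ^ d := pow_le_pow_right₀ (by norm_num) hd
    have e : (A * 2 ^ (n + 1)) ^ d = (A * 2 ^ n) ^ d * 2 ^ d := by rw [← mul_pow]; ring_nf
    have h4 : ((2 : ℝ) ^ n) ^ 2 = 4 ^ n := by rw [← pow_mul, mul_comm, pow_mul]; norm_num
    have e2 : (5 / 2 ^ n : ℝ) ^ 2 = 25 / 4 ^ n := by rw [div_pow, h4]; norm_num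
    rw [e2]
    rw [e] at hm' ⊢
    set W := (A * 2 ^ n) ^ d
    have hW : 0 ≤ W := by positivity
    have hp : (0 : ℝ) < 4 ^ n := by positivity
    have e3 : (m' : ℝ) * (25 / 4 ^ n) + 200 * W / 4 ^ n = (25 * m' + 200 * W) / 4 ^ n := by
      field_simp
    have e4 : 200 * (W * 2 ^ d) / 4 ^ (n + 1) = (50 * (W * 2 ^ d)) / 4 ^ n := by
      rw [pow_succ]; field_simp; ring
    rw [e3, e4]
    gcongr
    nlinarith

end Grouping

lemma one_le_rpow_mul_of_le {m d : ℕ} (hm : 1 ≤ m) {y : ℝ}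
    (h : (m : ℝ) ^ (1 / (d : ℝ)) ≤ y) : 1 ≤ y ^ 2 * (m : ℝ) ^ (-(2 / (d : ℝ))) := by
  have hm0 : (0 : ℝ) < m := by exact_mod_cast hm
  have h1 : ((m : ℝ) ^ (1 / (d : ℝ))) ^ 2 = (m : ℝ) ^ (2 / (d : ℝ)) := by
    rw [← Real.rpow_natCast, ← Real.rpow_mul hm0.le]; congr 1; push_cast; ring
  have hp : 0 < (m : ℝ) ^ (2 / (d : ℝ)) := Real.rpow_pos_of_pos hm0 _
  rw [Real.rpow_neg hm0.le, ← div_eq_mul_inv, le_div_iff₀ hp, one_mul, ← h1]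
  gcongr

/-- The scale is chosen with `A * 2^n ≤ m^(1/d) < A * 2^(n+1)`: there are then at most `m` cells,
and both terms of the previous bound are of order `m / 4^n`. The constant is `900 = 4 * (25 + 200)`.
If `m^(1/d) ≤ A`, the trivial diameter `5` is enough. -/
lemma hasGrouping_of_entropy {ι : Type*} {ρ : ι → ι → ℝ} {R m d : ℕ} {s : Finset ι} (hd : 3 ≤ d)
    (hR : 0 < R) (hm : 1 ≤ m) {A : ℝ} (hA : 1 ≤ A) (hρ : ∀ i j, ρ i j ≤ 5)
    (hcell : ∀ n : ℕ, ∃ (α : Type) (S : Finset α) (key : ι → α), (∀ i, key i ∈ S) ∧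
      (∀ i j, key i = key j → ρ i j ≤ 5 / 2 ^ n) ∧ (S.card : ℝ) ≤ (A * 2 ^ n) ^ d)
    (hs : s.card = m * R) :
    HasGrouping ρ R m s (900 * A ^ 2 * m * (m : ℝ) ^ (-(2 / (d : ℝ)))) := by
  have hm0 : (0 : ℝ) < m := by exact_mod_cast hm
  have hA0 : 0 < A := by linarith
  set w : ℝ := (m : ℝ) ^ (-(2 / (d : ℝ))) with hw
  have hw0 : 0 < w := Real.rpow_pos_of_pos hm0 _
  rcases le_or_gt ((m : ℝ) ^ (1 / (d : ℝ))) A with h | h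
  · refine (hasGrouping_of_forall_le hρ hs).mono ?_
    have h1 := one_le_rpow_mul_of_le hm h
    rw [← hw] at h1
    nlinarith
  · obtain ⟨n, hn1, hn2⟩ := exists_nat_pow_near (x := (m : ℝ) ^ (1 / (d : ℝ)) / A) (y := 2)
      ((one_le_div hA0).2 h.le) (by norm_num)
    refine (hasGrouping_of_levels hd hR hA0 hρ hcell n m s hs).mono ?_
    have h4 : ((2 : ℝ) ^ n) ^ 2 = 4 ^ n := by rw [← pow_mul, mul_comm, pow_mul]; norm_num
    have h1 : (A * 2 ^ n) ^ d ≤ m := by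
      rw [le_div_iff₀ hA0] at hn1
      calc (A * 2 ^ n) ^ d ≤ ((m : ℝ) ^ (1 / (d : ℝ))) ^ d := by
            gcongr; linarith
        _ = m := by
            rw [← Real.rpow_natCast, ← Real.rpow_mul hm0.le, one_div_mul_cancel, Real.rpow_one]
            have : d ≠ 0 := by omega
            exact_mod_cast this
    rw [div_lt_iff₀ hA0] at hn2
    have h2 := one_le_rpow_mul_of_le hm hn2.le
    rw [← hw] at h2
    have e : (2 ^ (n + 1) * A) ^ 2 * w = 4 ^ n * (4 * A ^ 2 * w) := by rw [← h4, pow_succ]; ring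
    rw [e] at h2
    have hp : (0 : ℝ) < 4 ^ n := by positivity
    have e2 : (m : ℝ) * (5 / 2 ^ n) ^ 2 + 200 * (A * 2 ^ n) ^ d / 4 ^ n =
        (25 * m + 200 * (A * 2 ^ n) ^ d) / 4 ^ n := by
      rw [div_pow, h4]; field_simp; norm_num
    rw [e2, div_le_iff₀ hp]
    nlinarith

/-! ### Grouping along the Hilbert curve -/

/-- The unit square. -/
def unitSquare : Set (ℝ × ℝ) := Set.Icc 0 1 ×ˢ Set.Icc 0 1

/-- The four similarities of the Hilbert curve. -/
noncomputable def hilbertMap (k : Fin 4) (u : ℝ × ℝ) : ℝ × ℝ :=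
  ![(u.2 / 2, u.1 / 2), (u.1 / 2, u.2 / 2 + 1 / 2), (u.1 / 2 + 1 / 2, u.2 / 2 + 1 / 2),
    (1 - u.2 / 2, 1 / 2 - u.1 / 2)] k

lemma dist_hilbertMap (k : Fin 4) (u v : ℝ × ℝ) :
    dist (hilbertMap k u) (hilbertMap k v) = dist u v / 2 := by
  have h : ∀ x y : ℝ, |x / 2 - y / 2| = |x - y| / 2 := fun x y => by
    rw [← sub_div, abs_div, abs_two]
  have h' : ∀ x y c : ℝ, |c - x / 2 - (c - y / 2)| = |x - y| / 2 := fun x y c => by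
    rw [← h, abs_sub_comm]; congr 1; ring
  have h3 : dist (hilbertMap 3 u) (hilbertMap 3 v) = dist u v / 2 := by
    change dist (1 - u.2 / 2, 1 / 2 - u.1 / 2) (1 - v.2 / 2, 1 / 2 - v.1 / 2) = _
    simp only [Prod.dist_eq, Real.dist_eq]
    rw [h', h', max_div_div_right (by norm_num : (0 : ℝ) ≤ 2), max_comm]
  fin_cases k
  · simp [hilbertMap, Prod.dist_eq, Real.dist_eq, h, max_div_div_right, max_comm]
  · simp [hilbertMap, Prod.dist_eq, Real.dist_eq, h, max_div_div_right]
  · simp [hilbertMap, Prod.dist_eq, Real.dist_eq, h, max_div_div_right]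
  · exact h3

lemma hilbertMap_zero_start : hilbertMap 0 (0, 0) = (0, 0) := by simp [hilbertMap]

lemma hilbertMap_three_end : hilbertMap 3 (1, 0) = (1, 0) := by simp [hilbertMap]

/-- The curve enters the square at `(0,0)` and leaves at `(1,0)`; consecutive quarter copies share
the exit of one and the entry of the next. -/
lemma hilbertMap_end {k l : Fin 4} (h : (k : ℕ) + 1 = l) :
    hilbertMap k (1, 0) = hilbertMap l (0, 0) := by
  fin_cases k <;> fin_cases l <;> simp at h <;> simp [hilbertMap]
  norm_num

lemma exists_hilbertMap_eq {p : ℝ × ℝ} (hp : p ∈ unitSquare) :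
    ∃ k, ∃ u ∈ unitSquare, hilbertMap k u = p := by
  obtain ⟨x, y⟩ := p
  obtain ⟨⟨hx0, hx1⟩, hy0, hy1⟩ := hp
  simp only at hx0 hx1 hy0 hy1
  rcases le_or_gt x (1 / 2) with hx | hx <;> rcases le_or_gt y (1 / 2) with hy | hy
  · exact ⟨0, (2 * y, 2 * x), ⟨⟨by simp; linarith, by simp; linarith⟩, by simp; linarith,
      by simp; linarith⟩, by simp [hilbertMap]⟩
  · exact ⟨1, (2 * x, 2 * y - 1), ⟨⟨by simp; linarith, by simp; linarith⟩, by simp; linarith,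
      by simp; linarith⟩, by simp [hilbertMap]; ring⟩
  · exact ⟨3, (1 - 2 * y, 2 - 2 * x), ⟨⟨by simp; linarith, by simp; linarith⟩, by simp; linarith,
      by simp; linarith⟩, by simp only [hilbertMap]; simp; constructor <;> ring⟩
  · exact ⟨2, (2 * x - 1, 2 * y - 1), ⟨⟨by simp; linarith, by simp; linarith⟩, by simp; linarith,
      by simp; linarith⟩, by simp only [hilbertMap]; simp; constructor <;> ring⟩

lemma dist_le_one_of_mem_unitSquare {p q : ℝ × ℝ} (hp : p ∈ unitSquare) (hq : q ∈ unitSquare) :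
    dist p q ≤ 1 := by
  obtain ⟨hp1, hp2⟩ := hp
  obtain ⟨hq1, hq2⟩ := hq
  rw [Prod.dist_eq]
  exact max_le (by simpa using Real.dist_le_of_mem_Icc hp1 hq1)
    (by simpa using Real.dist_le_of_mem_Icc hp2 hq2)

/-- A finite-level inverse of the Hilbert curve: points with close keys are close. -/
lemma exists_hilbertKey (L : ℕ) : ∃ κ : ℝ × ℝ → ℝ, ∀ p ∈ unitSquare, κ p ∈ Set.Icc (0 : ℝ) 1 ∧
    dist p (0, 0) ^ 2 ≤ 4 * (κ p + (1 / 4) ^ L) ∧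
    dist p (1, 0) ^ 2 ≤ 4 * (1 - κ p + (1 / 4) ^ L) ∧
    ∀ q ∈ unitSquare, dist p q ^ 2 ≤ 16 * (|κ p - κ q| + (1 / 4) ^ L) := by
  have hA : ((0 : ℝ), (0 : ℝ)) ∈ unitSquare := by simp [unitSquare]
  have hB : ((1 : ℝ), (0 : ℝ)) ∈ unitSquare := by simp [unitSquare]
  have hsq : ∀ p ∈ unitSquare, ∀ q ∈ unitSquare, dist p q ^ 2 ≤ 1 := fun p hp q hq =>
    pow_le_one₀ dist_nonneg (dist_le_one_of_mem_unitSquare hp hq)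
  induction L with
  | zero =>
    refine ⟨fun _ => 0, fun p hp => ⟨by simp, ?_, ?_, fun q hq => ?_⟩⟩
    · have := hsq p hp _ hA; rw [pow_zero]; norm_num; linarith
    · have := hsq p hp _ hB; rw [pow_zero]; norm_num; linarith
    · have := hsq p hp q hq; rw [pow_zero]; norm_num; linarith
  | succ L ih =>
    obtain ⟨κ, hκ⟩ := ih
    have hex : ∀ p, ∃ k : Fin 4, ∃ u, p ∈ unitSquare → u ∈ unitSquare ∧ hilbertMap k u = p := by
      intro p
      by_cases hp : p ∈ unitSquare
      · obtain ⟨k, u, hu, h⟩ := exists_hilbertMap_eq hp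
        exact ⟨k, u, fun _ => ⟨hu, h⟩⟩
      · exact ⟨0, p, fun h => absurd h hp⟩
    choose K U hKU using hex
    set e : ℝ := (1 / 4) ^ L with he
    have he0 : 0 < e := by positivity
    have he' : (1 / 4 : ℝ) ^ (L + 1) = e / 4 := by rw [pow_succ, he]; ring
    rw [he']
    -- The quadrant index becomes the leading base-4 digit of the key. A point on a common edge has
    -- a quadrant chosen once and for all.
    refine ⟨fun p => ((K p : ℕ) + κ (U p)) / 4, fun p hp => ?_⟩
    obtain ⟨hU, hS⟩ := hKU p hp
    obtain ⟨⟨k0, k1⟩, kA, kB, kp⟩ := hκ _ hU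
    have hK3 : ((K p : ℕ) : ℝ) ≤ 3 := by
      have := (K p).isLt
      exact_mod_cast (by omega : (K p : ℕ) ≤ 3)
    have hK0 : (0 : ℝ) ≤ ((K p : ℕ) : ℝ) := Nat.cast_nonneg _
    refine ⟨⟨by linarith, by linarith⟩, ?_, ?_, ?_⟩
    · by_cases hk : K p = 0
      · rw [hk] at hS
        nth_rewrite 1 [← hS]
        nth_rewrite 1 [← hilbertMap_zero_start]
        simp only [dist_hilbertMap, hk, div_pow]
        norm_num
        linarith
      · have h1 : (1 : ℝ) ≤ ((K p : ℕ) : ℝ) := by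
          have : (K p : ℕ) ≠ 0 := fun h => hk (Fin.ext h)
          exact_mod_cast Nat.one_le_iff_ne_zero.2 this
        have := hsq p hp _ hA
        linarith
    · by_cases hk : K p = 3
      · rw [hk] at hS
        nth_rewrite 1 [← hS]
        nth_rewrite 1 [← hilbertMap_three_end]
        simp only [dist_hilbertMap, hk, div_pow]
        norm_num
        linarith
      · have h1 : ((K p : ℕ) : ℝ) ≤ 2 := by
          have h2 := (K p).isLt
          have : (K p : ℕ) ≠ 3 := fun h => hk (Fin.ext h)
          exact_mod_cast (by omega : (K p : ℕ) ≤ 2)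
        have := hsq p hp _ hB
        linarith
    -- In the same quadrant, squared distances and keys both shrink by `4`. In adjacent quadrants
    -- the path through the shared corner uses the two endpoint estimates. Otherwise the keys differ
    -- by at least `1/4`, and the trivial bound `1` is enough.
    · have main : ∀ p ∈ unitSquare, ∀ q ∈ unitSquare, (K p : ℕ) ≤ K q →
          dist p q ^ 2 ≤ 16 * (|((K p : ℕ) + κ (U p)) / 4 - ((K q : ℕ) + κ (U q)) / 4| + e / 4) := by
        intro p hp q hq hle
        obtain ⟨hUp, hSp⟩ := hKU p hp
        obtain ⟨hUq, hSq⟩ := hKU q hq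
        obtain ⟨⟨p0, p1⟩, pA, pB, pp⟩ := hκ _ hUp
        obtain ⟨⟨q0, q1⟩, qA, qB, -⟩ := hκ _ hUq
        rcases hle.eq_or_lt with h | h
        · have hk : K p = K q := Fin.ext h
          have h1 := pp _ hUq
          have e1 : ((K p : ℕ) + κ (U p)) / 4 - ((K q : ℕ) + κ (U q)) / 4 =
              (κ (U p) - κ (U q)) / 4 := by rw [hk]; ring
          rw [e1, abs_div, abs_of_pos (by norm_num : (0 : ℝ) < 4)]
          nth_rewrite 1 [← hSp]
          nth_rewrite 1 [← hSq]
          rw [hk, dist_hilbertMap, div_pow]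
          linarith
        · rcases (Nat.succ_le_of_lt h).eq_or_lt with h' | h'
          · have hd : dist p q ≤ dist (U p) (1, 0) / 2 + dist (U q) (0, 0) / 2 := by
              rw [← dist_hilbertMap (K p), ← dist_hilbertMap (K q), hSp, hSq,
                hilbertMap_end h', dist_comm q]
              exact dist_triangle _ _ _
            have h2 : ((K q : ℕ) : ℝ) = (K p : ℕ) + 1 := by exact_mod_cast h'.symm
            have h3 := neg_le_abs (((K p : ℕ) + κ (U p)) / 4 - ((K q : ℕ) + κ (U q)) / 4)
            have h5 : dist p q ^ 2 ≤ (dist (U p) (1, 0) / 2 + dist (U q) (0, 0) / 2) ^ 2 :=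
              pow_le_pow_left₀ dist_nonneg hd 2
            nlinarith [sq_nonneg (dist (U p) (1, 0) - dist (U q) (0, 0))]
          · have h2 : ((K p : ℕ) : ℝ) + 2 ≤ (K q : ℕ) := by exact_mod_cast h'
            have h3 := neg_le_abs (((K p : ℕ) + κ (U p)) / 4 - ((K q : ℕ) + κ (U q)) / 4)
            have := hsq p hp q hq
            linarith
      intro q hq
      rcases le_total (K p : ℕ) (K q) with h | h
      · exact main p hp q hq h
      · rw [dist_comm, abs_sub_comm]
        exact main q hq p hp h

/-- The groups are consecutive blocks of `R` points in the order of the keys. A squared diameter is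
at most `16 * A ^ 2` times the key increment over the block plus `(1/4)^L`. The increments telescope
to at most `1`, and `L` is large enough for the `m` extra terms to sum to at most `1`. -/
lemma hasGrouping_of_unitSquare {m R : ℕ} (hm : 1 ≤ m)
    {ρ : Fin (m * R) → Fin (m * R) → ℝ} (p : Fin (m * R) → ℝ × ℝ) (hp : ∀ i, p i ∈ unitSquare)
    {A : ℝ} (hA : 0 ≤ A) (hρ : ∀ i j, ρ i j ≤ A * dist (p i) (p j)) :
    HasGrouping ρ R m Finset.univ (32 * A ^ 2) := by
  have hm0 : (0 : ℝ) < m := by exact_mod_cast hm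
  obtain ⟨L, hL⟩ := exists_pow_lt_of_lt_one (x := 1 / (m : ℝ)) (y := 1 / 4) (by positivity)
    (by norm_num)
  obtain ⟨κ, hκ⟩ := exists_hilbertKey L
  set e : ℝ := (1 / 4) ^ L with he
  have he0 : 0 < e := by positivity
  set σ := Tuple.sort (fun i => κ (p i)) with hσ
  have hmono : Monotone ((fun i => κ (p i)) ∘ σ) := Tuple.monotone_sort _
  -- The sorted keys, continued by `1` so that the last block also has a right endpoint `U (R * m)`.
  set U : ℕ → ℝ := fun n => if h : n < m * R then κ (p (σ ⟨n, h⟩)) else 1 with hU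
  have hUmono : Monotone U := by
    intro a b hab
    simp only [hU]
    split_ifs with h1 h2 h2
    · exact hmono (show (⟨a, h1⟩ : Fin (m * R)) ≤ ⟨b, h2⟩ from hab)
    · exact (hκ _ (hp _)).1.2
    · omega
    · exact le_rfl
  have hU01 : ∀ n, 0 ≤ U n ∧ U n ≤ 1 := by
    intro n
    simp only [hU]
    split_ifs
    · exact (hκ _ (hp _)).1
    · exact ⟨zero_le_one, le_rfl⟩
  have hUidx : ∀ (g : Fin m) (i : Fin R), κ (p (σ (finProdFinEquiv (g, i)))) = U (i + R * g) := by
    intro g i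
    have h := (finProdFinEquiv (g, i)).isLt
    have h1 : ((finProdFinEquiv (g, i) : Fin (m * R)) : ℕ) = i + R * g := rfl
    rw [h1] at h
    simp only [hU, dif_pos h]
    rfl
  have hgap : ∀ g : ℕ, 0 ≤ U (R * (g + 1)) - U (R * g) := fun g =>
    sub_nonneg.2 (hUmono (Nat.mul_le_mul_left _ (Nat.le_succ g)))
  refine ⟨fun g i => σ (finProdFinEquiv (g, i)),
    fun g => A * √(16 * (U (R * (g + 1)) - U (R * g) + e)), fun g i j => ?_, ?_, fun h => ?_⟩
  · refine (hρ _ _).trans (mul_le_mul_of_nonneg_left (Real.le_sqrt_of_sq_le ?_) hA)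
    refine ((hκ _ (hp _)).2.2.2 _ (hp _)).trans ?_
    gcongr
    rw [hUidx, hUidx]
    have hi := i.isLt
    have hj := j.isLt
    have a1 := hUmono (show R * (g : ℕ) ≤ i + R * g by omega)
    have a2 := hUmono (show R * (g : ℕ) ≤ j + R * g by omega)
    have a3 := hUmono (show i + R * (g : ℕ) ≤ R * (g + 1) by rw [mul_add]; omega)
    have a4 := hUmono (show j + R * (g : ℕ) ≤ R * (g + 1) by rw [mul_add]; omega)
    rw [abs_le]
    constructor <;> linarith
  · have h1 : ∀ g : Fin m, (A * √(16 * (U (R * (g + 1)) - U (R * g) + e))) ^ 2 =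
        16 * A ^ 2 * (U (R * (g + 1)) - U (R * g) + e) := by
      intro g
      have := hgap g
      rw [mul_pow, Real.sq_sqrt (by positivity)]; ring
    simp only [h1]
    rw [← Finset.mul_sum, Finset.sum_add_distrib]
    have h2 : ∑ g : Fin m, (U (R * ((g : ℕ) + 1)) - U (R * g)) = U (R * m) - U (R * 0) := by
      rw [Fin.sum_univ_eq_sum_range (fun g => U (R * (g + 1)) - U (R * g)) m,
        Finset.sum_range_sub (fun g => U (R * g))]
    rw [h2]
    simp only [Finset.sum_const, Finset.card_univ, Fintype.card_fin, nsmul_eq_mul]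
    have h3 := (hU01 (R * m)).2
    have h4 := (hU01 (R * 0)).1
    have h5 : (m : ℝ) * e ≤ 1 := by
      rw [lt_div_iff₀ hm0] at hL; linarith
    nlinarith [sq_nonneg A]
  · rw [← Fintype.sum_prod_type' (f := fun g i => h (σ (finProdFinEquiv (g, i))))]
    exact ((finProdFinEquiv.trans σ).sum_comp h)

/-! ### Covering the parameter set -/

/-- Weighting each lattice point by `x ^ ∑ r i` with `x = 1/(1+η)` costs a factor `(1+η)^M` and
turns the count into a product of geometric series. Counting the simplex instead of the enclosing
cube keeps the base of the covering number independent of the dimension. -/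
lemma card_filter_sum_le (n M : ℕ) {η : ℝ} (hη : 0 < η) :
    (((Fintype.piFinset fun _ : Fin n => Finset.range (M + 1)).filter
      fun r => ∑ i, r i ≤ M).card : ℝ) ≤ (1 + η) ^ M * ((1 + η) / η) ^ n := by
  set x : ℝ := (1 + η)⁻¹ with hx
  have hx0 : 0 < x := by positivity
  have hx1 : x < 1 := inv_lt_one_of_one_lt₀ (by linarith)
  set S := Fintype.piFinset fun _ : Fin n => Finset.range (M + 1) with hS
  have h1 : ((S.filter fun r => ∑ i, r i ≤ M).card : ℝ) * x ^ M ≤ ∑ r ∈ S, x ^ ∑ i, r i := by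
    rw [← nsmul_eq_mul, ← Finset.sum_const]
    refine (Finset.sum_le_sum fun r hr => ?_).trans
      (Finset.sum_le_sum_of_subset_of_nonneg (Finset.filter_subset _ _) fun _ _ _ => by positivity)
    exact pow_le_pow_of_le_one hx0.le hx1.le (Finset.mem_filter.1 hr).2
  have h2 : ∑ r ∈ S, x ^ ∑ i, r i = (∑ j ∈ Finset.range (M + 1), x ^ j) ^ n := by
    simp_rw [← Finset.prod_pow_eq_pow_sum, hS]
    rw [← Finset.prod_univ_sum (fun _ : Fin n => Finset.range (M + 1)) (fun _ j => x ^ j)]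
    simp
  have h3 : ∑ j ∈ Finset.range (M + 1), x ^ j ≤ (1 + η) / η := by
    rw [geom_sum_eq hx1.ne, ← neg_div_neg_eq, neg_sub, neg_sub, div_le_iff₀ (by linarith)]
    have e : (1 + η) / η * (1 - x) = 1 := by rw [hx]; field_simp; ring
    rw [e]
    have : 0 < x ^ (M + 1) := by positivity
    linarith
  have h4 : (1 + η) ^ M * x ^ M = 1 := by
    rw [← mul_pow, hx, mul_inv_cancel₀ (by positivity), one_pow]
  calc _ = (1 + η) ^ M * (((S.filter fun r => ∑ i, r i ≤ M).card : ℝ) * x ^ M) := by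
        rw [mul_comm _ (x ^ M), ← mul_assoc, h4, one_mul]
    _ ≤ (1 + η) ^ M * ((1 + η) / η) ^ n := by
        rw [h2] at h1
        gcongr
        refine h1.trans (pow_le_pow_left₀ (Finset.sum_nonneg fun _ _ => by positivity) h3 n)

lemma abs_sub_eq_abs_abs_sub_abs {x y : ℝ} (h : (0 ≤ x) ↔ (0 ≤ y)) :
    |x - y| = |(|x| - |y|)| := by
  by_cases hx : 0 ≤ x
  · rw [abs_of_nonneg hx, abs_of_nonneg (h.1 hx)]
  · have hy : ¬ 0 ≤ y := fun hy => hx (h.2 hy)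
    rw [abs_of_neg (not_le.1 hx), abs_of_neg (not_le.1 hy), ← abs_neg]
    congr 1; ring

lemma abs_sub_le_of_floor_eq {x y : ℝ} {M : ℕ} (hM : 0 < M) (hx : 0 ≤ x) (hy : 0 ≤ y)
    (h : ⌊M * x⌋₊ = ⌊M * y⌋₊) : |x - y| ≤ 1 / M := by
  have hM' : (0 : ℝ) < M := by exact_mod_cast hM
  have x1 := Nat.floor_le (show 0 ≤ M * x by positivity)
  have x2 := Nat.lt_floor_add_one (M * x)
  have y1 := Nat.floor_le (show 0 ≤ M * y by positivity)
  have y2 := Nat.lt_floor_add_one (M * y)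
  rw [h] at x1 x2
  have e : |x - y| * M = |M * x - M * y| := by rw [← mul_sub, abs_mul, abs_of_pos hM', mul_comm]
  rw [le_div_iff₀ hM', e, abs_le]
  constructor <;> linarith

/-- The parameters can be divided into at most `(1300 / ε)ᵈ` cells of diameter at most `ε`. -/
lemma exists_cells {d : ℕ} (hd : 1 ≤ d) {ε : ℝ} (hε : 0 < ε) (hε5 : ε ≤ 5) :
    ∃ (α : Type) (S : Finset α) (key : ℝ × (Fin d → ℝ) × ℝ → α),
      (∀ θ ∈ ridgeParams d, key θ ∈ S) ∧
      (∀ θ ∈ ridgeParams d, ∀ θ' ∈ ridgeParams d, key θ = key θ' → paramDist θ θ' ≤ ε) ∧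
      (S.card : ℝ) ≤ (1300 / ε) ^ d := by
  classical
  -- Since `‖a‖₁ = 1`, the last `|a i|` is determined by the other `n`. Together with `t` this
  -- leaves `d` continuous parameters.
  obtain ⟨n, rfl⟩ : ∃ n, d = n + 1 := ⟨d - 1, by omega⟩
  -- The meshes `1/M` and `1/P` each contribute at most `ε/2` to the diameter; the `+ 1` keeps `M`
  -- positive when `n = 0`.
  set M : ℕ := ⌈4 * n / ε⌉₊ + 1 with hM
  set P : ℕ := ⌈2 / ε⌉₊ with hP
  have hMpos : 0 < M := Nat.succ_pos _
  have hPpos : 0 < P := Nat.ceil_pos.2 (by positivity)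
  have hM' : (0 : ℝ) < M := by exact_mod_cast hMpos
  have hP' : (0 : ℝ) < P := by exact_mod_cast hPpos
  have hMge : 4 * n / ε ≤ M := by
    rw [hM]; push_cast; linarith [Nat.le_ceil (4 * n / ε)]
  have hMle : (M : ℝ) ≤ 4 * n / ε + 2 := by
    rw [hM]; push_cast
    linarith [Nat.ceil_lt_add_one (show 0 ≤ 4 * n / ε by positivity)]
  have hPge : 2 / ε ≤ P := Nat.le_ceil _
  have hPle : (P : ℝ) ≤ 2 / ε + 1 := (Nat.ceil_lt_add_one (by positivity)).le
  refine ⟨(Fin (n + 1) → Bool) × Bool × ℕ × (Fin n → ℕ),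
    Finset.univ ×ˢ Finset.univ ×ˢ Finset.range (P + 1) ×ˢ
      ((Fintype.piFinset fun _ : Fin n => Finset.range (M + 1)).filter fun r => ∑ i, r i ≤ M),
    fun θ => (fun i => decide (0 ≤ θ.2.1 i), decide (θ.1 = 1), ⌊P * θ.2.2⌋₊,
      fun i => ⌊M * |θ.2.1 i.castSucc|⌋₊), ?_, ?_, ?_⟩
  · rintro ⟨b, a, t⟩ ⟨-, ha, ht0, ht1⟩
    simp only at ha ht0 ht1
    have hsum : ∑ i : Fin n, ⌊M * |a i.castSucc|⌋₊ ≤ M := by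
      have h1 : ∑ i : Fin n, |a i.castSucc| ≤ 1 := by
        rw [l1norm, Fin.sum_univ_castSucc] at ha
        linarith [abs_nonneg (a (Fin.last n))]
      have h2 : ((∑ i : Fin n, ⌊M * |a i.castSucc|⌋₊ : ℕ) : ℝ) ≤ M := by
        push_cast
        calc _ ≤ ∑ i : Fin n, M * |a i.castSucc| :=
              Finset.sum_le_sum fun i _ => Nat.floor_le (by positivity)
          _ ≤ M * 1 := by rw [← Finset.mul_sum]; gcongr
          _ = M := mul_one _
      exact_mod_cast h2
    simp only [Finset.mem_product, Finset.mem_univ, true_and, Finset.mem_range,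
      Finset.mem_filter, Fintype.mem_piFinset]
    refine ⟨Nat.lt_succ_of_le (Nat.floor_le_of_le ?_), fun i => Nat.lt_succ_of_le ?_, hsum⟩
    · nlinarith
    · exact (Finset.single_le_sum (f := fun i : Fin n => ⌊M * |a i.castSucc|⌋₊)
        (fun _ _ => Nat.zero_le _) (Finset.mem_univ i)).trans hsum
  · rintro ⟨b, a, t⟩ ⟨hb, ha, ht0, ht1⟩ ⟨b', a', t'⟩ ⟨hb', ha', ht0', ht1'⟩ hkey
    simp only [Prod.mk.injEq, funext_iff, decide_eq_decide] at hkey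
    simp only at hb ha ht0 ht1 hb' ha' ht0' ht1'
    obtain ⟨h1, h2, h3, h4⟩ := hkey
    have hbb : b = b' := by
      rcases hb with rfl | rfl <;> rcases hb' with rfl | rfl <;>
        first | rfl | norm_num at h2
    have habs : ∀ i : Fin n, |(|a i.castSucc| - |a' i.castSucc|)| ≤ 1 / M := fun i =>
      abs_sub_le_of_floor_eq hMpos (abs_nonneg _) (abs_nonneg _) (h4 i)
    have hsum : ∑ i : Fin n, |(|a i.castSucc| - |a' i.castSucc|)| ≤ n * (1 / M) := by
      refine (Finset.sum_le_sum fun i _ => habs i).trans_eq ?_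
      simp
    have hlast : |(|a (Fin.last n)| - |a' (Fin.last n)|)| ≤ n * (1 / M) := by
      rw [l1norm, Fin.sum_univ_castSucc] at ha ha'
      have e : |a (Fin.last n)| - |a' (Fin.last n)| =
          -∑ i : Fin n, (|a i.castSucc| - |a' i.castSucc|) := by
        rw [Finset.sum_sub_distrib]; linarith
      rw [e, abs_neg]
      exact (Finset.abs_sum_le_sum_abs _ _).trans hsum
    have hA : l1norm (a - a') ≤ 2 * (n * (1 / M)) := by
      rw [l1norm]
      simp only [Pi.sub_apply, abs_sub_eq_abs_abs_sub_abs (h1 _)]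
      rw [Fin.sum_univ_castSucc]
      linarith
    have hT := abs_sub_le_of_floor_eq hPpos ht0 ht0' h3
    have k1 : 2 * (n * (1 / (M : ℝ))) ≤ ε / 2 := by
      rw [div_le_iff₀ hε] at hMge
      rw [mul_one_div, mul_div_assoc', div_le_div_iff₀ hM' (by norm_num)]
      linarith
    have k2 : 1 / (P : ℝ) ≤ ε / 2 := by
      rw [div_le_iff₀ hε] at hPge
      rw [div_le_div_iff₀ hP' (by norm_num)]
      linarith
    simp only [paramDist, hbb, sub_self, abs_zero, zero_add]
    linarith
  · simp only [Finset.card_product, Finset.card_univ, Fintype.card_fun, Fintype.card_bool,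
      Fintype.card_fin, Finset.card_range, Nat.cast_mul, Nat.cast_pow, Nat.cast_ofNat,
      Nat.cast_add, Nat.cast_one]
    -- With `η = ε/4` and `M ≤ 4n/ε + 2`, the factor `(1+η)^M` is at most `e^(n+3)`, exponential in
    -- `n` with a base free of `ε`.
    have hη : 0 < ε / 4 := by positivity
    have hcount := card_filter_sum_le n M hη
    have he3 : Real.exp 1 ≤ 3 := by have := Real.exp_one_lt_d9; linarith
    have k1 : (1 + ε / 4) ^ M ≤ 27 * 3 ^ n := by
      calc (1 + ε / 4) ^ M ≤ Real.exp (ε / 4) ^ M := by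
            gcongr
            have := Real.add_one_le_exp (ε / 4)
            linarith
        _ = Real.exp (M * (ε / 4)) := by rw [← Real.exp_nat_mul]
        _ ≤ Real.exp ((n + 3 : ℕ) * 1) := by
            refine Real.exp_le_exp.2 ?_
            push_cast
            have : M * (ε / 4) ≤ (4 * n / ε + 2) * (ε / 4) := by gcongr
            have e : (4 * n / ε + 2) * (ε / 4) = n + ε / 2 := by field_simp; ring
            linarith
        _ = Real.exp 1 ^ (n + 3) := by rw [Real.exp_nat_mul]
        _ ≤ 3 ^ (n + 3) := by gcongr
        _ = 27 * 3 ^ n := by rw [pow_add]; norm_num; ring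
    have k2 : (1 + ε / 4) / (ε / 4) ≤ 9 / ε := by
      rw [div_le_div_iff₀ hη hε]; nlinarith
    have k3 : (P : ℝ) + 1 ≤ 12 / ε := by
      have : 2 ≤ 10 / ε := by rw [le_div_iff₀ hε]; linarith
      have e : (12 : ℝ) / ε = 2 / ε + 10 / ε := by rw [← add_div]; norm_num
      linarith
    calc _ ≤ (2 : ℝ) ^ (n + 1) * (2 * (12 / ε * ((27 * 3 ^ n) * (9 / ε) ^ n))) := by
          gcongr
          refine hcount.trans ?_
          gcongr
      _ = 1296 / ε * (54 / ε) ^ n := by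
          have : (54 / ε) ^ n = 2 ^ n * 3 ^ n * (9 / ε) ^ n := by
            rw [← mul_pow, ← mul_pow]; congr 1; ring
          rw [this, pow_succ]; ring
      _ ≤ 1300 / ε * (1300 / ε) ^ n := by gcongr <;> norm_num
      _ = _ := by rw [pow_succ]; ring

/-- Once the signs of `b` and of the coordinates are fixed, `|a i₀|` and `t` determine the
parameter. The eight sign patterns occupy strips of the square at mutual distance at least `1/16`;
as all parameters lie within distance `5`, the factor is `80 = 5 * 16`. -/
lemma exists_unitSquare_embedding {d : ℕ} (hd : 1 ≤ d) (hd2 : d ≤ 2) :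
    ∃ p : ℝ × (Fin d → ℝ) × ℝ → ℝ × ℝ, ∀ θ ∈ ridgeParams d, p θ ∈ unitSquare ∧
      ∀ θ' ∈ ridgeParams d, paramDist θ θ' ≤ 80 * dist (p θ) (p θ') := by
  classical
  set i₀ : Fin d := ⟨0, hd⟩
  -- The last coordinate; it coincides with `i₀` when `d = 1`.
  set i₁ : Fin d := ⟨d - 1, by omega⟩
  set k : ℝ × (Fin d → ℝ) × ℝ → ℕ := fun θ => (if θ.1 = 1 then 1 else 0) +
    (if 0 ≤ θ.2.1 i₀ then 2 else 0) + (if 0 ≤ θ.2.1 i₁ then 4 else 0) with hk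
  have hk7 : ∀ θ, k θ ≤ 7 := by
    intro θ; simp only [hk]; split_ifs <;> omega
  have hs : ∀ θ ∈ ridgeParams d, |θ.2.1 i₀| ≤ 1 := by
    intro θ hθ
    rw [← hθ.2.1]
    exact Finset.single_le_sum (f := fun i => |θ.2.1 i|) (fun _ _ => abs_nonneg _)
      (Finset.mem_univ i₀)
  refine ⟨fun θ => ((2 * (k θ : ℝ) + |θ.2.1 i₀|) / 16, θ.2.2), fun θ hθ => ⟨⟨?_, hθ.2.2⟩,
    fun θ' hθ' => ?_⟩⟩
  · have h1 := hs θ hθ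
    have h2 : (k θ : ℝ) ≤ 7 := by exact_mod_cast hk7 θ
    have h3 : (0 : ℝ) ≤ k θ := Nat.cast_nonneg _
    have h4 := abs_nonneg (θ.2.1 i₀)
    constructor <;> simp only <;> linarith
  · have h1 := hs θ hθ
    have h1' := hs θ' hθ'
    have h4 := abs_nonneg (θ.2.1 i₀)
    have h4' := abs_nonneg (θ'.2.1 i₀)
    rw [Prod.dist_eq, Real.dist_eq, Real.dist_eq]
    simp only
    set D := max |(2 * (k θ : ℝ) + |θ.2.1 i₀|) / 16 - (2 * (k θ' : ℝ) + |θ'.2.1 i₀|) / 16|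
      |θ.2.2 - θ'.2.2| with hD
    have hD1 : |(2 * (k θ : ℝ) + |θ.2.1 i₀|) / 16 - (2 * (k θ' : ℝ) + |θ'.2.1 i₀|) / 16| ≤ D :=
      le_max_left _ _
    have hD2 : |θ.2.2 - θ'.2.2| ≤ D := le_max_right _ _
    rw [← sub_div, abs_div, abs_of_pos (by norm_num : (0 : ℝ) < 16)] at hD1
    by_cases hkk : k θ = k θ'
    · have hb : θ.1 = θ'.1 := by
        have h5 := hθ.1
        have h5' := hθ'.1
        simp only [hk] at hkk
        rcases h5 with h | h <;> rcases h5' with h' | h' <;> rw [h, h'] at hkk ⊢ <;>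
          norm_num at hkk <;> split_ifs at hkk <;> omega
      have hi₀ : 0 ≤ θ.2.1 i₀ ↔ 0 ≤ θ'.2.1 i₀ := by
        simp only [hk] at hkk
        by_contra h
        split_ifs at hkk <;> first | omega | tauto
      have hi₁ : 0 ≤ θ.2.1 i₁ ↔ 0 ≤ θ'.2.1 i₁ := by
        simp only [hk] at hkk
        by_contra h
        split_ifs at hkk <;> first | omega | tauto
      rw [hkk] at hD1
      have e : 2 * (k θ' : ℝ) + |θ.2.1 i₀| - (2 * (k θ' : ℝ) + |θ'.2.1 i₀|) =
          |θ.2.1 i₀| - |θ'.2.1 i₀| := by ring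
      rw [e] at hD1
      have hL : l1norm (θ.2.1 - θ'.2.1) ≤ 32 * D := by
        have ha := hθ.2.1
        have ha' := hθ'.2.1
        obtain rfl | rfl : d = 1 ∨ d = 2 := by omega
        · simp only [l1norm, Fin.sum_univ_one, Pi.sub_apply] at ha ha' ⊢
          have e0 : (0 : Fin 1) = i₀ := rfl
          rw [e0, abs_sub_eq_abs_abs_sub_abs hi₀]
          linarith [abs_nonneg (|θ.2.1 i₀| - |θ'.2.1 i₀|)]
        · simp only [l1norm, Fin.sum_univ_two, Pi.sub_apply] at ha ha' ⊢
          have e0 : (0 : Fin 2) = i₀ := rfl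
          have e1 : (1 : Fin 2) = i₁ := rfl
          rw [e0, e1] at ha ha' ⊢
          rw [abs_sub_eq_abs_abs_sub_abs hi₀, abs_sub_eq_abs_abs_sub_abs hi₁]
          have e2 : |θ.2.1 i₁| - |θ'.2.1 i₁| = -(|θ.2.1 i₀| - |θ'.2.1 i₀|) := by linarith
          rw [e2, abs_neg]
          linarith
      have hD0 := (abs_nonneg _).trans hD2
      simp only [paramDist, hb, sub_self, abs_zero, zero_add]
      linarith
    · have h5 := paramDist_le_five hθ hθ'
      have h6 : 1 ≤ |2 * (k θ : ℝ) + |θ.2.1 i₀| - (2 * (k θ' : ℝ) + |θ'.2.1 i₀|)| := by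
        rcases lt_or_gt_of_ne hkk with h | h
        · have : (k θ : ℝ) + 1 ≤ k θ' := by exact_mod_cast h
          rw [le_abs]; right; linarith
        · have : (k θ' : ℝ) + 1 ≤ k θ := by exact_mod_cast h
          rw [le_abs]; left; linarith
      linarith

/-- Ridge function parameters can be divided into groups of equal size and small diameter. -/
theorem exists_hasGrouping : ∃ C : ℝ, 0 < C ∧ ∀ (d m R : ℕ), 1 ≤ d → 1 ≤ m → 0 < R →
    ∀ θ : Fin (m * R) → ℝ × (Fin d → ℝ) × ℝ, (∀ i, θ i ∈ ridgeParams d) →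
      HasGrouping (fun i j => paramDist (θ i) (θ j)) R m Finset.univ
        (C * m * (m : ℝ) ^ (-(2 / ((max d 2 : ℕ) : ℝ)))) := by
  -- Cells of diameter `5 / 2^n` number at most `(1300 * 2^n / 5)^d`, so `A = 260`. The constant
  -- also exceeds the `32 * 80 ^ 2` of the planar case.
  refine ⟨900 * 260 ^ 2, by norm_num, fun d m R hd hm hR θ hθ => ?_⟩
  rcases le_or_gt d 2 with hd2 | hd2
  · obtain ⟨p, hp⟩ := exists_unitSquare_embedding hd hd2
    refine (hasGrouping_of_unitSquare hm (fun i => p (θ i)) (fun i => (hp _ (hθ i)).1)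
      (A := 80) (by norm_num) (fun i j => (hp _ (hθ i)).2 _ (hθ j))).mono ?_
    rw [max_eq_right hd2]
    have hm0 : (m : ℝ) ≠ 0 := by have : m ≠ 0 := by omega
                                 exact_mod_cast this
    norm_num [Real.rpow_neg_one, mul_assoc, hm0]
  · rw [max_eq_left hd2.le]
    refine hasGrouping_of_entropy hd2 hR hm (by norm_num)
      (fun i j => paramDist_le_five (hθ i) (hθ j)) (fun n => ?_) (by simp)
    have hp : (0 : ℝ) < 2 ^ n := by positivity
    obtain ⟨α, S, key, h1, h2, h3⟩ := exists_cells hd (ε := 5 / 2 ^ n) (by positivity)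
      (div_le_self (by norm_num) (one_le_pow₀ (by norm_num)))
    refine ⟨α, S, fun i => key (θ i), fun i => h1 _ (hθ i), fun i j h => h2 _ (hθ i) _ (hθ j) h,
      h3.trans_eq ?_⟩
    congr 1
    field_simp
    norm_num

/-! ### From convex combinations to averages of `m` ridge functions -/

/-- Convex weights are approximated by the frequencies of a long finite sequence. -/
lemma exists_sequence_of_weights {J : Type*} [Fintype J] [Nonempty J] (p : J → ℝ)
    (hp : ∀ j, 0 ≤ p j) (hsum : ∑ j, p j = 1) (N : ℕ) :
    ∃ u : Fin N → J, ∀ h : J → ℝ, (∀ j, |h j| ≤ 1) →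
      |N * ∑ j, p j * h j - ∑ i, h (u i)| ≤ 2 * Fintype.card J := by
  classical
  set n : J → ℕ := fun j => ⌊p j * N⌋₊ with hn
  have hle : ∀ j, (n j : ℝ) ≤ p j * N := fun j => Nat.floor_le (by have := hp j; positivity)
  have hcard : Fintype.card (Σ j, Fin (n j)) ≤ Fintype.card (Fin N) := by
    rw [Fintype.card_sigma, Fintype.card_fin]
    simp only [Fintype.card_fin]
    have : ((∑ j, n j : ℕ) : ℝ) ≤ N := by
      push_cast
      refine (Finset.sum_le_sum fun j _ => hle j).trans_eq ?_
      rw [← Finset.sum_mul, hsum, one_mul]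
    exact_mod_cast this
  obtain ⟨emb⟩ := Function.Embedding.nonempty_of_card_le hcard
  obtain ⟨j₀⟩ := ‹Nonempty J›
  -- Each `j` receives `⌊p j * N⌋` slots; the slots left over by rounding go to an arbitrary `j₀`.
  set u : Fin N → J := Function.extend emb Sigma.fst (fun _ => j₀) with hu
  have hfib : ∀ j, n j ≤ (Finset.univ.filter fun i => u i = j).card := by
    intro j
    have h1 : (Finset.univ.image fun r : Fin (n j) => emb ⟨j, r⟩) ⊆
        Finset.univ.filter fun i => u i = j := by
      intro i hi
      obtain ⟨r, -, rfl⟩ := Finset.mem_image.1 hi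
      simp [hu, emb.injective.extend_apply]
    have h2 := Finset.card_le_card h1
    rwa [Finset.card_image_of_injective _ (fun r r' h => by simpa using emb.injective h),
      Finset.card_univ, Fintype.card_fin] at h2
  set q : J → ℝ := fun j => ((Finset.univ.filter fun i => u i = j).card : ℝ) with hq
  have hqsum : ∑ j, q j = N := by
    have := Finset.card_eq_sum_card_fiberwise (f := u) (s := Finset.univ) (t := Finset.univ)
      (fun _ _ => Finset.mem_coe.2 (Finset.mem_univ _))
    rw [Finset.card_univ, Fintype.card_fin] at this
    simp only [hq]
    exact_mod_cast this.symm
  refine ⟨u, fun h hh => ?_⟩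
  have e1 : ∑ i, h (u i) = ∑ j, q j * h j := by
    rw [← Finset.sum_fiberwise (s := Finset.univ) (g := u)]
    refine Finset.sum_congr rfl fun j _ => ?_
    rw [Finset.sum_congr rfl (g := fun _ => h j)
      (fun i hi => by rw [(Finset.mem_filter.1 hi).2]), Finset.sum_const, nsmul_eq_mul]
  rw [e1, Finset.mul_sum, ← Finset.sum_sub_distrib]
  have hterm : ∀ j, |N * (p j * h j) - q j * h j| ≤ 2 + (q j - p j * N) := by
    intro j
    have h1 : p j * N < n j + 1 := Nat.lt_floor_add_one _
    have h2 : (n j : ℝ) ≤ q j := by simp only [hq]; exact_mod_cast hfib j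
    have e : N * (p j * h j) - q j * h j = (p j * N - q j) * h j := by ring
    rw [e, abs_mul]
    calc |p j * N - q j| * |h j| ≤ |p j * N - q j| * 1 := by gcongr; exact hh j
      _ = |p j * N - q j| := mul_one _
      _ ≤ _ := by rw [abs_le]; constructor <;> linarith
  refine (Finset.abs_sum_le_sum_abs _ _).trans ((Finset.sum_le_sum fun j _ => hterm j).trans ?_)
  rw [Finset.sum_add_distrib, Finset.sum_sub_distrib, hqsum, ← Finset.sum_mul, hsum]
  simp [mul_comm]

/-- A convex combination of ridge functions is approximated by an average of `m` of them. -/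
theorem exists_ridge_average : ∃ C : ℝ, 0 < C ∧ ∀ (d m : ℕ), 1 ≤ d → 1 ≤ m →
    ∀ (J : Type) [Fintype J] (p : J → ℝ) (θ : J → ℝ × (Fin d → ℝ) × ℝ), (∀ j, 0 ≤ p j) →
      ∑ j, p j = 1 → (∀ j, θ j ∈ ridgeParams d) →
      ∃ η : Fin m → ℝ × (Fin d → ℝ) × ℝ, (∀ k, η k ∈ ridgeParams d) ∧ ∀ x ∈ cube d,
        |∑ j, p j * ridge (θ j) x - (1 / (m : ℝ)) * ∑ k, ridge (η k) x| ≤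
          C * √(d : ℝ) * (m : ℝ) ^ (-(1 / 2 : ℝ) - 1 / ((max d 2 : ℕ) : ℝ)) := by
  obtain ⟨C, hC, hgroup⟩ := exists_hasGrouping
  refine ⟨52 * √C + 1, by positivity, fun d m hd hm J _ p θ hp hsum hθ => ?_⟩
  have hm0 : (0 : ℝ) < m := by exact_mod_cast hm
  set D : ℝ := ((max d 2 : ℕ) : ℝ) with hD
  set r : ℝ := (m : ℝ) ^ (-(1 / 2 : ℝ) - 1 / D) with hr
  have hr0 : 0 < r := Real.rpow_pos_of_pos hm0 _
  have hd1 : 1 ≤ √(d : ℝ) := Real.one_le_sqrt.2 (by exact_mod_cast hd)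
  have hJ : Nonempty J := by
    by_contra h
    rw [not_nonempty_iff] at h
    simp at hsum
  -- The group size is free: it is taken so large that the rounding of the weights is negligible,
  -- and it does not enter the final bound.
  obtain ⟨R, hR⟩ := exists_nat_gt (2 * Fintype.card J / r)
  have hR0 : (0 : ℝ) < R := lt_of_le_of_lt (by positivity) hR
  have hRpos : 0 < R := by exact_mod_cast hR0
  obtain ⟨u, hu⟩ := exists_sequence_of_weights p hp hsum (m * R)
  obtain ⟨idx, δ, hδ, hδsum, hidx⟩ := hgroup d m R hd hm hRpos (fun i => θ (u i))
    (fun i => hθ _)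
  have hB : 0 < C * m * (m : ℝ) ^ (-(2 / D)) := by
    have := Real.rpow_pos_of_pos hm0 (-(2 / D))
    positivity
  obtain ⟨ω, hω⟩ := exists_selection hd hRpos (fun g i => θ (u (idx g i))) (fun g i => hθ _) δ hδ
    hB hδsum
  refine ⟨fun k => θ (u (idx k (ω k))), fun k => hθ _, fun x hx => ?_⟩
  have h1 := hω x hx
  have h2 := hu (fun j => ridge (θ j) x) (fun j => abs_ridge_le_one (hθ j) hx)
  have h3 := hidx (fun i => ridge (θ (u i)) x)
  rw [Finset.sum_sub_distrib, ← Finset.mul_sum, h3] at h1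
  set S := ∑ j, p j * ridge (θ j) x
  set T := ∑ i, ridge (θ (u i)) x
  set W := ∑ k, ridge (θ (u (idx k (ω k)))) x
  have hsqrt : √(C * m * (m : ℝ) ^ (-(2 / D))) = √C * (m * r) := by
    rw [mul_assoc, Real.sqrt_mul hC.le]
    congr 1
    have e1 : (m : ℝ) * (m : ℝ) ^ (-(2 / D)) = (m : ℝ) ^ (1 - 2 / D) := by
      rw [sub_eq_add_neg, Real.rpow_add hm0, Real.rpow_one]
    have e2 : (m : ℝ) * r = (m : ℝ) ^ ((1 - 2 / D) * (1 / 2)) := by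
      rw [hr, show (1 - 2 / D) * (1 / 2) = 1 + (-(1 / 2) - 1 / D) by ring, Real.rpow_add hm0,
        Real.rpow_one]
    rw [e1, e2, Real.sqrt_eq_rpow, ← Real.rpow_mul hm0.le]
  rw [hsqrt] at h1
  push_cast at h2
  have e : S - 1 / (m : ℝ) * W =
      (1 / (m * R)) * (m * R * S - T) - (1 / m) * (W - 1 / (R : ℝ) * T) := by
    field_simp; ring
  have k1 : |(1 / (m * R : ℝ)) * (m * R * S - T)| ≤ r * √(d : ℝ) := by
    rw [abs_mul, abs_of_pos (by positivity)]
    calc _ ≤ (1 / (m * R : ℝ)) * (2 * Fintype.card J) := by gcongr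
      _ ≤ (1 / (1 * R : ℝ)) * (2 * Fintype.card J) := by
          gcongr
          exact_mod_cast hm
      _ ≤ r := by
          rw [div_lt_iff₀ hr0] at hR
          rw [one_mul, one_div_mul_eq_div, div_le_iff₀ hR0]
          linarith
      _ ≤ r * √(d : ℝ) := le_mul_of_one_le_right hr0.le hd1
  have k2 : |(1 / m) * (W - 1 / (R : ℝ) * T)| ≤ 52 * √C * r * √(d : ℝ) := by
    rw [abs_mul, abs_of_pos (by positivity)]
    calc _ ≤ (1 / m) * (52 * (√C * (m * r)) * √(d : ℝ)) := by gcongr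
      _ = _ := by field_simp
  rw [e]
  refine (abs_sub _ _).trans ((add_le_add k1 k2).trans_eq (by ring))

/-! ### From integrals to finite combinations -/

lemma isBounded_ridgeParams (d : ℕ) : Bornology.IsBounded (ridgeParams d) := by
  refine (Metric.isBounded_closedBall (x := (0 : ℝ × (Fin d → ℝ) × ℝ)) (r := 1)).subset ?_
  rintro ⟨b, a, t⟩ ⟨hb, ha, ht0, ht1⟩
  simp only at hb ha ht0 ht1
  rw [mem_closedBall_zero_iff, Prod.norm_def, Prod.norm_def]
  refine max_le ?_ (max_le ?_ ?_)
  · rcases hb with h | h <;> simp [h]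
  · refine (pi_norm_le_iff_of_nonneg zero_le_one).2 fun i => ?_
    rw [← ha]
    exact Finset.single_le_sum (f := fun i => |a i|) (fun _ _ => abs_nonneg _) (Finset.mem_univ i)
  · simp only [Real.norm_eq_abs]
    rw [abs_le]; constructor <;> linarith

lemma ridgeParams_nonempty {d : ℕ} (hd : 1 ≤ d) : (ridgeParams d).Nonempty := by
  refine ⟨(1, Pi.single ⟨0, hd⟩ 1, 0), Or.inr rfl, ?_, by simp⟩
  simp [l1norm, Pi.single_apply, apply_ite abs]

lemma paramDist_le_dist {d : ℕ} (θ θ' : ℝ × (Fin d → ℝ) × ℝ) :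
    paramDist θ θ' ≤ (d + 2) * dist θ θ' := by
  have h1 : |θ.1 - θ'.1| ≤ dist θ θ' := le_max_left _ _
  have h2 : dist θ.2 θ'.2 ≤ dist θ θ' := le_max_right _ _
  have h3 : |θ.2.2 - θ'.2.2| ≤ dist θ θ' := (le_max_right _ _ : dist θ.2.2 θ'.2.2 ≤ _).trans h2
  have h4 : dist θ.2.1 θ'.2.1 ≤ dist θ θ' := (le_max_left _ _ : dist θ.2.1 θ'.2.1 ≤ _).trans h2
  have h5 : l1norm (θ.2.1 - θ'.2.1) ≤ d * dist θ θ' := by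
    refine (Finset.sum_le_sum (g := fun _ => dist θ θ') fun i _ => ?_).trans_eq (by simp)
    exact (dist_le_pi_dist θ.2.1 θ'.2.1 i).trans h4
  unfold paramDist
  linarith

/-- The net is presented as an initial segment of a sequence, the form in which
`SimpleFunc.nearestPtInd` selects a nearest point measurably. -/
lemma exists_finite_net {d : ℕ} (hd : 1 ≤ d) {ε : ℝ} (hε : 0 < ε) :
    ∃ (e : ℕ → ℝ × (Fin d → ℝ) × ℝ) (N : ℕ), (∀ n, e n ∈ ridgeParams d) ∧
      ∀ θ ∈ ridgeParams d, ∃ k ≤ N, dist (e k) θ < ε := by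
  obtain ⟨t, ht, hfin, hcov⟩ := Metric.finite_approx_of_totallyBounded
    ((isBounded_ridgeParams d).isCompact_closure.totallyBounded.subset subset_closure) ε hε
  have hne : t.Nonempty := by
    obtain ⟨θ, hθ⟩ := ridgeParams_nonempty hd
    obtain ⟨y, hy, -⟩ := Set.mem_iUnion₂.1 (hcov hθ)
    exact ⟨y, hy⟩
  obtain ⟨e, he⟩ := hfin.countable.exists_eq_range hne
  have hidx : ∀ y, ∃ k, y ∈ t → e k = y := by
    intro y
    by_cases hy : y ∈ t
    · rw [he] at hy
      obtain ⟨k, hk⟩ := hy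
      exact ⟨k, fun _ => hk⟩
    · exact ⟨0, fun h => absurd h hy⟩
  choose idx hidx using hidx
  refine ⟨e, hfin.toFinset.sup idx, fun n => ht (he ▸ Set.mem_range_self n), fun θ hθ => ?_⟩
  obtain ⟨y, hy, hyθ⟩ := Set.mem_iUnion₂.1 (hcov hθ)
  refine ⟨idx y, Finset.le_sup (f := idx) (hfin.mem_toFinset.2 hy), ?_⟩
  rw [hidx y hy, dist_comm]
  exact hyθ

lemma continuous_ridge {d : ℕ} (x : Fin d → ℝ) : Continuous fun θ => ridge (d := d) θ x := by
  unfold ridge dotProduct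
  fun_prop

/-- Integrals of ridge functions are uniformly approximated by finite combinations with the same
total weight. -/
lemma exists_finite_combination {Ω κ : Type} [MeasurableSpace Ω] {μ : Measure Ω} [Fintype κ]
    {d : ℕ} (hd : 1 ≤ d) (w : κ → Ω → ℝ) (hw0 : ∀ c ω, 0 ≤ w c ω)
    (hwi : ∀ c, Integrable (w c) μ) (θ : κ → Ω → ℝ × (Fin d → ℝ) × ℝ)
    (hθm : ∀ c, Measurable (θ c)) (hθ : ∀ c, ∀ᵐ ω ∂μ, θ c ω ∈ ridgeParams d) {ε : ℝ}
    (hε : 0 < ε) :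
    ∃ (J : Type) (_ : Fintype J) (p : J → ℝ) (η : J → ℝ × (Fin d → ℝ) × ℝ), (∀ j, 0 ≤ p j) ∧
      ∑ j, p j = ∑ c, ∫ ω, w c ω ∂μ ∧ (∀ j, η j ∈ ridgeParams d) ∧ ∀ x ∈ cube d,
        |∑ c, ∫ ω, w c ω * ridge (θ c ω) x ∂μ - ∑ j, p j * ridge (η j) x| ≤
          ε * ∑ c, ∫ ω, w c ω ∂μ := by
  -- The factor `d + 2` compares `paramDist` with the product distance, and `4` is the Lipschitz
  -- constant of `abs_ridge_sub_le`.
  obtain ⟨e, N, he, hnet⟩ := exists_finite_net hd (ε := ε / (4 * (d + 2))) (by positivity)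
  set k : κ → Ω → ℕ := fun c ω => SimpleFunc.nearestPtInd e N (θ c ω) with hk
  have hkm : ∀ c j, MeasurableSet {ω | k c ω = j} := fun c j =>
    ((SimpleFunc.measurable _).comp (hθm c)) (measurableSet_singleton j)
  have hkN : ∀ c ω, k c ω < N + 1 := fun c ω => Nat.lt_succ_of_le (SimpleFunc.nearestPtInd_le _ _ _)
  set p : κ × Fin (N + 1) → ℝ := fun j => ∫ ω, {ω | k j.1 ω = j.2}.indicator (w j.1) ω ∂μ with hp
  have hsum : ∀ c, ∀ h : ℕ → ℝ, ∑ j : Fin (N + 1), p (c, j) * h j = ∫ ω, w c ω * h (k c ω) ∂μ := by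
    intro c h
    simp only [hp]
    simp_rw [← integral_mul_const]
    rw [← integral_finsetSum _ fun (j : Fin (N + 1)) _ =>
      ((hwi c).indicator (hkm c j)).mul_const (h j)]
    congr 1
    ext ω
    rw [Finset.sum_eq_single (⟨k c ω, hkN c ω⟩ : Fin (N + 1))]
    · simp
    · intro j _ hj
      have : k c ω ≠ j := fun h => hj (Fin.ext h.symm)
      simp [this]
    · simp
  refine ⟨κ × Fin (N + 1), inferInstance, p, fun j => e j.2, fun j => ?_, ?_, fun j => he _, ?_⟩
  · exact integral_nonneg fun ω => Set.indicator_nonneg (fun ω _ => hw0 _ ω) ω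
  · rw [Fintype.sum_prod_type]
    refine Finset.sum_congr rfl fun c _ => ?_
    simpa using hsum c fun _ => 1
  · intro x hx
    rw [Fintype.sum_prod_type, ← Finset.sum_sub_distrib, Finset.mul_sum]
    refine (Finset.abs_sum_le_sum_abs _ _).trans (Finset.sum_le_sum fun c _ => ?_)
    simp only
    rw [hsum c fun j => ridge (e j) x]
    have hi1 : Integrable (fun ω => w c ω * ridge (θ c ω) x) μ := by
      refine (hwi c).mul_bdd (c := 1)
        ((continuous_ridge x).measurable.comp (hθm c)).aestronglyMeasurable ?_
      filter_upwards [hθ c] with ω hω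
      exact abs_ridge_le_one hω hx
    have hi2 : Integrable (fun ω => w c ω * ridge (e (k c ω)) x) μ := by
      refine (hwi c).mul_bdd (c := 1) ?_ (Filter.Eventually.of_forall fun ω =>
        abs_ridge_le_one (he _) hx)
      exact (((measurable_from_nat (f := fun j => ridge (e j) x)).comp
        ((SimpleFunc.measurable _).comp (hθm c)))).aestronglyMeasurable
    rw [← integral_sub hi1 hi2, ← integral_const_mul, ← Real.norm_eq_abs]
    refine norm_integral_le_of_norm_le ((hwi c).const_mul ε) ?_
    filter_upwards [hθ c] with ω hω
    rw [← mul_sub, norm_mul, Real.norm_of_nonneg (hw0 c ω), mul_comm ε]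
    refine mul_le_mul_of_nonneg_left ?_ (hw0 c ω)
    obtain ⟨j, hjN, hj⟩ := hnet _ hω
    have h1 := SimpleFunc.edist_nearestPt_le e (θ c ω) hjN
    have h2 : dist (θ c ω) (e (k c ω)) ≤ ε / (4 * (d + 2)) := by
      rw [edist_dist, edist_dist, ENNReal.ofReal_le_ofReal_iff dist_nonneg] at h1
      rw [dist_comm]
      exact h1.trans hj.le
    refine (abs_ridge_sub_le hω (he _) hx).trans ?_
    have h3 := paramDist_le_dist (θ c ω) (e (k c ω))
    calc _ ≤ 4 * ((d + 2) * (ε / (4 * (d + 2)))) := by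
          gcongr
          exact h3.trans (by gcongr)
      _ = ε := by field_simp

/-! ### Integral form of the Fourier remainder -/

/-- The kernel of the integral remainder of `e^{iny}` in terms of squared ReLU functions. -/
noncomputable def remainderKernel (n y t : ℝ) : ℂ :=
  -Complex.I * n ^ 3 / 2 * Complex.exp (Complex.I * n * t) * ((max (y - t) 0) ^ 2 : ℝ)

/-- The kernel vanishes for `t > y`. On `[0, y]` an antiderivative is `e^{int}` times the quadratic
Taylor polynomial of `e^{in(y-t)}`, equal to `e^{iny}` at `t = y` and to the polynomial in `y` at `t
= 0`. -/
lemma integral_remainderKernel_of_nonneg (n : ℝ) {y : ℝ} (hy0 : 0 ≤ y) (hy1 : y ≤ 1) :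
    ∫ t in (0 : ℝ)..1, remainderKernel n y t = Complex.exp (Complex.I * n * y) -
      (1 + Complex.I * n * y - n ^ 2 * y ^ 2 / 2) := by
  have hcont : Continuous fun t => remainderKernel n y t := by
    unfold remainderKernel; fun_prop
  have hint : ∀ a b, IntervalIntegrable (fun t => remainderKernel n y t) volume a b :=
    fun a b => hcont.intervalIntegrable a b
  rw [← intervalIntegral.integral_add_adjacent_intervals (hint 0 y) (hint y 1)]
  have h2 : ∫ t in y..1, remainderKernel n y t = 0 := by
    rw [intervalIntegral.integral_congr (g := fun _ => 0)]
    · simp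
    · intro t ht
      rw [Set.uIcc_of_le hy1] at ht
      have : max (y - t) 0 = 0 := max_eq_right (by linarith [ht.1])
      simp [remainderKernel, this]
  have h1 : ∫ t in (0 : ℝ)..y, remainderKernel n y t =
      ∫ t in (0 : ℝ)..y, (-Complex.I * n ^ 3 / 2 * Complex.exp (Complex.I * n * t) *
        (y - t) ^ 2) := by
    refine intervalIntegral.integral_congr fun t ht => ?_
    rw [Set.uIcc_of_le hy0] at ht
    have : max (y - t) 0 = y - t := max_eq_left (by linarith [ht.2])
    simp [remainderKernel, this]
  rw [h2, h1, add_zero, intervalIntegral.integral_eq_sub_of_hasDerivAt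
    (f := fun t : ℝ => Complex.exp (Complex.I * n * t) *
      (1 + Complex.I * n * (y - t) - n ^ 2 * (y - t) ^ 2 / 2))]
  · simp
  · intro t _
    have d0 : HasDerivAt (fun t : ℝ => (t : ℂ)) 1 t := Complex.ofRealCLM.hasDerivAt
    have d1 : HasDerivAt (fun t : ℝ => Complex.exp (Complex.I * n * t))
        (Complex.exp (Complex.I * n * t) * (Complex.I * n * 1)) t :=
      (d0.const_mul (Complex.I * n)).cexp
    have d2 : HasDerivAt (fun t : ℝ => (y : ℂ) - t) (-1) t := d0.const_sub _
    have d3 := ((d2.const_mul (Complex.I * n)).const_add 1).sub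
      (((d2.pow 2).const_mul ((n : ℂ) ^ 2)).div_const 2)
    refine (d1.mul d3).congr_deriv ?_
    simp only [Nat.cast_ofNat, Nat.add_one_sub_one, pow_one, Pi.sub_apply, Pi.pow_apply]
    linear_combination (Complex.exp (Complex.I * n * t) * n ^ 2 * (y - t)) * Complex.I_sq
  · exact (by fun_prop : Continuous _).intervalIntegrable _ _

/-- Since `e^{iny} = e^{i(-n)(-y)}`, negative `y` reduces to the previous case; the kernel with the
nonpositive argument integrates to zero. -/
lemma integral_remainderKernel (n : ℝ) {y : ℝ} (hy : |y| ≤ 1) :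
    ∫ t in (0 : ℝ)..1, (remainderKernel n y t + remainderKernel (-n) (-y) t) =
      Complex.exp (Complex.I * n * y) - (1 + Complex.I * n * y - n ^ 2 * y ^ 2 / 2) := by
  have hcont : ∀ n y : ℝ, Continuous fun t => remainderKernel n y t := fun n y => by
    unfold remainderKernel; fun_prop
  have hzero : ∀ n y : ℝ, y ≤ 0 → ∫ t in (0 : ℝ)..1, remainderKernel n y t = 0 := by
    intro n y hy
    rw [intervalIntegral.integral_congr (g := fun _ => 0)]
    · simp
    · intro t ht
      rw [Set.uIcc_of_le zero_le_one] at ht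
      have : max (y - t) 0 = 0 := max_eq_right (by linarith [ht.1])
      simp [remainderKernel, this]
  rw [intervalIntegral.integral_add ((hcont _ _).intervalIntegrable _ _)
    ((hcont _ _).intervalIntegrable _ _)]
  rw [abs_le] at hy
  rcases le_total 0 y with h | h
  · rw [integral_remainderKernel_of_nonneg n h hy.2, hzero _ _ (by linarith), add_zero]
  · rw [hzero _ _ h, zero_add,
      integral_remainderKernel_of_nonneg (-n) (by linarith) (by linarith [hy.1])]
    push_cast
    ring_nf

lemma norm_remainderKernel_le (n : ℝ) {y t : ℝ} (hy : |y| ≤ 1) (ht : 0 ≤ t) :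
    ‖remainderKernel n y t‖ ≤ |n| ^ 3 / 2 := by
  have h1 : ‖Complex.exp (Complex.I * n * t)‖ = 1 := by
    rw [Complex.norm_exp]; simp
  have h2 : (max (y - t) 0) ^ 2 ≤ 1 := by
    refine pow_le_one₀ (le_max_right _ _) (max_le ?_ zero_le_one)
    linarith [(abs_le.1 hy).2]
  rw [remainderKernel, norm_mul, norm_mul, h1, mul_one, norm_div, norm_mul, norm_neg,
    Complex.norm_I, one_mul, norm_pow, Complex.norm_real, Complex.norm_real, Real.norm_eq_abs,
    Real.norm_of_nonneg (sq_nonneg _)]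
  simpa using mul_le_mul_of_nonneg_left h2 (by positivity : 0 ≤ |n| ^ 3 / 2)

section FourierRemainder

variable {d : ℕ} {F : (Fin d → ℝ) → ℂ}

lemma FiniteFourierMoment.integrable_pow_mul (h3 : FiniteFourierMoment 3 F) (hF : Integrable F)
    {k : ℕ} (hk : k ≤ 3) : Integrable fun ω => l1norm ω ^ k * ‖F ω‖ := by
  refine Integrable.mono' (hF.norm.add h3)
    ((continuous_l1norm.pow k).aestronglyMeasurable.mul hF.1.norm)
    (Filter.Eventually.of_forall fun ω => ?_)
  have h0 := l1norm_nonneg ω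
  rw [Real.norm_of_nonneg (by positivity)]
  have h1 : l1norm ω ^ k ≤ 1 + l1norm ω ^ 3 := by
    rcases le_total (l1norm ω) 1 with h | h
    · exact (pow_le_one₀ h0 h).trans (by linarith [pow_nonneg h0 3])
    · exact (pow_le_pow_right₀ h hk).trans (by linarith)
  calc l1norm ω ^ k * ‖F ω‖ ≤ (1 + l1norm ω ^ 3) * ‖F ω‖ := by gcongr
    _ = _ := by simp only [Pi.add_apply]; ring

lemma fourierMoment_nonneg (s : ℕ) : 0 ≤ fourierMoment s F :=
  integral_nonneg fun ω => mul_nonneg (pow_nonneg (l1norm_nonneg ω) s) (norm_nonneg _)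

lemma integrable_remainderKernel_mul (hF : Integrable F) (h3 : FiniteFourierMoment 3 F)
    {n y : (Fin d → ℝ) → ℝ} (hn : Measurable n) (hy : Measurable y)
    (hnle : ∀ ω, |n ω| ≤ l1norm ω) (hyle : ∀ ω, |y ω| ≤ 1) :
    Integrable (fun p : (Fin d → ℝ) × ℝ => remainderKernel (n p.1) (y p.1) p.2 * F p.1)
      (volume.prod (volume.restrict (Set.Ioc (0 : ℝ) 1))) := by
  refine Integrable.mono' (h3.comp_fst (volume.restrict (Set.Ioc (0 : ℝ) 1))) ?_ ?_
  · refine AEStronglyMeasurable.mul ?_ hF.1.comp_fst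
    have : Continuous fun q : ℝ × ℝ × ℝ => remainderKernel q.1 q.2.1 q.2.2 := by
      unfold remainderKernel; fun_prop
    exact (this.measurable.comp ((hn.comp measurable_fst).prodMk
      ((hy.comp measurable_fst).prodMk measurable_snd))).aestronglyMeasurable
  · have hmem : ∀ᵐ p : (Fin d → ℝ) × ℝ ∂(volume.prod (volume.restrict (Set.Ioc (0 : ℝ) 1))),
        p.2 ∈ Set.Ioc (0 : ℝ) 1 :=
      Measure.quasiMeasurePreserving_snd.ae (ae_restrict_mem measurableSet_Ioc)
    filter_upwards [hmem] with p hp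
    rw [norm_mul]
    refine mul_le_mul_of_nonneg_right ?_ (norm_nonneg _)
    refine (norm_remainderKernel_le _ (hyle _) hp.1.le).trans ?_
    have h1 : |n p.1| ^ 3 ≤ l1norm p.1 ^ 3 := pow_le_pow_left₀ (abs_nonneg _) (hnle _) 3
    have h2 : 0 ≤ |n p.1| ^ 3 := by positivity
    linarith

/-- The integral of the second order Taylor polynomial of `e^{ix·ω}` against `F`. -/
noncomputable def fourierTaylor (F : (Fin d → ℝ) → ℂ) (x : Fin d → ℝ) : ℂ :=
  ∫ ω, (1 + Complex.I * ((x ⬝ᵥ ω : ℝ) : ℂ) - ((x ⬝ᵥ ω : ℝ) : ℂ) ^ 2 / 2) * F ω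

lemma integrable_exp_mul (hF : Integrable F) (x : Fin d → ℝ) :
    Integrable fun ω => Complex.exp (Complex.I * ((x ⬝ᵥ ω : ℝ) : ℂ)) * F ω := by
  refine hF.bdd_mul (c := 1) ?_ (Filter.Eventually.of_forall fun ω => ?_)
  · exact (by unfold dotProduct; fun_prop : Continuous _).aestronglyMeasurable
  · rw [Complex.norm_exp]; simp

lemma integrable_fourierTaylor (hF : Integrable F) (h3 : FiniteFourierMoment 3 F)
    {x : Fin d → ℝ} (hx : x ∈ cube d) :
    Integrable fun ω => (1 + Complex.I * ((x ⬝ᵥ ω : ℝ) : ℂ) -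
      ((x ⬝ᵥ ω : ℝ) : ℂ) ^ 2 / 2) * F ω := by
  have h1 := h3.integrable_pow_mul hF (k := 1) (by norm_num)
  have h2 := h3.integrable_pow_mul hF (k := 2) (by norm_num)
  refine Integrable.mono' ((hF.norm.add h1).add h2) ?_ (Filter.Eventually.of_forall fun ω => ?_)
  · exact (by unfold dotProduct; fun_prop : Continuous _).aestronglyMeasurable.mul hF.1
  · have h := abs_dotProduct_le_of_mem_cube ω hx
    rw [dotProduct_comm] at h
    have h0 := l1norm_nonneg ω
    have hb : ‖1 + Complex.I * ((x ⬝ᵥ ω : ℝ) : ℂ) - ((x ⬝ᵥ ω : ℝ) : ℂ) ^ 2 / 2‖ ≤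
        1 + l1norm ω + l1norm ω ^ 2 := by
      refine (norm_sub_le _ _).trans (add_le_add ((norm_add_le _ _).trans ?_) ?_)
      · simpa using h
      · simp only [norm_div, norm_pow, Complex.norm_real, Real.norm_eq_abs]
        have : |x ⬝ᵥ ω| ^ 2 ≤ l1norm ω ^ 2 := pow_le_pow_left₀ (abs_nonneg _) h 2
        norm_num
        have h2 : (0 : ℝ) ≤ (x ⬝ᵥ ω) ^ 2 := sq_nonneg _
        rw [sq_abs] at this
        linarith
    rw [norm_mul]
    calc _ ≤ (1 + l1norm ω + l1norm ω ^ 2) * ‖F ω‖ := by gcongr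
      _ = _ := by simp only [Pi.add_apply]; ring

/-- The factorisation `x·ω = n y` is left open: in general `n = ‖ω‖₁` and `y` is the normalised
direction paired with `x`, while in dimension one `n = ω 0` and `y = x 0`, which does not depend on
`ω`. -/
lemma integral_exp_sub_fourierTaylor (hF : Integrable F) (h3 : FiniteFourierMoment 3 F)
    {n y : (Fin d → ℝ) → ℝ} (hn : Measurable n) (hy : Measurable y)
    (hnle : ∀ ω, |n ω| ≤ l1norm ω) (hyle : ∀ ω, |y ω| ≤ 1) {x : Fin d → ℝ} (hx : x ∈ cube d)
    (hxy : ∀ ω, x ⬝ᵥ ω = n ω * y ω) :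
    (∫ ω, Complex.exp (Complex.I * ((x ⬝ᵥ ω : ℝ) : ℂ)) * F ω) - fourierTaylor F x =
      ∫ p, (remainderKernel (n p.1) (y p.1) p.2 * F p.1 +
        remainderKernel (-n p.1) (-y p.1) p.2 * F p.1)
          ∂(volume.prod (volume.restrict (Set.Ioc (0 : ℝ) 1))) := by
  have hint : Integrable (fun p : (Fin d → ℝ) × ℝ => remainderKernel (n p.1) (y p.1) p.2 * F p.1 +
      remainderKernel (-n p.1) (-y p.1) p.2 * F p.1)
        (volume.prod (volume.restrict (Set.Ioc (0 : ℝ) 1))) :=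
    (integrable_remainderKernel_mul hF h3 hn hy hnle hyle).add
      (integrable_remainderKernel_mul hF h3 (n := fun ω => -n ω) (y := fun ω => -y ω) hn.neg hy.neg
        (by simpa using hnle) (by simpa using hyle))
  rw [integral_prod _ hint, fourierTaylor,
    ← integral_sub (integrable_exp_mul hF x) (integrable_fourierTaylor hF h3 hx)]
  refine integral_congr_ae (Filter.Eventually.of_forall fun ω => ?_)
  simp only [← add_mul]
  rw [integral_mul_const, ← intervalIntegral.integral_of_le zero_le_one,
    integral_remainderKernel _ (hyle ω), hxy]
  push_cast
  ring_nf

end FourierRemainder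

/-- The sign `1` or `-1`. -/
def boolSign (s : Bool) : ℝ := if s then 1 else -1

/-- The direction `ω / ‖ω‖₁`, with an arbitrary unit vector at `ω = 0`. -/
noncomputable def l1direction {d : ℕ} (hd : 1 ≤ d) (ω : Fin d → ℝ) : Fin d → ℝ :=
  open Classical in if ω = 0 then Pi.single ⟨0, hd⟩ 1 else (l1norm ω)⁻¹ • ω

lemma measurable_l1direction {d : ℕ} (hd : 1 ≤ d) : Measurable (l1direction hd) := by
  unfold l1direction
  exact Measurable.ite (measurableSet_singleton 0) measurable_const
    (continuous_l1norm.measurable.inv.smul measurable_id)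

lemma l1norm_l1direction {d : ℕ} (hd : 1 ≤ d) (ω : Fin d → ℝ) : l1norm (l1direction hd ω) = 1 := by
  unfold l1direction
  split_ifs with h
  · simp [l1norm, Pi.single_apply, apply_ite abs]
  · have := l1norm_pos h
    rw [l1norm_smul, abs_of_pos (by positivity), inv_mul_cancel₀ this.ne']

lemma l1norm_smul_l1direction {d : ℕ} (hd : 1 ≤ d) (ω : Fin d → ℝ) :
    l1norm ω • l1direction hd ω = ω := by
  unfold l1direction
  split_ifs with h
  · simp [h, l1norm]
  · rw [smul_smul, mul_inv_cancel₀ (l1norm_pos h).ne', one_smul]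

/-- The coefficient of the squared ReLU function in the real part of the Fourier remainder. -/
noncomputable def remainderCoeff (n t : ℝ) (c : ℂ) : ℝ :=
  (-Complex.I * n ^ 3 / 2 * Complex.exp (Complex.I * n * t) * c).re

lemma re_remainderKernel_mul (n y t : ℝ) (c : ℂ) :
    (remainderKernel n y t * c).re = remainderCoeff n t c * (max (y - t) 0) ^ 2 := by
  rw [remainderKernel, remainderCoeff, mul_right_comm, Complex.re_mul_ofReal]

lemma abs_remainderCoeff_le (n t : ℝ) (c : ℂ) : |remainderCoeff n t c| ≤ |n| ^ 3 * ‖c‖ / 2 := by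
  refine (Complex.abs_re_le_norm _).trans (le_of_eq ?_)
  have h1 : ‖Complex.exp (Complex.I * n * t)‖ = 1 := by
    rw [Complex.norm_exp]; simp
  rw [norm_mul, norm_mul, h1, norm_div, norm_mul, norm_neg, Complex.norm_I, norm_pow,
    Complex.norm_real, Real.norm_eq_abs]
  simp
  ring

/-- The Fourier remainder is approximated by averages of ridge functions. -/
theorem exists_ridge_average_fourier : ∃ C : ℝ, 0 < C ∧ ∀ (d : ℕ), 1 ≤ d →
    ∀ F : (Fin d → ℝ) → ℂ, Integrable F → FiniteFourierMoment 3 F → 0 < fourierMoment 3 F →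
      ∀ m : ℕ, 1 ≤ m → ∃ η : Fin m → ℝ × (Fin d → ℝ) × ℝ, (∀ k, η k ∈ ridgeParams d) ∧
        ∀ x ∈ cube d,
          |(∫ ω, Complex.exp (Complex.I * ((x ⬝ᵥ ω : ℝ) : ℂ)) * F ω).re - (fourierTaylor F x).re -
              fourierMoment 3 F / m * ∑ k, ridge (η k) x| ≤
            C * fourierMoment 3 F * √(d : ℝ) *
              (m : ℝ) ^ (-(1 / 2 : ℝ) - 1 / ((max d 2 : ℕ) : ℝ)) := by
  obtain ⟨C, hC, hav⟩ := exists_ridge_average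
  refine ⟨C + 1, by positivity, fun d hd F hF h3 hV m hm => ?_⟩
  have hm0 : (0 : ℝ) < m := by exact_mod_cast hm
  set V := fourierMoment 3 F with hVdef
  set μ : Measure ((Fin d → ℝ) × ℝ) := volume.prod (volume.restrict (Set.Ioc (0 : ℝ) 1)) with hμ
  have hmem : ∀ᵐ p ∂μ, p.2 ∈ Set.Ioc (0 : ℝ) 1 :=
    Measure.quasiMeasurePreserving_snd.ae (ae_restrict_mem measurableSet_Ioc)
  have hd1 : 1 ≤ √(d : ℝ) := Real.one_le_sqrt.2 (by exact_mod_cast hd)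
  set r : ℝ := (m : ℝ) ^ (-(1 / 2 : ℝ) - 1 / ((max d 2 : ℕ) : ℝ)) with hr
  have hr0 : 0 < r := Real.rpow_pos_of_pos hm0 _
  set S : Bool → (Fin d → ℝ) × ℝ → ℝ := fun z p =>
    remainderCoeff (boolSign z * l1norm p.1) p.2 (F p.1) with hS
  have hSle : ∀ z p, |S z p| ≤ l1norm p.1 ^ 3 * ‖F p.1‖ / 2 := by
    intro z p
    refine (abs_remainderCoeff_le _ _ _).trans_eq ?_
    have : |boolSign z| = 1 := by cases z <;> simp [boolSign]
    rw [abs_mul, this, one_mul, abs_of_nonneg (l1norm_nonneg _)]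
  have h3μ : Integrable (fun p => l1norm p.1 ^ 3 * ‖F p.1‖) μ := h3.comp_fst _
  have hSm : ∀ z, AEStronglyMeasurable (S z) μ := by
    intro z
    have hc : Continuous fun q : (Fin d → ℝ) × ℝ =>
        -Complex.I * ((boolSign z * l1norm q.1 : ℝ) : ℂ) ^ 3 / 2 *
          Complex.exp (Complex.I * ((boolSign z * l1norm q.1 : ℝ) : ℂ) * q.2) := by
      have := continuous_l1norm (d := d)
      fun_prop
    exact (hc.aestronglyMeasurable.mul hF.1.comp_fst).re
  have hSi : ∀ z, Integrable (S z) μ := fun z =>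
    (h3μ.div_const 2).mono' (hSm z) (Filter.Eventually.of_forall (hSle z))
  -- The signed density `S` is split as `(h + S)/2 - (h - S)/2`, where `h = ‖ω‖₁³|F|/2` dominates
  -- `|S|`. Using `h` in place of `|S|` makes the total mass exactly `V`, whatever the phase of `F`.
  set w : Bool × Bool → (Fin d → ℝ) × ℝ → ℝ := fun c p =>
    (l1norm p.1 ^ 3 * ‖F p.1‖ / 2 + boolSign c.2 * S c.1 p) / 2 with hw
  set θ : Bool × Bool → (Fin d → ℝ) × ℝ → ℝ × (Fin d → ℝ) × ℝ := fun c p =>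
    (boolSign c.2, boolSign c.1 • l1direction hd p.1, p.2) with hθ
  have hw0 : ∀ c p, 0 ≤ w c p := by
    rintro ⟨z, s⟩ p
    have := abs_le.1 (hSle z p)
    cases s <;> simp only [hw, boolSign] <;> norm_num <;> linarith
  have hwi : ∀ c, Integrable (w c) μ := fun c =>
    ((h3μ.div_const 2).add ((hSi c.1).const_mul _)).div_const 2
  have hθm : ∀ c, Measurable (θ c) := by
    intro c
    have hα : Measurable fun p : (Fin d → ℝ) × ℝ => boolSign c.1 • l1direction hd p.1 :=
      ((measurable_l1direction hd).const_smul (boolSign c.1)).comp measurable_fst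
    exact measurable_const.prodMk (hα.prodMk measurable_snd)
  have hθp : ∀ c, ∀ᵐ p ∂μ, θ c p ∈ ridgeParams d := by
    rintro ⟨z, s⟩
    filter_upwards [hmem] with p hp
    refine ⟨?_, ?_, Set.Ioc_subset_Icc_self hp⟩
    · cases s <;> simp [hθ, boolSign]
    · have : |boolSign z| = 1 := by cases z <;> simp [boolSign]
      simp only [hθ]
      rw [l1norm_smul, l1norm_l1direction, this, one_mul]
  have hwsum : ∑ c, ∫ p, w c p ∂μ = V := by
    rw [← integral_finsetSum _ fun c _ => hwi c]
    have e : ∀ p, ∑ c, w c p = l1norm p.1 ^ 3 * ‖F p.1‖ := by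
      intro p
      simp only [hw, Fintype.sum_prod_type, Fintype.sum_bool, boolSign]
      norm_num
      ring
    simp only [e]
    rw [hμ, integral_fun_fst (fun ω => l1norm ω ^ 3 * ‖F ω‖)]
    simp [hVdef, fourierMoment]
  obtain ⟨J, hJ, p, η, hp0, hpsum, hη, happ⟩ := exists_finite_combination hd w hw0 hwi θ hθm hθp
    hr0
  rw [hwsum] at hpsum happ
  obtain ⟨η', hη', happ'⟩ := hav d m hd hm J (fun j => p j / V) η
    (fun j => div_nonneg (hp0 j) hV.le) (by rw [← Finset.sum_div, hpsum, div_self hV.ne']) hη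
  refine ⟨η', hη', fun x hx => ?_⟩
  have hrep : (∫ ω, Complex.exp (Complex.I * ((x ⬝ᵥ ω : ℝ) : ℂ)) * F ω).re -
      (fourierTaylor F x).re = ∑ c, ∫ q, w c q * ridge (θ c q) x ∂μ := by
    have hn : Measurable (l1norm (d := d)) := continuous_l1norm.measurable
    have hy : Measurable fun ω => l1direction hd ω ⬝ᵥ x :=
      (by unfold dotProduct; fun_prop : Continuous fun a : Fin d → ℝ => a ⬝ᵥ x).measurable.comp
        (measurable_l1direction hd)
    have hnle : ∀ ω : Fin d → ℝ, |l1norm ω| ≤ l1norm ω := fun ω =>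
      (abs_of_nonneg (l1norm_nonneg ω)).le
    have hyle : ∀ ω, |l1direction hd ω ⬝ᵥ x| ≤ 1 := fun ω =>
      (abs_dotProduct_le_of_mem_cube _ hx).trans_eq (l1norm_l1direction hd ω)
    have i1 := integrable_remainderKernel_mul hF h3 hn hy hnle hyle
    have i2 := integrable_remainderKernel_mul hF h3 (n := fun ω => -l1norm ω)
      (y := fun ω => -(l1direction hd ω ⬝ᵥ x)) hn.neg hy.neg (by simpa using hnle)
      (by simpa using hyle)
    have hri : ∀ c, Integrable (fun q => w c q * ridge (θ c q) x) μ := by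
      intro c
      refine (hwi c).mul_bdd (c := 1)
        ((continuous_ridge x).measurable.comp (hθm c)).aestronglyMeasurable ?_
      filter_upwards [hθp c] with q hq
      exact abs_ridge_le_one hq hx
    rw [← Complex.sub_re, integral_exp_sub_fourierTaylor hF h3 hn hy hnle hyle hx fun ω => by
      nth_rewrite 1 [← l1norm_smul_l1direction hd ω]
      rw [dotProduct_smul, dotProduct_comm, smul_eq_mul],
      ← integral_finsetSum _ fun c _ => hri c]
    refine (integral_re (𝕜 := ℂ) (i1.add i2)).symm.trans ?_
    refine integral_congr_ae (Filter.Eventually.of_forall fun q => ?_)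
    simp only [Pi.add_apply, RCLike.re_to_complex, Complex.add_re, re_remainderKernel_mul]
    simp only [hw, hθ, hS, ridge, Fintype.sum_prod_type, Fintype.sum_bool, boolSign, smul_dotProduct]
    simp only [if_true, Bool.false_eq_true, if_false, one_mul, smul_eq_mul, neg_mul]
    ring
  have h1 := happ x hx
  have h2 := happ' x hx
  rw [hrep]
  have e : ∑ j, p j / V * ridge (η j) x = (∑ j, p j * ridge (η j) x) / V := by
    rw [Finset.sum_div]; exact Finset.sum_congr rfl fun j _ => by ring
  rw [e] at h2
  set A := ∑ c, ∫ q, w c q * ridge (θ c q) x ∂μ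
  set B := ∑ j, p j * ridge (η j) x
  set D := ∑ k, ridge (η' k) x
  have e2 : A - V / m * D = (A - B) + V * (B / V - 1 / m * D) := by field_simp; ring
  rw [e2]
  refine (abs_add_le _ _).trans ?_
  rw [abs_mul, abs_of_pos hV]
  calc _ ≤ r * V + V * (C * √(d : ℝ) * r) := by gcongr
    _ ≤ r * V * √(d : ℝ) + V * (C * √(d : ℝ) * r) := by
        have := le_mul_of_one_le_right (show 0 ≤ r * V by positivity) hd1
        linarith
    _ = _ := by ring

/-! ### Derivatives of `f` at the origin -/

section FourierDerivatives

variable {d : ℕ}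

/-- The function with Fourier representation `H`. -/
noncomputable def fourierSynthesis (H : (Fin d → ℝ) → ℂ) (x : Fin d → ℝ) : ℂ :=
  ∫ ω, Complex.exp (Complex.I * ((x ⬝ᵥ ω : ℝ) : ℂ)) * H ω

/-- The pairing `(ω, x) ↦ -(x·ω) / (2π)`. -/
noncomputable def scaledPairing (d : ℕ) : (Fin d → ℝ) →L[ℝ] (Fin d → ℝ) →L[ℝ] ℝ :=
  (-(1 / (2 * Real.pi))) • ∑ i : Fin d,
    (ContinuousLinearMap.proj (R := ℝ) (φ := fun _ : Fin d => ℝ) i).smulRight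
      (ContinuousLinearMap.proj (R := ℝ) (φ := fun _ : Fin d => ℝ) i)

lemma scaledPairing_apply (ω x : Fin d → ℝ) :
    scaledPairing d ω x = -(1 / (2 * Real.pi)) * x ⬝ᵥ ω := by
  simp [scaledPairing, dotProduct, mul_comm]

lemma fourierSynthesis_eq (H : (Fin d → ℝ) → ℂ) :
    fourierSynthesis H = VectorFourier.fourierIntegral Real.fourierChar volume
      (scaledPairing d).toLinearMap₁₂ H := by
  ext x
  refine integral_congr_ae (Filter.Eventually.of_forall fun ω => ?_)
  have h : (scaledPairing d).toLinearMap₁₂ ω x = scaledPairing d ω x := rfl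
  simp only [h, scaledPairing_apply, Circle.smul_def, Real.fourierChar_apply, smul_eq_mul]
  congr 2
  have := Real.pi_pos.ne'
  push_cast
  field_simp

lemma norm_le_l1norm (ω : Fin d → ℝ) : ‖ω‖ ≤ l1norm ω :=
  (pi_norm_le_iff_of_nonneg (l1norm_nonneg ω)).2 fun i =>
    Finset.single_le_sum (f := fun i => |ω i|) (fun _ _ => abs_nonneg _) (Finset.mem_univ i)

lemma integrable_norm_pow_mul {H : (Fin d → ℝ) → ℂ} {k : ℕ} (hm : AEStronglyMeasurable H)
    (h : Integrable fun ω => l1norm ω ^ k * ‖H ω‖) : Integrable fun ω => ‖ω‖ ^ k * ‖H ω‖ := by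
  refine h.mono' ((continuous_norm.pow k).aestronglyMeasurable.mul hm.norm)
    (Filter.Eventually.of_forall fun ω => ?_)
  rw [Real.norm_of_nonneg (by positivity)]
  gcongr
  exact norm_le_l1norm ω

lemma contDiff_fourierSynthesis {F : (Fin d → ℝ) → ℂ} (hF : Integrable F)
    (h3 : FiniteFourierMoment 3 F) : ContDiff ℝ 2 (fourierSynthesis F) := by
  rw [fourierSynthesis_eq]
  refine VectorFourier.contDiff_fourierIntegral (N := 2) (scaledPairing d) fun n hn => ?_
  have hn2 : n ≤ 2 := by exact_mod_cast hn
  exact integrable_norm_pow_mul hF.1 (h3.integrable_pow_mul hF (by omega))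

/-- Differentiation under the integral sign. A general `H` allows a second application, to `iω_j F`,
which produces the Hessian. -/
lemma exists_hasFDerivAt_re_fourierSynthesis {H : (Fin d → ℝ) → ℂ} (hH : Integrable H)
    (h1 : Integrable fun ω => l1norm ω ^ 1 * ‖H ω‖) (x : Fin d → ℝ) :
    ∃ D : (Fin d → ℝ) →L[ℝ] ℝ, HasFDerivAt (fun y => (fourierSynthesis H y).re) D x ∧
      ∀ i, D (Pi.single i 1) = (fourierSynthesis (fun ω => Complex.I * ω i * H ω) x).re := by
  have h1' : Integrable fun ω => ‖ω‖ * ‖H ω‖ := by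
    simpa using integrable_norm_pow_mul hH.1 h1
  have hD := VectorFourier.hasFDerivAt_fourierIntegral (scaledPairing d) hH h1' x
  rw [← fourierSynthesis_eq] at hD
  refine ⟨_, Complex.reCLM.hasFDerivAt.comp x hD, fun i => ?_⟩
  rw [ContinuousLinearMap.comp_apply, Complex.reCLM_apply]
  congr 1
  unfold VectorFourier.fourierIntegral
  rw [ContinuousLinearMap.integral_apply]
  · refine integral_congr_ae (Filter.Eventually.of_forall fun ω => ?_)
    have h : (scaledPairing d).toLinearMap₁₂ ω x = scaledPairing d ω x := rfl
    have e1 : ((Real.fourierChar (-scaledPairing d ω x) : Circle) : ℂ) =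
        Complex.exp (Complex.I * ((x ⬝ᵥ ω : ℝ) : ℂ)) := by
      rw [Real.fourierChar_apply, scaledPairing_apply]
      congr 1
      push_cast
      field_simp
    beta_reduce
    rw [h, Circle.smul_def, e1, smul_apply, smul_eq_mul, VectorFourier.fourierSMulRight_apply,
      scaledPairing_apply, single_one_dotProduct, Complex.real_smul, smul_eq_mul]
    congr 1
    push_cast
    field_simp
  · refine (VectorFourier.fourierIntegral_convergent_iff Real.continuous_fourierChar
      (by apply (scaledPairing d).continuous₂) x).2 ?_
    refine (h1'.const_mul (2 * Real.pi * ‖scaledPairing d‖)).mono' hH.1.fourierSMulRight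
      (Filter.Eventually.of_forall fun ω => ?_)
    rw [← mul_assoc]
    exact VectorFourier.norm_fourierSMulRight_le _ _ _

lemma integrable_coord_mul {H : (Fin d → ℝ) → ℂ} {k : ℕ} (hm : AEStronglyMeasurable H)
    (h : Integrable fun ω => l1norm ω ^ (k + 1) * ‖H ω‖) (i : Fin d) :
    Integrable fun ω => l1norm ω ^ k * ‖Complex.I * ω i * H ω‖ := by
  refine h.mono' ((continuous_l1norm.pow k).aestronglyMeasurable.mul ?_)
    (Filter.Eventually.of_forall fun ω => ?_)
  · exact ((by fun_prop : Continuous fun ω : Fin d → ℝ => Complex.I * (ω i : ℂ)).aestronglyMeasurable.mul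
      hm).norm
  · have h0 := l1norm_nonneg ω
    rw [Real.norm_of_nonneg (by positivity), norm_mul, norm_mul, Complex.norm_I, one_mul,
      Complex.norm_real, Real.norm_eq_abs, pow_succ, mul_assoc]
    have : |ω i| ≤ l1norm ω :=
      Finset.single_le_sum (f := fun i => |ω i|) (fun _ _ => abs_nonneg _) (Finset.mem_univ i)
    gcongr

lemma aestronglyMeasurable_coord_mul {H : (Fin d → ℝ) → ℂ} (hm : AEStronglyMeasurable H)
    (i : Fin d) : AEStronglyMeasurable fun ω => Complex.I * (ω i : ℂ) * H ω :=
  (by fun_prop : Continuous fun ω : Fin d → ℝ => Complex.I * (ω i : ℂ)).aestronglyMeasurable.mul hm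

lemma cube_mem_nhds {x : Fin d → ℝ} (hx : ‖x‖ < 1) : cube d ∈ nhds x := by
  refine Filter.mem_of_superset (Metric.isOpen_ball.mem_nhds (mem_ball_zero_iff.2 hx)) fun y hy => ?_
  rw [mem_cube_iff_abs]
  exact fun i => (norm_le_pi_norm y i).trans (mem_ball_zero_iff.1 hy).le

variable {f : (Fin d → ℝ) → ℝ} {F : (Fin d → ℝ) → ℂ}

lemma HasFourierRepresentationOn.eq_re (hf : HasFourierRepresentationOn f F (cube d))
    {x : Fin d → ℝ} (hx : x ∈ cube d) : f x = (fourierSynthesis F x).re := by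
  rw [fourierSynthesis, ← hf.2 x hx, Complex.ofReal_re]

/-- The representation holds only on the cube. Agreement near every interior point, not just at `0`,
is what lets second derivatives be transferred. -/
lemma HasFourierRepresentationOn.eventuallyEq (hf : HasFourierRepresentationOn f F (cube d))
    {x : Fin d → ℝ} (hx : ‖x‖ < 1) : f =ᶠ[nhds x] fun y => (fourierSynthesis F y).re := by
  filter_upwards [cube_mem_nhds hx] with y hy
  exact hf.eq_re hy

lemma HasFourierRepresentationOn.contDiffAt (hf : HasFourierRepresentationOn f F (cube d))
    (h3 : FiniteFourierMoment 3 F) : ContDiffAt ℝ 2 f 0 :=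
  ((Complex.reCLM.contDiff.comp (contDiff_fourierSynthesis hf.1 h3)).contDiffAt).congr_of_eventuallyEq
    (hf.eventuallyEq (by simp))

lemma HasFourierRepresentationOn.gradVec_eq (hf : HasFourierRepresentationOn f F (cube d))
    (h3 : FiniteFourierMoment 3 F) {x : Fin d → ℝ} (hx : ‖x‖ < 1) (j : Fin d) :
    gradVec f x j = (fourierSynthesis (fun ω => Complex.I * ω j * F ω) x).re := by
  obtain ⟨D, hD, hDi⟩ := exists_hasFDerivAt_re_fourierSynthesis hf.1
    (h3.integrable_pow_mul hf.1 (by norm_num)) x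
  rw [gradVec, (hf.eventuallyEq hx).fderiv_eq, hD.fderiv, hDi]

lemma integrable_coord_mul_self (hF : Integrable F) (h3 : FiniteFourierMoment 3 F) (j : Fin d) :
    Integrable fun ω => Complex.I * (ω j : ℂ) * F ω := by
  have := integrable_coord_mul (k := 0) hF.1 (h3.integrable_pow_mul hF (by norm_num)) j
  simp only [pow_zero, one_mul] at this
  exact (integrable_norm_iff (aestronglyMeasurable_coord_mul hF.1 j)).1 this

lemma integrable_coord_mul_coord_mul (hF : Integrable F) (h3 : FiniteFourierMoment 3 F)
    (i j : Fin d) : Integrable fun ω => Complex.I * (ω i : ℂ) * (Complex.I * (ω j : ℂ) * F ω) := by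
  have := integrable_coord_mul (k := 0) (aestronglyMeasurable_coord_mul hF.1 j)
    (integrable_coord_mul (k := 1) hF.1 (h3.integrable_pow_mul hF (by norm_num)) j) i
  simp only [pow_zero, one_mul] at this
  exact (integrable_norm_iff (aestronglyMeasurable_coord_mul
    (aestronglyMeasurable_coord_mul hF.1 j) i)).1 this

lemma HasFourierRepresentationOn.hessMat_eq (hf : HasFourierRepresentationOn f F (cube d))
    (h3 : FiniteFourierMoment 3 F) (i j : Fin d) :
    hessMat f 0 i j =
      (∫ ω, Complex.I * (ω i : ℂ) * (Complex.I * (ω j : ℂ) * F ω)).re := by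
  obtain ⟨D, hD, hDi⟩ := exists_hasFDerivAt_re_fourierSynthesis
    (integrable_coord_mul_self hf.1 h3 j)
    (integrable_coord_mul (k := 1) hf.1.1 (h3.integrable_pow_mul hf.1 (by norm_num)) j) 0
  have hev : (fun y => gradVec f y j) =ᶠ[nhds 0]
      fun y => (fourierSynthesis (fun ω => Complex.I * ω j * F ω) y).re := by
    filter_upwards [Metric.ball_mem_nhds (0 : Fin d → ℝ) one_pos] with y hy
    exact hf.gradVec_eq h3 (mem_ball_zero_iff.1 hy) j
  rw [hessMat, Matrix.of_apply, hev.fderiv_eq, hD.fderiv, hDi, fourierSynthesis]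
  simp

/-- The second order Taylor polynomial of `f` at `0` is the integral of those of `e^{ix·ω}`. -/
lemma HasFourierRepresentationOn.taylor_eq (hf : HasFourierRepresentationOn f F (cube d))
    (h3 : FiniteFourierMoment 3 F) (x : Fin d → ℝ) :
    f 0 + gradVec f 0 ⬝ᵥ x + (x ⬝ᵥ (hessMat f 0).mulVec x) / 2 = (fourierTaylor F x).re := by
  have hF := hf.1
  have hg := fun j => integrable_coord_mul_self hF h3 j
  have hh := fun i j => integrable_coord_mul_coord_mul hF h3 i j
  have h1 : fourierTaylor F x = (∫ ω, F ω) + ∑ j, (x j : ℂ) * (∫ ω, Complex.I * (ω j : ℂ) * F ω) +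
      (∑ i, ∑ j, ((x i * x j : ℝ) : ℂ) *
        ∫ ω, Complex.I * (ω i : ℂ) * (Complex.I * (ω j : ℂ) * F ω)) / 2 := by
    have s1 : Integrable fun ω => ∑ j, (x j : ℂ) * (Complex.I * (ω j : ℂ) * F ω) :=
      integrable_finsetSum _ fun j _ => (hg j).const_mul _
    have s2 : Integrable fun ω => ∑ i, ∑ j, ((x i * x j : ℝ) : ℂ) *
        (Complex.I * (ω i : ℂ) * (Complex.I * (ω j : ℂ) * F ω)) :=
      integrable_finsetSum _ fun i _ => integrable_finsetSum _ fun j _ => (hh i j).const_mul _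
    have s3 : Integrable fun ω => F ω + ∑ j, (x j : ℂ) * (Complex.I * (ω j : ℂ) * F ω) := hF.add s1
    simp_rw [← integral_const_mul]
    rw [← integral_finsetSum _ fun j _ => (hg j).const_mul (x j : ℂ)]
    simp_rw [← integral_finsetSum Finset.univ fun j _ => (hh _ j).const_mul ((x _ * x j : ℝ) : ℂ)]
    rw [← integral_finsetSum _ fun i _ => integrable_finsetSum _ fun j _ => (hh i j).const_mul _,
      ← integral_div, ← integral_add hF s1, ← integral_add s3 (s2.div_const 2),
      fourierTaylor]
    refine integral_congr_ae (Filter.Eventually.of_forall fun ω => ?_)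
    have e1 : ∑ j, (x j : ℂ) * (Complex.I * (ω j : ℂ) * F ω) =
        Complex.I * ((x ⬝ᵥ ω : ℝ) : ℂ) * F ω := by
      rw [dotProduct, Complex.ofReal_sum, Finset.mul_sum, Finset.sum_mul]
      exact Finset.sum_congr rfl fun j _ => by push_cast; ring
    have e2 : ∑ i, ∑ j, ((x i * x j : ℝ) : ℂ) *
        (Complex.I * (ω i : ℂ) * (Complex.I * (ω j : ℂ) * F ω)) =
        -((x ⬝ᵥ ω : ℝ) : ℂ) ^ 2 * F ω := by
      rw [dotProduct, Complex.ofReal_sum, sq, Finset.sum_mul_sum, ← Finset.sum_neg_distrib,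
        Finset.sum_mul]
      refine Finset.sum_congr rfl fun i _ => ?_
      rw [← Finset.sum_neg_distrib, Finset.sum_mul]
      refine Finset.sum_congr rfl fun j _ => ?_
      push_cast
      linear_combination (x i * x j * ω i * ω j * F ω : ℂ) * Complex.I_sq
    simp only [e1, e2]
    ring
  have h0 : f 0 = (∫ ω, F ω).re := by
    rw [hf.eq_re (zero_mem_cube d), fourierSynthesis]; simp
  have hgrad : ∀ j, gradVec f 0 j = (∫ ω, Complex.I * (ω j : ℂ) * F ω).re := by
    intro j
    rw [hf.gradVec_eq h3 (by simp), fourierSynthesis]; simp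
  rw [h1, h0]
  simp only [Complex.add_re, Complex.re_sum, Complex.re_ofReal_mul, Complex.div_ofNat_re]
  congr 1
  · congr 1
    rw [dotProduct]
    exact Finset.sum_congr rfl fun j _ => by rw [hgrad, mul_comm]
  · congr 1
    simp only [dotProduct, Matrix.mulVec]
    refine Finset.sum_congr rfl fun i _ => ?_
    rw [Finset.mul_sum]
    refine Finset.sum_congr rfl fun j _ => ?_
    rw [hf.hessMat_eq h3]
    ring

end FourierDerivatives

/-! ### Quadrature in dimension one -/

/-- The function `z ↦ z₊²` is convex with a 2-Lipschitz derivative: it lies above its tangents, by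
at most the squared displacement. -/
lemma max_sub_zero_sq_bounds (A e : ℝ) :
    (max A 0) ^ 2 - 2 * max A 0 * e ≤ (max (A - e) 0) ^ 2 ∧
      (max (A - e) 0) ^ 2 ≤ (max A 0) ^ 2 - 2 * max A 0 * e + e ^ 2 := by
  rcases le_total A 0 with hA | hA
  · rw [max_eq_right hA]
    rcases le_total (A - e) 0 with h | h
    · rw [max_eq_right h]; constructor <;> nlinarith
    · rw [max_eq_left h]; constructor <;> nlinarith
  · rw [max_eq_left hA]
    rcases le_total (A - e) 0 with h | h
    · rw [max_eq_right h]; constructor <;> nlinarith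
    · rw [max_eq_left h]; constructor <;> nlinarith [sq_nonneg e]

/-- The error of linear interpolation of `t ↦ (y - t)₊²` on an interval of length `L`. -/
lemma abs_interpolation_error_le (y : ℝ) {p L t : ℝ} (hL : 0 < L) (hp : p ≤ t) (ht : t ≤ p + L) :
    |(max (y - t) 0) ^ 2 - ((1 - (t - p) / L) * (max (y - p) 0) ^ 2 +
      (t - p) / L * (max (y - (p + L)) 0) ^ 2)| ≤ L ^ 2 := by
  set l : ℝ := (t - p) / L with hl
  have hl0 : 0 ≤ l := div_nonneg (by linarith) hL.le
  have hl1 : l ≤ 1 := (div_le_one hL).2 (by linarith)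
  have htl : t = p + l * L := by rw [hl]; field_simp; ring
  obtain ⟨a1, a2⟩ := max_sub_zero_sq_bounds (y - t) (p - t)
  obtain ⟨b1, b2⟩ := max_sub_zero_sq_bounds (y - t) (p + L - t)
  rw [sub_sub_sub_cancel_right] at a1 a2 b1 b2
  have e1 : p - t = -(l * L) := by rw [htl]; ring
  have e2 : p + L - t = (1 - l) * L := by rw [htl]; ring
  rw [e1] at a1 a2
  rw [e2] at b1 b2
  set X := (max (y - p) 0) ^ 2
  set Y := (max (y - (p + L)) 0) ^ 2
  set Z := max (y - t) 0
  have hl1' : 0 ≤ 1 - l := by linarith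
  -- In the average of the tangent bounds at the two nodes the linear terms cancel, leaving an error
  -- of at most `l(1-l)L²`.
  have c1 := mul_le_mul_of_nonneg_left a1 hl1'
  have c2 := mul_le_mul_of_nonneg_left a2 hl1'
  have d1 := mul_le_mul_of_nonneg_left b1 hl0
  have d2 := mul_le_mul_of_nonneg_left b2 hl0
  have hLL : l * (1 - l) * L ^ 2 ≤ L ^ 2 := by
    have : l * (1 - l) ≤ 1 := by nlinarith
    nlinarith [sq_nonneg L]
  rw [abs_le]
  constructor <;> nlinarith

lemma integral_sub_div (p : ℝ) {L : ℝ} (hL : 0 < L) :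
    ∫ t in p..(p + L), (t - p) / L = L / 2 := by
  rw [intervalIntegral.integral_div, intervalIntegral.integral_sub (continuous_id'.intervalIntegrable _ _)
    intervalIntegrable_const, integral_id, intervalIntegral.integral_const]
  simp only [smul_eq_mul]
  field_simp
  ring

section Quadrature

variable {φ : ℝ → ℝ} {B : ℝ}

lemma abs_integral_mul_le (hφ : ∀ t, |φ t| ≤ B) {g : ℝ → ℝ} {a b : ℝ} (hab : a ≤ b)
    (hg : IntervalIntegrable g volume a b) (hg0 : ∀ t ∈ Set.Ioc a b, 0 ≤ g t) :
    |∫ t in a..b, φ t * g t| ≤ B * ∫ t in a..b, g t := by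
  rw [← intervalIntegral.integral_const_mul, ← Real.norm_eq_abs]
  refine intervalIntegral.norm_integral_le_of_norm_le hab
    (Filter.Eventually.of_forall fun t ht => ?_) (hg.const_mul B)
  rw [norm_mul, Real.norm_eq_abs, Real.norm_of_nonneg (hg0 t ht)]
  exact mul_le_mul_of_nonneg_right (hφ t) (hg0 t ht)

/-- A bounded density on `[0,1]` is replaced by `2q` point masses, with second order error when
integrated against `(y - t)₊²`. -/
lemma exists_point_masses (hint : IntervalIntegrable φ volume 0 1) (hφ : ∀ t, |φ t| ≤ B)
    {m : ℕ} (hm : 1 ≤ m) :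
    ∃ (β τ : Bool × Fin (m / 4) → ℝ), (∀ k, |β k| ≤ B * (2 / m)) ∧
      (∀ k, τ k ∈ Set.Icc (0 : ℝ) 1) ∧ ∀ y ≤ 1,
        |(∫ t in (0 : ℝ)..1, φ t * (max (y - t) 0) ^ 2) - ∑ k, β k * (max (y - τ k) 0) ^ 2| ≤
          32 * B / m ^ 2 := by
  have hm0 : (0 : ℝ) < m := by exact_mod_cast hm
  have hB : 0 ≤ B := (abs_nonneg _).trans (hφ 0)
  -- Two directions times two nodes per interval use `4 * (m / 4) ≤ m` ridge functions. The
  -- intervals of length `4/m` leave a tail of length at most `L`, which is all of `[0,1]` when `m <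
  -- 4`.
  set q : ℕ := m / 4 with hq
  set L : ℝ := 4 / m with hL
  have hL0 : 0 < L := by positivity
  have hqm : 4 * (q : ℝ) ≤ m := by exact_mod_cast (show 4 * q ≤ m by omega)
  have hqm' : (m : ℝ) ≤ 4 * q + 4 := by exact_mod_cast (show m ≤ 4 * q + 4 by omega)
  have hqL : q * L ≤ 1 := by rw [hL, mul_div_assoc', div_le_one hm0]; linarith
  have hqL' : 1 ≤ q * L + L := by
    have : q * L + L = (4 * q + 4) / m := by rw [hL]; field_simp
    rw [this, le_div_iff₀ hm0]; linarith
  have hjL : ∀ j : ℕ, j < q → (j : ℝ) * L + L ≤ 1 := by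
    intro j hj
    have : (j : ℝ) + 1 ≤ q := by exact_mod_cast hj
    nlinarith
  have hsub : ∀ a b, 0 ≤ a → a ≤ b → b ≤ 1 → IntervalIntegrable φ volume a b := by
    intro a b ha hab hb
    refine hint.mono_set ?_
    rw [Set.uIcc_of_le hab, Set.uIcc_of_le zero_le_one]
    exact Set.Icc_subset_Icc ha hb
  -- The mass of each interval is shared between its endpoints by linear interpolation weights, each
  -- of integral `L/2`.
  set β : Bool × Fin q → ℝ := fun k =>
    if k.1 then ∫ t in (k.2 * L : ℝ)..(k.2 * L + L), φ t * ((t - k.2 * L) / L)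
    else ∫ t in (k.2 * L : ℝ)..(k.2 * L + L), φ t * (1 - (t - k.2 * L) / L) with hβ
  set τ : Bool × Fin q → ℝ := fun k => if k.1 then k.2 * L + L else k.2 * L with hτ
  have hpos : ∀ j : Fin q, (0 : ℝ) ≤ j * L := fun j => by positivity
  refine ⟨β, τ, ?_, ?_, ?_⟩
  · rintro ⟨s, j⟩
    have hle : (j * L : ℝ) ≤ j * L + L := by linarith
    have e2 : (2 : ℝ) / m = L / 2 := by rw [hL]; ring
    rw [e2]
    cases s
    · simp only [hβ, Bool.false_eq_true, if_false]
      refine (abs_integral_mul_le hφ hle ((by fun_prop : Continuous _).intervalIntegrable _ _)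
        fun t ht => ?_).trans_eq ?_
      · have : (t - j * L) / L ≤ 1 := (div_le_one hL0).2 (by linarith [ht.2])
        linarith
      · rw [intervalIntegral.integral_sub intervalIntegrable_const
          ((by fun_prop : Continuous _).intervalIntegrable _ _), integral_sub_div _ hL0,
          intervalIntegral.integral_const]
        simp only [smul_eq_mul]
        ring
    · simp only [hβ, if_true]
      refine (abs_integral_mul_le hφ hle ((by fun_prop : Continuous _).intervalIntegrable _ _)
        fun t ht => ?_).trans_eq ?_
      · exact div_nonneg (by linarith [ht.1]) hL0.le
      · rw [integral_sub_div _ hL0]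
  · rintro ⟨s, j⟩
    have h1 := hjL j j.isLt
    have h2 := hpos j
    cases s
    · simp only [hτ, Bool.false_eq_true, if_false]
      exact ⟨h2, by linarith⟩
    · simp only [hτ, if_true]
      exact ⟨by linarith, h1⟩
  · intro y hy
    set s : ℝ → ℝ := fun t => (max (y - t) 0) ^ 2 with hs
    have hsc : Continuous s := by simp only [hs]; fun_prop
    have hφs : ∀ g : ℝ → ℝ, Continuous g → ∀ a b, 0 ≤ a → a ≤ b → b ≤ 1 →
        IntervalIntegrable (fun t => φ t * g t) volume a b := fun g hg a b ha hab hb =>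
      (hsub a b ha hab hb).mul_continuousOn hg.continuousOn
    have hsplit : ∀ n ≤ q, ∫ t in (0 : ℝ)..(n * L), φ t * s t =
        ∑ j ∈ Finset.range n, ∫ t in (j * L : ℝ)..(j * L + L), φ t * s t := by
      intro n
      induction n with
      | zero => intro _; simp
      | succ n ih =>
        intro hn
        have h1 := hjL n (by omega)
        rw [Finset.sum_range_succ, ← ih (by omega)]
        have e : ((n + 1 : ℕ) : ℝ) * L = n * L + L := by push_cast; ring
        rw [e, intervalIntegral.integral_add_adjacent_intervals]
        · exact hφs s hsc _ _ le_rfl (by positivity) (by linarith)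
        · exact hφs s hsc _ _ (by positivity) (by linarith) h1
    have hmain : ∫ t in (0 : ℝ)..1, φ t * s t =
        (∑ j : Fin q, ∫ t in (j * L : ℝ)..(j * L + L), φ t * s t) +
          ∫ t in (q * L : ℝ)..1, φ t * s t := by
      rw [Fin.sum_univ_eq_sum_range (fun j : ℕ => ∫ t in (j * L : ℝ)..(j * L + L), φ t * s t),
        ← hsplit q le_rfl, intervalIntegral.integral_add_adjacent_intervals]
      · exact hφs s hsc _ _ le_rfl (by positivity) hqL
      · exact hφs s hsc _ _ (by positivity) hqL le_rfl
    have hcell : ∀ j : Fin q, |(∫ t in (j * L : ℝ)..(j * L + L), φ t * s t) -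
        (β (false, j) * s (j * L) + β (true, j) * s (j * L + L))| ≤ B * L ^ 2 * L := by
      intro j
      have h1 := hjL j j.isLt
      have h2 := hpos j
      have hle : (j * L : ℝ) ≤ j * L + L := by linarith
      have i1 := hφs s hsc _ _ h2 hle h1
      have i2 := hφs (fun t => 1 - (t - j * L) / L) (by fun_prop) _ _ h2 hle h1
      have i3 := hφs (fun t => (t - j * L) / L) (by fun_prop) _ _ h2 hle h1
      have e : (∫ t in (j * L : ℝ)..(j * L + L), φ t * s t) -
          (β (false, j) * s (j * L) + β (true, j) * s (j * L + L)) =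
          ∫ t in (j * L : ℝ)..(j * L + L), (φ t * s t -
            (φ t * (1 - (t - j * L) / L) * s (j * L) + φ t * ((t - j * L) / L) * s (j * L + L))) := by
        rw [intervalIntegral.integral_sub i1 ((i2.mul_const _).add (i3.mul_const _)),
          intervalIntegral.integral_add (i2.mul_const _) (i3.mul_const _),
          intervalIntegral.integral_mul_const, intervalIntegral.integral_mul_const]
        simp [hβ]
      rw [e, ← Real.norm_eq_abs]
      refine (intervalIntegral.norm_integral_le_of_norm_le_const (C := B * L ^ 2)
        fun t ht => ?_).trans_eq ?_
      · rw [Set.uIoc_of_le hle] at ht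
        have h3 := abs_interpolation_error_le y hL0 ht.1.le ht.2
        have e3 : φ t * s t - (φ t * (1 - (t - j * L) / L) * s (j * L) +
            φ t * ((t - j * L) / L) * s (j * L + L)) =
            φ t * (s t - ((1 - (t - j * L) / L) * s (j * L) +
              (t - j * L) / L * s (j * L + L))) := by ring
        rw [e3, norm_mul, Real.norm_eq_abs, Real.norm_eq_abs]
        exact mul_le_mul (hφ t) h3 (abs_nonneg _) hB
      · rw [add_sub_cancel_left, abs_of_pos hL0]
    -- No node is spent on the tail: there `y - t ≤ 1 - qL ≤ L`, so `(y - t)₊²` is already at most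
    -- `L²`.
    have htail : |∫ t in (q * L : ℝ)..1, φ t * s t| ≤ B * L ^ 2 := by
      rw [← Real.norm_eq_abs]
      refine (intervalIntegral.norm_integral_le_of_norm_le_const (C := B * L ^ 2)
        fun t ht => ?_).trans ?_
      · rw [Set.uIoc_of_le hqL] at ht
        rw [norm_mul, Real.norm_eq_abs, Real.norm_of_nonneg (sq_nonneg _)]
        refine mul_le_mul (hφ t) (pow_le_pow_left₀ (le_max_right _ _) (max_le ?_ hL0.le) 2)
          (sq_nonneg _) hB
        linarith [ht.1]
      · rw [abs_of_nonneg (by linarith)]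
        refine mul_le_of_le_one_right (by positivity) ?_
        have : 0 ≤ q * L := by positivity
        linarith
    have hsumeq : ∑ k, β k * (max (y - τ k) 0) ^ 2 =
        ∑ j : Fin q, (β (false, j) * s (j * L) + β (true, j) * s (j * L + L)) := by
      rw [Fintype.sum_prod_type, Fintype.sum_bool, ← Finset.sum_add_distrib]
      refine Finset.sum_congr rfl fun j _ => ?_
      simp only [hτ, hs, if_true, Bool.false_eq_true, if_false]
      ring
    rw [hsumeq]
    change |(∫ t in (0 : ℝ)..1, φ t * s t) - _| ≤ _
    rw [hmain, add_sub_right_comm, ← Finset.sum_sub_distrib]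
    refine (abs_add_le _ _).trans ?_
    have h5 : |∑ j : Fin q, ((∫ t in (j * L : ℝ)..(j * L + L), φ t * s t) -
        (β (false, j) * s (j * L) + β (true, j) * s (j * L + L)))| ≤ B * L ^ 2 := by
      refine (Finset.abs_sum_le_sum_abs _ _).trans
        ((Finset.sum_le_sum fun j _ => hcell j).trans ?_)
      rw [Finset.sum_const, Finset.card_univ, Fintype.card_fin, nsmul_eq_mul]
      have : 0 ≤ B * L ^ 2 := by positivity
      nlinarith
    have e6 : 32 * B / m ^ 2 = B * L ^ 2 + B * L ^ 2 := by rw [hL]; ring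
    rw [e6]
    exact add_le_add h5 htail

end Quadrature

lemma integrable_remainderCoeff {d : ℕ} {F : (Fin d → ℝ) → ℂ} (hF : Integrable F)
    (h3 : FiniteFourierMoment 3 F) {n : (Fin d → ℝ) → ℝ} (hn : Continuous n)
    (hnle : ∀ ω, |n ω| ≤ l1norm ω) :
    Integrable (fun p : (Fin d → ℝ) × ℝ => remainderCoeff (n p.1) p.2 (F p.1))
      (volume.prod (volume.restrict (Set.Ioc (0 : ℝ) 1))) := by
  refine Integrable.mono' ((h3.comp_fst (volume.restrict (Set.Ioc (0 : ℝ) 1))).div_const 2) ?_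
    (Filter.Eventually.of_forall fun p => ?_)
  · have hc : Continuous fun q : (Fin d → ℝ) × ℝ =>
        -Complex.I * (n q.1 : ℂ) ^ 3 / 2 * Complex.exp (Complex.I * (n q.1 : ℂ) * q.2) := by
      fun_prop
    exact (hc.aestronglyMeasurable.mul hF.1.comp_fst).re
  · refine (abs_remainderCoeff_le _ _ _).trans ?_
    gcongr
    exact hnle _

/-- In dimension one, the Fourier remainder is an integral of `(±x - t)₊²` against bounded
densities. -/
lemma exists_density_of_dim_one {F : (Fin 1 → ℝ) → ℂ} (hF : Integrable F)
    (h3 : FiniteFourierMoment 3 F) : ∃ φ : Bool → ℝ → ℝ,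
      (∀ z, IntervalIntegrable (φ z) volume 0 1) ∧ (∀ z t, |φ z t| ≤ fourierMoment 3 F / 2) ∧
      ∀ x ∈ cube 1,
        (∫ ω, Complex.exp (Complex.I * ((x ⬝ᵥ ω : ℝ) : ℂ)) * F ω).re - (fourierTaylor F x).re =
          ∑ z, ∫ t in (0 : ℝ)..1, φ z t * (max (boolSign z * x 0 - t) 0) ^ 2 := by
  have hn : ∀ z, Continuous fun ω : Fin 1 → ℝ => boolSign z * ω 0 := fun z => by fun_prop
  have hnle : ∀ z, ∀ ω : Fin 1 → ℝ, |boolSign z * ω 0| ≤ l1norm ω := by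
    intro z ω
    have : |boolSign z| = 1 := by cases z <;> simp [boolSign]
    rw [abs_mul, this, one_mul]; simp [l1norm]
  have hci := fun z => integrable_remainderCoeff hF h3 (hn z) (hnle z)
  -- The ridge factor depends on `ω` only through the sign `z`, so `ω` is integrated out and a
  -- density in `t` remains.
  refine ⟨fun z t => ∫ ω, remainderCoeff (boolSign z * ω 0) t (F ω), fun z => ?_, fun z t => ?_,
    fun x hx => ?_⟩
  · rw [intervalIntegrable_iff_integrableOn_Ioc_of_le zero_le_one]
    exact (hci z).integral_prod_right
  · rw [← Real.norm_eq_abs]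
    have h : Integrable fun ω => l1norm ω ^ 3 * ‖F ω‖ / 2 := Integrable.div_const h3 2
    refine (norm_integral_le_of_norm_le h (Filter.Eventually.of_forall fun ω =>
      (abs_remainderCoeff_le _ _ _).trans ?_)).trans_eq ?_
    · gcongr
      exact hnle z ω
    · rw [integral_div, fourierMoment]
  · have hx0 : |x 0| ≤ 1 := mem_cube_iff_abs.1 hx 0
    have hm1 : Measurable fun ω : Fin 1 → ℝ => ω 0 := measurable_pi_apply 0
    have hm2 : Measurable fun _ : Fin 1 → ℝ => x 0 := measurable_const
    have hle1 : ∀ ω : Fin 1 → ℝ, |ω 0| ≤ l1norm ω := fun ω => by simp [l1norm]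
    have i1 := integrable_remainderKernel_mul hF h3 hm1 hm2 hle1 (fun _ => hx0)
    have i2 := integrable_remainderKernel_mul hF h3 (n := fun ω => -ω 0) (y := fun _ => -x 0)
      hm1.neg hm2.neg (by simpa using hle1) (by simpa using hx0)
    rw [← Complex.sub_re, integral_exp_sub_fourierTaylor hF h3 hm1 hm2 hle1 (fun _ => hx0) hx
      (fun ω => by simp [dotProduct, mul_comm])]
    refine (integral_re (𝕜 := ℂ) (i1.add i2)).symm.trans ?_
    have hterm : ∀ z, Integrable (fun p : (Fin 1 → ℝ) × ℝ =>
        remainderCoeff (boolSign z * p.1 0) p.2 (F p.1) *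
          (max (boolSign z * x 0 - p.2) 0) ^ 2)
        (volume.prod (volume.restrict (Set.Ioc (0 : ℝ) 1))) := by
      intro z
      cases z
      · simpa only [RCLike.re_to_complex, re_remainderKernel_mul, boolSign, Bool.false_eq_true,
          if_false, neg_mul, one_mul] using i2.re
      · simpa only [RCLike.re_to_complex, re_remainderKernel_mul, boolSign,
          if_true, one_mul] using i1.re
    have hswap : ∀ z, ∫ t in (0 : ℝ)..1, (∫ ω, remainderCoeff (boolSign z * ω 0) t (F ω)) *
        (max (boolSign z * x 0 - t) 0) ^ 2 = ∫ p : (Fin 1 → ℝ) × ℝ,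
          remainderCoeff (boolSign z * p.1 0) p.2 (F p.1) * (max (boolSign z * x 0 - p.2) 0) ^ 2
            ∂(volume.prod (volume.restrict (Set.Ioc (0 : ℝ) 1))) := by
      intro z
      rw [integral_prod_symm _ (hterm z), intervalIntegral.integral_of_le zero_le_one]
      simp only [integral_mul_const]
    rw [Fintype.sum_bool, hswap, hswap, ← integral_add (hterm _) (hterm _)]
    refine integral_congr_ae (Filter.Eventually.of_forall fun p => ?_)
    simp only [Pi.add_apply, RCLike.re_to_complex, Complex.add_re, re_remainderKernel_mul, boolSign,
      if_true, Bool.false_eq_true, if_false, one_mul, neg_mul]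

/-- The rate `m⁻²` in dimension one, with coefficients in `[-1,1]`. -/
theorem exists_sum_approx_of_dim_one {F : (Fin 1 → ℝ) → ℂ} (hF : Integrable F)
    (h3 : FiniteFourierMoment 3 F) (hV : 0 < fourierMoment 3 F) {m : ℕ} (hm : 1 ≤ m) :
    ∃ (b : Fin m → ℝ) (a : Fin m → Fin 1 → ℝ) (t : Fin m → ℝ), (∀ k, b k ∈ Set.Icc (-1 : ℝ) 1) ∧
      (∀ k, l1norm (a k) = 1) ∧ (∀ k, t k ∈ Set.Icc (0 : ℝ) 1) ∧ ∀ x ∈ cube 1,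
        |(∫ ω, Complex.exp (Complex.I * ((x ⬝ᵥ ω : ℝ) : ℂ)) * F ω).re - (fourierTaylor F x).re -
            fourierMoment 3 F / m * ∑ k, b k * (max (a k ⬝ᵥ x - t k) 0) ^ 2| ≤
          32 * fourierMoment 3 F / m ^ 2 := by
  obtain ⟨φ, hφi, hφB, hrep⟩ := exists_density_of_dim_one hF h3
  set V := fourierMoment 3 F
  have hm0 : (0 : ℝ) < m := by exact_mod_cast hm
  choose β τ hβ hτ happ using fun z => exists_point_masses (hφi z) (hφB z) hm
  have hcard : Fintype.card (Bool × Bool × Fin (m / 4)) ≤ Fintype.card (Fin m) := by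
    simp only [Fintype.card_prod, Fintype.card_bool, Fintype.card_fin]; omega
  obtain ⟨e⟩ := Function.Embedding.nonempty_of_card_le hcard
  set b' : Bool × Bool × Fin (m / 4) → ℝ := fun k => m / V * β k.1 k.2 with hb'
  set a' : Bool × Bool × Fin (m / 4) → Fin 1 → ℝ := fun k _ => boolSign k.1 with ha'
  set t' : Bool × Bool × Fin (m / 4) → ℝ := fun k => τ k.1 k.2 with ht'
  have hext : ∀ {α : Type} (P : α → Prop) (u : Bool × Bool × Fin (m / 4) → α) (w : α),
      (∀ k, P (u k)) → P w → ∀ k, P (Function.extend e u (fun _ => w) k) := by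
    intro α P u w hu hw k
    by_cases hk : ∃ i, e i = k
    · obtain ⟨i, rfl⟩ := hk
      rw [e.injective.extend_apply]; exact hu i
    · rw [Function.extend_apply' _ _ _ hk]; exact hw
  -- Unused slots get the coefficient `0`, which `[-1,1]` allows and `{-1,1}` would not.
  refine ⟨Function.extend e b' fun _ => 0, Function.extend e a' fun _ _ => 1,
    Function.extend e t' fun _ => 0, hext (· ∈ Set.Icc (-1 : ℝ) 1) _ _ ?_ (by simp),
    hext (fun a => l1norm a = 1) _ _ ?_ (by simp [l1norm]),
    hext (· ∈ Set.Icc (0 : ℝ) 1) _ _ (fun k => hτ _ _) (by simp), fun x hx => ?_⟩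
  · intro k
    rw [Set.mem_Icc, ← abs_le, hb', abs_mul, abs_of_pos (by positivity)]
    calc _ ≤ m / V * (V / 2 * (2 / m)) := by gcongr; exact hβ _ _
      _ = 1 := by field_simp
  · rintro ⟨z, -⟩
    cases z <;> simp [ha', l1norm, boolSign]
  · have hsum : ∑ k, Function.extend e b' (fun _ => 0) k *
        (max (Function.extend e a' (fun _ _ => 1) k ⬝ᵥ x -
          Function.extend e t' (fun _ => 0) k) 0) ^ 2 =
        ∑ k, b' k * (max (a' k ⬝ᵥ x - t' k) 0) ^ 2 := by
      refine (Fintype.sum_of_injective e e.injective _ _ (fun k hk => ?_) fun k => ?_).symm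
      · rw [Function.extend_apply' _ _ _ hk, zero_mul]
      · simp only [e.injective.extend_apply]
    have hsum' : V / m * ∑ k, b' k * (max (a' k ⬝ᵥ x - t' k) 0) ^ 2 =
        ∑ z, ∑ k, β z k * (max (boolSign z * x 0 - τ z k) 0) ^ 2 := by
      rw [Fintype.sum_prod_type, Finset.mul_sum]
      refine Finset.sum_congr rfl fun z _ => ?_
      rw [Finset.mul_sum]
      refine Finset.sum_congr rfl fun k _ => ?_
      simp only [hb', ha', ht', dotProduct, Fin.sum_univ_one]
      field_simp
    rw [hsum, hsum', hrep x hx, ← Finset.sum_sub_distrib]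
    have hx0 := abs_le.1 (mem_cube_iff_abs.1 hx 0)
    refine (Finset.abs_sum_le_sum_abs _ _).trans
      ((Finset.sum_le_sum (g := fun _ => 32 * (V / 2) / m ^ 2) fun z _ => happ z _ ?_).trans_eq ?_)
    · cases z <;> simp only [boolSign, if_true, Bool.false_eq_true, if_false] <;> linarith
    · simp only [Finset.sum_const, Finset.card_univ, Fintype.card_bool, nsmul_eq_mul]
      push_cast
      ring

/-! ### The degenerate case and the conclusion -/

/-- Almost everywhere `F ω = 0` or `ω = 0`, and at `ω = 0` the exponential equals its Taylor
polynomial. This case stands apart because the averaging argument divides the weights by `V`. -/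
lemma re_integral_exp_eq_of_fourierMoment_eq_zero {d : ℕ} {F : (Fin d → ℝ) → ℂ}
    (hF : Integrable F) (h3 : FiniteFourierMoment 3 F) (hV : fourierMoment 3 F = 0)
    {x : Fin d → ℝ} (hx : x ∈ cube d) :
    ∫ ω, Complex.exp (Complex.I * ((x ⬝ᵥ ω : ℝ) : ℂ)) * F ω = fourierTaylor F x := by
  have h0 : (fun ω => l1norm ω ^ 3 * ‖F ω‖) =ᵐ[volume] 0 :=
    (integral_eq_zero_iff_of_nonneg
      (fun ω => mul_nonneg (pow_nonneg (l1norm_nonneg ω) 3) (norm_nonneg _)) h3).1 hV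
  rw [← sub_eq_zero, fourierTaylor, ← integral_sub (integrable_exp_mul hF x)
    (integrable_fourierTaylor hF h3 hx)]
  refine integral_eq_zero_of_ae ?_
  filter_upwards [h0] with ω hω
  rcases mul_eq_zero.1 hω with h | h
  · have : ω = 0 := by
      by_contra hne
      exact (l1norm_pos hne).ne' (pow_eq_zero_iff (by norm_num) |>.1 h)
    simp [this]
  · simp [norm_eq_zero.1 h]

theorem theorem3 :
    ∃ c : ℝ, 0 < c ∧
      ∀ (d : ℕ), 1 ≤ d →
      ∀ (f : (Fin d → ℝ) → ℝ) (F : (Fin d → ℝ) → ℂ),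
        HasFourierRepresentationOn f F (cube d) →
        FiniteFourierMoment 3 F →
        ContDiffAt ℝ 2 f 0 ∧
        ∃ v : ℝ, 0 ≤ v ∧ v ≤ 2 * fourierMoment 3 F ∧
          ∀ (m : ℕ), 1 ≤ m →
            (∃ (b : Fin m → ℝ) (a : Fin m → Fin d → ℝ) (t : Fin m → ℝ),
              (∀ k, b k ∈ Set.Icc (-1 : ℝ) 1) ∧ (∀ k, l1norm (a k) = 1) ∧
              (∀ k, t k ∈ Set.Icc (0 : ℝ) 1) ∧
              ∀ x ∈ cube d,
                |f x - sqReLUCombination (f 0) (gradVec f 0) (hessMat f 0) v b a t x| ≤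
                  c * fourierMoment 3 F * √(d : ℝ) *
                    (m : ℝ) ^ (-(1 / 2 : ℝ) - 1 / (d : ℝ))) ∧
            (∃ (b : Fin m → ℝ) (a : Fin m → Fin d → ℝ) (t : Fin m → ℝ),
              (∀ k, b k = -1 ∨ b k = 1) ∧ (∀ k, l1norm (a k) = 1) ∧
              (∀ k, t k ∈ Set.Icc (0 : ℝ) 1) ∧
              ∀ x ∈ cube d,
                |f x - sqReLUCombination (f 0) (gradVec f 0) (hessMat f 0) v b a t x| ≤
                  c * fourierMoment 3 F * √(d : ℝ) *
                    (m : ℝ) ^ (-(1 / 2 : ℝ) - 1 / ((d : ℝ) + 2))) := by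
  obtain ⟨C, hC, havg⟩ := exists_ridge_average_fourier
  refine ⟨C + 32, by positivity, fun d hd f F hf h3 => ⟨hf.contDiffAt h3, ?_⟩⟩
  have hV0 : 0 ≤ fourierMoment 3 F := fourierMoment_nonneg 3
  refine ⟨2 * fourierMoment 3 F, by positivity, le_rfl, fun m hm => ?_⟩
  have hm0 : (0 : ℝ) < m := by exact_mod_cast hm
  have hm1 : (1 : ℝ) ≤ m := by exact_mod_cast hm
  have hdiff : ∀ (b : Fin m → ℝ) (a : Fin m → Fin d → ℝ) (t : Fin m → ℝ), ∀ x ∈ cube d,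
      f x - sqReLUCombination (f 0) (gradVec f 0) (hessMat f 0) (2 * fourierMoment 3 F) b a t x =
        (∫ ω, Complex.exp (Complex.I * ((x ⬝ᵥ ω : ℝ) : ℂ)) * F ω).re - (fourierTaylor F x).re -
          fourierMoment 3 F / m * ∑ k, b k * (max (a k ⬝ᵥ x - t k) 0) ^ 2 := by
    intro b a t x hx
    rw [sqReLUCombination, hf.taylor_eq h3, hf.eq_re hx, fourierSynthesis,
      mul_div_mul_left _ _ two_ne_zero]
    ring
  rcases hV0.eq_or_lt with hV | hV
  · obtain ⟨θ, hθ⟩ := ridgeParams_nonempty hd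
    have hzero : ∀ x ∈ cube d, |f x - sqReLUCombination (f 0) (gradVec f 0) (hessMat f 0)
        (2 * fourierMoment 3 F) (fun _ : Fin m => θ.1) (fun _ => θ.2.1) (fun _ => θ.2.2) x| ≤ 0 := by
      intro x hx
      rw [hdiff _ _ _ x hx, re_integral_exp_eq_of_fourierMoment_eq_zero hf.1 h3 hV.symm hx, ← hV]
      simp
    refine ⟨⟨fun _ => θ.1, fun _ => θ.2.1, fun _ => θ.2.2, fun _ => ?_, fun _ => hθ.2.1,
      fun _ => hθ.2.2, fun x hx => (hzero x hx).trans (by positivity)⟩,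
      ⟨fun _ => θ.1, fun _ => θ.2.1, fun _ => θ.2.2, fun _ => hθ.1, fun _ => hθ.2.1,
      fun _ => hθ.2.2, fun x hx => (hzero x hx).trans (by positivity)⟩⟩
    rcases hθ.1 with h | h <;> simp [h]
  · obtain ⟨η, hη, happ⟩ := havg d hd F hf.1 h3 hV m hm
    -- The same `±1` average serves both claims: since `m ≥ 1`, any exponent at least `-1/2 -
    -- 1/max(d,2)` is admissible. Only the first claim with `d = 1` falls outside.
    have hbound : ∀ e : ℝ, -(1 / 2 : ℝ) - 1 / ((max d 2 : ℕ) : ℝ) ≤ e → ∀ x ∈ cube d,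
        |f x - sqReLUCombination (f 0) (gradVec f 0) (hessMat f 0) (2 * fourierMoment 3 F)
          (fun k => (η k).1) (fun k => (η k).2.1) (fun k => (η k).2.2) x| ≤
            (C + 32) * fourierMoment 3 F * √(d : ℝ) * (m : ℝ) ^ e := by
      intro e he x hx
      rw [hdiff _ _ _ x hx]
      refine (happ x hx).trans ?_
      gcongr
      linarith
    refine ⟨?_, ⟨fun k => (η k).1, fun k => (η k).2.1, fun k => (η k).2.2, fun k => (hη k).1,
      fun k => (hη k).2.1, fun k => (hη k).2.2, hbound _ ?_⟩⟩
    · rcases hd.eq_or_lt with rfl | hd2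
      · obtain ⟨b, a, t, hb, ha, ht, h⟩ := exists_sum_approx_of_dim_one hf.1 h3 hV hm
        refine ⟨b, a, t, hb, ha, ht, fun x hx => ?_⟩
        rw [hdiff _ _ _ x hx]
        refine (h x hx).trans ?_
        have e1 : (32 : ℝ) * fourierMoment 3 F / m ^ 2 =
            32 * fourierMoment 3 F * √((1 : ℕ) : ℝ) * (m : ℝ) ^ (-2 : ℝ) := by
          rw [Real.rpow_neg hm0.le, Real.rpow_two]; simp [div_eq_mul_inv]
        rw [e1]
        gcongr
        · linarith
        · norm_num
      · refine ⟨fun k => (η k).1, fun k => (η k).2.1, fun k => (η k).2.2, fun k => ?_,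
          fun k => (hη k).2.1, fun k => (hη k).2.2, hbound _ ?_⟩
        · rcases (hη k).1 with h | h <;> simp [h]
        · rw [max_eq_left hd2]
    · have h1 : ((max d 2 : ℕ) : ℝ) ≤ (d : ℝ) + 2 := by
        exact_mod_cast (by omega : max d 2 ≤ d + 2)
      have h2 : (0 : ℝ) < ((max d 2 : ℕ) : ℝ) := by
        exact_mod_cast (by omega : 0 < max d 2)
      have := one_div_le_one_div_of_le h2 h1
      linarith
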